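/- Let $0\le k<n$ be integers. Let $o$ be a point of the round unit sphere $\mathbb S^{n+1}$ (the origin), let $\mathbb S^{n+1}_+$ be the open hemisphere centred at $o$, and write its metric in geodesic polar coordinates around $o$ as $d\rho^2+\phi(\rho)^2dz^2$, $\rho\in[0,\pi/2)$, $z\in\mathbb S^n$, with $\phi=\sin$, $\phi'=\cos$. For a hypersurface of $\mathbb S^{n+1}_+$ that encloses $o$, with outward unit normal $\nu$, let $\kappa_1,\dots,\kappa_n$ be its principal curvatures (with the sign for which small geodesic spheres have positive curvatures), $\sigma_j$ the $j$-th elementary symmetric function of them ($\sigma_0=1$), $F=\sigma_{k+1}/\sigma_k$, and $u=\langle\phi(\rho)\,\partial_\rho,\nu\rangle$. Let $c_{n,k}=\frac{n-k}{k+1}=\frac{\sigma_{k+1}(1,\dots,1)}{\sigma_k(1,\dots,1)}$. Let $M$ be a closed connected smooth $n$-manifold, $X_0:M\to\mathbb S^{n+1}_+$ a map, and $0<r_1$, $r_2<\pi/2$, $G$, $F_0$ real numbers. Then there is a constant $C>0$, depending only on $n,k$, the initial hypersurface $X_0$ (and $o$), $r_1,r_2,G,F_0$, such that the following holds for every $T\in(0,\infty]$.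 Let $X:M\times[0,T)\to\mathbb S^{n+1}_+$ be a smooth family of embedded, strictly convex (all $\kappa_i>0$) hypersurfaces $X(\cdot,t)$ that enclose $o$, with $X(\cdot,0)=X_0$, solving $$X_t=\Big(c_{n,k}\,\phi'(\rho)-\frac{\sigma_{k+1}}{\sigma_k}\,u\Big)\nu .$$ Suppose that, for all $t\in[0,T)$, one has on $X(M,t)$: $r_1\le\rho\le r_2$; $|\nabla\rho|\le G$, where the hypersurface is regarded as a radial graph $\rho=\rho(z)$, $z\in\mathbb S^n$, and the gradient is taken on the round $\mathbb S^n$; and $F\le F_0$. Then $$\kappa_i(\cdot,t)\ge\frac1C\qquad\text{for all }t\in[0,T)\text{ and }i=1,\dots,n .$$ -/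

import Mathlib

open scoped Manifold ContDiff Topology RealInnerProductSpace

noncomputable section

namespace SphereFlow

/-- The Euclidean space `ℝⁿ⁺²`, whose unit sphere is the round sphere `𝕊ⁿ⁺¹`. -/
abbrev Amb (n : ℕ) : Type := EuclideanSpace ℝ (Fin (n + 2))

/-! ### Geodesic polar coordinates of the sphere around the origin `o`

A point of the open hemisphere around the unit vector `o` is `cos ρ • o + sin ρ • z`, with
`ρ ∈ [0, π/2)` and `z` a unit vector orthogonal to `o`; the round metric is
`dρ² + φ(ρ)² dz²` with `φ = sin`, `φ' = cos`. -/

/-- The open hemisphere `𝕊ⁿ⁺¹₊` centred at `o`. -/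
def hemisphere {n : ℕ} (o : Amb n) : Set (Amb n) := {p | ‖p‖ = 1 ∧ 0 < ⟪o, p⟫}

/-- The radial coordinate `ρ`, the geodesic distance to `o`. -/
def rho {n : ℕ} (o p : Amb n) : ℝ := Real.arccos ⟪o, p⟫

/-- The angular coordinate `z`. -/
def ang {n : ℕ} (o p : Amb n) : Amb n :=
  (Real.sin (rho o p))⁻¹ • (p - Real.cos (rho o p) • o)

/-- The coordinate vector field `∂/∂ρ`. -/
def radialField {n : ℕ} (o p : Amb n) : Amb n :=
  Real.cos (rho o p) • ang o p - Real.sin (rho o p) • o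

/-- The conformal Killing field `V = φ(ρ) ∂/∂ρ`. -/
def conformalField {n : ℕ} (o p : Amb n) : Amb n :=
  Real.sin (rho o p) • radialField o p

/-- The generalized support function `u = ⟨V, ν⟩` at the point `p` with unit normal `ν`. -/
def support {n : ℕ} (o p ν : Amb n) : ℝ := ⟪conformalField o p, ν⟫

/-- The region of `𝕊ⁿ⁺¹` enclosed by `S` (a subset of the open hemisphere around `o`): the union
of the connected components of `𝕊ⁿ⁺¹ \ S` other than the one that contains the antipode `-o`
(and with it the whole opposite hemisphere). -/
def enclosed {n : ℕ} (o : Amb n) (S : Set (Amb n)) : Set (Amb n) :=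
  {p | p ∈ Metric.sphere (0 : Amb n) 1 \ S ∧
    -o ∉ connectedComponentIn (Metric.sphere (0 : Amb n) 1 \ S) p}

section Hypersurface

variable {n : ℕ} {M : Type*} [TopologicalSpace M] [ChartedSpace (EuclideanSpace ℝ (Fin n)) M]

/-- The differential at `x` of a map from the `n`-manifold `M` to a normed space, as a linear map
on the tangent space `T_x M`, which is the model space `ℝⁿ`. -/
def diff {E : Type*} [NormedAddCommGroup E] [NormedSpace ℝ E] (f : M → E) (x : M) :
    EuclideanSpace ℝ (Fin n) →L[ℝ] E :=
  mfderiv (𝓡 n) 𝓘(ℝ, E) f x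

/-- The induced metric `g_{ij} = ⟨dX(e_i), dX(e_j)⟩`, in the standard basis of `T_x M`. -/
def metric (X : M → Amb n) (x : M) : Matrix (Fin n) (Fin n) ℝ :=
  Matrix.of fun i j => ⟪diff X x (EuclideanSpace.single i 1), diff X x (EuclideanSpace.single j 1)⟫

/-- The second fundamental form `h_{ij} = ⟨dν(e_i), dX(e_j)⟩` for the unit normal field `ν`,
with the sign for which geodesic spheres are convex with respect to the outward normal. -/
def secondForm (X ν : M → Amb n) (x : M) : Matrix (Fin n) (Fin n) ℝ :=
  Matrix.of fun i j => ⟪diff ν x (EuclideanSpace.single i 1), diff X x (EuclideanSpace.single j 1)⟫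

/-- The principal curvatures `κ_1, …, κ_n` at `x`: the eigenvalues, with multiplicity, of the
Weingarten map `g⁻¹ h`. -/
def principalCurvatures (X ν : M → Amb n) (x : M) : Multiset ℝ :=
  ((metric X x)⁻¹ * secondForm X ν x).charpoly.roots

/-- `σ_k(κ)`, the `k`-th elementary symmetric function of the principal curvatures. -/
def sigma (k : ℕ) (X ν : M → Amb n) (x : M) : ℝ := (principalCurvatures X ν x).esymm k

/-- `F = σ_{k+1}(κ) / σ_k(κ)`. -/
def curvQuot (k : ℕ) (X ν : M → Amb n) (x : M) : ℝ := sigma (k + 1) X ν x / sigma k X ν x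

/-- `X` is a smooth embedding of the closed manifold `M` as a hypersurface of the open hemisphere
around `o` that encloses the origin `o`, and `ν` is its outward unit normal field. -/
structure IsEnclosingHypersurface (o : Amb n) (X ν : M → Amb n) : Prop where
  smooth : ContMDiff (𝓡 n) 𝓘(ℝ, Amb n) ∞ X
  mem_hemisphere : ∀ x, X x ∈ hemisphere o
  injective : Function.Injective X
  immersion : ∀ x, Function.Injective (diff (n := n) X x)
  smooth_normal : ContMDiff (𝓡 n) 𝓘(ℝ, Amb n) ∞ ν
  unit_normal : ∀ x, ‖ν x‖ = 1
  tangent_sphere : ∀ x, ⟪X x, ν x⟫ = 0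
  normal : ∀ x, ∀ v : EuclideanSpace ℝ (Fin n), ⟪diff X x v, ν x⟫ = 0
  encloses_origin : o ∈ enclosed o (Set.range X)
  /-- The geodesic that starts at `X x` in the direction `ν x` leaves the enclosed region. -/
  outward : ∀ x, ∀ᶠ s : ℝ in 𝓝[>] 0,
    Real.cos s • X x + Real.sin s • ν x ∉ enclosed o (Set.range X)

/-- Strict convexity: all principal curvatures (for the outward normal) are positive. -/
def IsStrictlyConvex (X ν : M → Amb n) : Prop :=
  ∀ x, ∀ κ ∈ principalCurvatures X ν x, 0 < κ

/-- The gradient estimate `|∇ρ| ≤ G`, where the hypersurface is the graph of `ρ` in polar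
coordinates and `ρ` is differentiated as a function of the angular coordinate `z ∈ 𝕊ⁿ` (with its
round metric). By the chain rule this reads `|d(ρ ∘ X)(v)| ≤ G |d(z ∘ X)(v)|` for all tangent
vectors `v`. -/
def RadialGradientBound (o : Amb n) (X : M → Amb n) (G : ℝ) : Prop :=
  ∀ x, ∀ v : EuclideanSpace ℝ (Fin n), |diff (fun y => rho o (X y)) x v| ≤ G * ‖diff (fun y => ang o (X y)) x v‖

/-- The time interval `[0, T)`, where `T` may be `∞`. -/
def timeInterval (T : EReal) : Set ℝ := {t | 0 ≤ t ∧ (t : EReal) < T}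

/-- `X` is a smooth solution on `[0, T)`, by closed strictly convex hypersurfaces that enclose the
origin `o` and have outward unit normal `ν`, of the flow
`X_t = (c_{n,k} φ'(ρ) - u σ_{k+1}/σ_k) ν`, where `c_{n,k} = σ_{k+1}(1,…,1)/σ_k(1,…,1)`, which is
`(n-k)/(k+1)`. -/
structure IsConvexSolution (k : ℕ) (o : Amb n) (T : EReal) (X ν : ℝ → M → Amb n) : Prop where
  smooth : ContMDiffOn ((𝓡 n).prod 𝓘(ℝ, ℝ)) 𝓘(ℝ, Amb n) ∞
    (fun p : M × ℝ => X p.2 p.1) (Set.univ ×ˢ timeInterval T)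
  smooth_normal : ContMDiffOn ((𝓡 n).prod 𝓘(ℝ, ℝ)) 𝓘(ℝ, Amb n) ∞
    (fun p : M × ℝ => ν p.2 p.1) (Set.univ ×ˢ timeInterval T)
  hypersurface : ∀ t ∈ timeInterval T, IsEnclosingHypersurface o (X t) (ν t)
  strictlyConvex : ∀ t ∈ timeInterval T, IsStrictlyConvex (X t) (ν t)
  flow : ∀ t ∈ timeInterval T, ∀ x,
    HasDerivWithinAt (fun s => X s x)
      ((((n : ℝ) - k) / (k + 1) * Real.cos (rho o (X t x))
        - curvQuot k (X t) (ν t) x * support o (X t x) (ν t x)) • ν t x)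
      (timeInterval T) t

end Hypersurface

end SphereFlow

end

/-!
The radii of curvature `1 / κ i` are compared with the barrier `C₀ (φ' - μ / 2 + (μ / 8) u)`, where
`μ = cos r₂`, `φ' = ⟪o, X⟫` and `u = -⟪o, ν⟫`. The barrier is positive and at most `C₀`, so it is
enough that the radii stay below it. They do initially if `C₀` is large, because the initial
hypersurface is closed and strictly convex (`IsConvexSolution.exists_initial_bound`); that the unit
normal is determined by the map (`IsEnclosingHypersurface.normal_unique`) makes this depend on `X₀`
only. Being below the barrier is an open condition on a compact manifold, so a violation has a first
time (`IsConvexSolution.radiiLT_barrier`), and the maximum principle excludes it.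

At a first touching point the hypersurface is written in the coordinates given by its Gauss map
(`NormalForm`): there the coordinates of a point are the components of its normal in a frame of
principal directions. The quotient `⟪∂ₘX, ∂ₘN⟫ / ⟪∂ₘN, ∂ₘN⟫`, for the index `m` of the largest
radius at the point, is a smooth lower bound for the largest radius nearby, with equality at the
point. In these coordinates the second derivatives of `N` at the point are explicit, and the
Codazzi equations, Simons' identity and the evolution of the second fundamental form are
consequences of the symmetry of higher derivatives of `X` and `N`.

The second derivatives of the speed are controlled by the inverse concavity of
`F = σ_{k+1} / σ_k`: as a function of the radii, `1 / F` has a supporting linear function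
(`exists_supergradient_inv_symmQuot`). Applied to the diagonal entries of the inverse Weingarten map
in a frame moved along by rotations, with a Schur type inequality to pass from eigenvalues to
diagonal entries (`inv_symmQuot_le_sum_sq`), it becomes a smooth function that touches `1 / F` from
above at the point (`supportFun`, `inv_symmQuot_le_supportFun`). With `l` the coefficients of the
linear function and `λ` the radii, `S₁ = ∑ l i`, `S₂ = ∑ l i * λ i ^ 2`, the derivative tests for the
barrier and for the speed combine (`maximum_principle_algebra`) to an inequality in which `λ m` is
the value of the barrier. The trace bound `c ≤ F ^ 2 * S₂` (`le_sq_mul_sum_supergradient`), with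
`c = c_{n,k}`, and `c ≤ λ m * F` make the terms of order `C₀` nonpositive except for
`-C₀ (μ / 8) c φ' ^ 2`, which beats the bounded terms when `C₀` is large
(`maximum_principle_contradiction`).

The argument needs `u ≥ u₀ > 0`. The gradient bound gives `u ^ 2` a positive lower bound
(`le_sq_inner_normal`), so `u` has no zeros and its sign is constant on the connected hypersurface; it
is positive at the point farthest from `o`, by strict convexity
(`IsEnclosingHypersurface.inner_normal_neg_of_isMin`).
-/

noncomputable section

namespace SphereFlow

/-! ### Quotients of elementary symmetric functions -/

section SymmetricFunctions

set_option linter.unusedSectionVars false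

variable {ι : Type*} [DecidableEq ι]

/-- The `m`-th elementary symmetric function of the numbers `x i`, `i ∈ S`. -/
def elemSymm (S : Finset ι) (m : ℕ) (x : ι → ℝ) : ℝ :=
  ∑ t ∈ S.powersetCard m, ∏ i ∈ t, x i

/-- The quotient `σ_{m+1} / σ_m` of the numbers `x i`, `i ∈ S`. -/
def symmQuot (S : Finset ι) (m : ℕ) (x : ι → ℝ) : ℝ :=
  elemSymm S (m + 1) x / elemSymm S m x

lemma elemSymm_pos {S : Finset ι} {m : ℕ} (hm : m ≤ S.card) {x : ι → ℝ} (hx : ∀ i, 0 < x i) :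
    0 < elemSymm S m x :=
  Finset.sum_pos (fun _ _ => Finset.prod_pos fun i _ => hx i) (Finset.powersetCard_nonempty.2 hm)

lemma symmQuot_pos {S : Finset ι} {m : ℕ} (hm : m + 1 ≤ S.card) {x : ι → ℝ} (hx : ∀ i, 0 < x i) :
    0 < symmQuot S m x :=
  div_pos (elemSymm_pos hm hx) (elemSymm_pos (by omega) hx)

lemma elemSymm_succ {S : Finset ι} {i : ι} (hi : i ∈ S) (m : ℕ) (x : ι → ℝ) :
    elemSymm S (m + 1) x =
      elemSymm (S.erase i) (m + 1) x + x i * elemSymm (S.erase i) m x := by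
  have hni : i ∉ S.erase i := Finset.notMem_erase i S
  conv_lhs => rw [← Finset.insert_erase hi]
  unfold elemSymm
  rw [Finset.powersetCard_succ_insert hni, Finset.sum_union, Finset.sum_image, Finset.mul_sum]
  · congr 1
    refine Finset.sum_congr rfl fun t ht => ?_
    rw [Finset.prod_insert]
    exact fun h => hni ((Finset.mem_powersetCard.1 ht).1 h)
  · intro t ht t' ht' h
    have h1 : i ∉ t := fun h => hni ((Finset.mem_powersetCard.1 ht).1 h)
    have h2 : i ∉ t' := fun h => hni ((Finset.mem_powersetCard.1 ht').1 h)
    rw [← Finset.erase_insert h1, ← Finset.erase_insert h2, h]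
  · rw [Finset.disjoint_left]
    intro t ht ht'
    obtain ⟨s, -, rfl⟩ := Finset.mem_image.1 ht'
    exact hni ((Finset.mem_powersetCard.1 ht).1 (Finset.mem_insert_self i s))

/-- Euler's relation for elementary symmetric functions. -/
lemma sum_mul_elemSymm_erase (S : Finset ι) (m : ℕ) (x : ι → ℝ) :
    ∑ i ∈ S, x i * elemSymm (S.erase i) m x = (m + 1) * elemSymm S (m + 1) x := by
  have h1 : ∀ i ∈ S, x i * elemSymm (S.erase i) m x =
      ∑ t ∈ S.powersetCard (m + 1), if i ∈ t then ∏ j ∈ t, x j else 0 := by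
    intro i hi
    have h2 := elemSymm_succ hi m x
    have h3 : elemSymm (S.erase i) (m + 1) x =
        ∑ t ∈ S.powersetCard (m + 1), if i ∈ t then 0 else ∏ j ∈ t, x j := by
      unfold elemSymm
      rw [Finset.sum_ite, Finset.sum_const_zero, zero_add]
      refine Finset.sum_congr ?_ fun _ _ => rfl
      ext t
      simp only [Finset.mem_powersetCard, Finset.mem_filter, Finset.subset_erase]
      tauto
    have h4 : elemSymm S (m + 1) x = ∑ t ∈ S.powersetCard (m + 1),
        ((if i ∈ t then 0 else ∏ j ∈ t, x j) + if i ∈ t then ∏ j ∈ t, x j else 0) := by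
      unfold elemSymm
      refine Finset.sum_congr rfl fun t _ => ?_
      split_ifs <;> simp
    rw [Finset.sum_add_distrib] at h4
    linarith
  rw [Finset.sum_congr rfl h1, Finset.sum_comm]
  unfold elemSymm
  rw [Finset.mul_sum]
  refine Finset.sum_congr rfl fun t ht => ?_
  obtain ⟨hts, htc⟩ := Finset.mem_powersetCard.1 ht
  rw [← Finset.sum_filter, Finset.filter_mem_eq_inter, Finset.inter_eq_right.2 hts,
    Finset.sum_const, htc, nsmul_eq_mul]
  push_cast
  ring

lemma symmQuot_zero (S : Finset ι) (x : ι → ℝ) : symmQuot S 0 x = ∑ i ∈ S, x i := by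
  unfold symmQuot
  have h := sum_mul_elemSymm_erase S 0 x
  have h0 : ∀ T : Finset ι, elemSymm T 0 x = 1 := fun T => by simp [elemSymm]
  simp only [h0, mul_one, Nat.cast_zero, zero_add, one_mul] at h
  rw [h0, h]
  simp

/-- The recursion that carries the concavity properties of `σ_{m+1} / σ_m` from `m` to `m + 1`:
the quotient is a mean of harmonic sums of `x i` and the quotient of the remaining variables. -/
lemma symmQuot_succ {S : Finset ι} {m : ℕ} (hm : m + 2 ≤ S.card) {x : ι → ℝ} (hx : ∀ i, 0 < x i) :
    symmQuot S (m + 1) x = ((m : ℝ) + 2)⁻¹ *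
      ∑ i ∈ S, x i * symmQuot (S.erase i) m x / (x i + symmQuot (S.erase i) m x) := by
  have h := sum_mul_elemSymm_erase S (m + 1) x
  have hpos := elemSymm_pos (S := S) (m := m + 1) (by omega) hx
  have h2 : elemSymm S (m + 1 + 1) x =
      ((m : ℝ) + 2)⁻¹ * ∑ i ∈ S, x i * elemSymm (S.erase i) (m + 1) x := by
    rw [h]
    push_cast
    field_simp
    ring
  unfold symmQuot
  rw [h2, mul_div_assoc, Finset.sum_div]
  congr 1
  refine Finset.sum_congr rfl fun i hi => ?_
  have hc : (S.erase i).card = S.card - 1 := Finset.card_erase_of_mem hi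
  have h3 := elemSymm_pos (S := S.erase i) (m := m) (by omega) hx
  have h4 := elemSymm_pos (S := S.erase i) (m := m + 1) (by omega) hx
  have h5 := elemSymm_succ hi m x
  have h6 := hx i
  rw [h5]
  field_simp
  ring

/-- The harmonic sum `a b / (a + b)` is concave: it lies below its tangent plane at `(a₀, b₀)`. -/
lemma mul_div_add_le {a b a₀ b₀ : ℝ} (ha : 0 < a) (hb : 0 < b) (ha₀ : 0 < a₀) (hb₀ : 0 < b₀) :
    a * b / (a + b) ≤ (b₀ / (a₀ + b₀)) ^ 2 * a + (a₀ / (a₀ + b₀)) ^ 2 * b := by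
  rw [div_le_iff₀ (by positivity)]
  have h : ((b₀ / (a₀ + b₀)) ^ 2 * a + (a₀ / (a₀ + b₀)) ^ 2 * b) * (a + b) - a * b =
      ((b₀ * a - a₀ * b) / (a₀ + b₀)) ^ 2 := by
    field_simp
    ring
  nlinarith [sq_nonneg ((b₀ * a - a₀ * b) / (a₀ + b₀))]

/-- `σ_{m+1} / σ_m` is concave, in the form of a supporting linear function at each point `x` of
the positive cone (the function is homogeneous of degree one). -/
lemma exists_supergradient_symmQuot (m : ℕ) : ∀ (S : Finset ι), m + 1 ≤ S.card → ∀ x : ι → ℝ,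
    (∀ i, 0 < x i) → ∃ l : ι → ℝ, (∀ i, 0 ≤ l i) ∧
      (∀ y : ι → ℝ, (∀ i, 0 < y i) → symmQuot S m y ≤ ∑ i ∈ S, l i * y i) ∧
      symmQuot S m x = ∑ i ∈ S, l i * x i := by
  induction m with
  | zero =>
    intro S _ x _
    exact ⟨fun _ => 1, fun _ => zero_le_one, fun y _ => by simp [symmQuot_zero],
      by simp [symmQuot_zero]⟩
  | succ m ih =>
    intro S hS x hx
    have hcard : ∀ i ∈ S, m + 1 ≤ (S.erase i).card := fun i hi => by
      rw [Finset.card_erase_of_mem hi]; omega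
    have key : ∀ i, ∃ l : ι → ℝ, (∀ j, 0 ≤ l j) ∧ (i ∈ S →
        (∀ y : ι → ℝ, (∀ i, 0 < y i) → symmQuot (S.erase i) m y ≤ ∑ j ∈ S.erase i, l j * y j) ∧
        symmQuot (S.erase i) m x = ∑ j ∈ S.erase i, l j * x j) := by
      intro i
      by_cases hi : i ∈ S
      · obtain ⟨l, h1, h2, h3⟩ := ih (S.erase i) (hcard i hi) x hx
        exact ⟨l, h1, fun _ => ⟨h2, h3⟩⟩
      · exact ⟨fun _ => 0, fun _ => le_rfl, fun h => absurd h hi⟩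
    choose l hl0 hl using key
    set r : ι → ℝ := fun i => symmQuot (S.erase i) m x with hr
    -- `p i` and `q i` are the partial derivatives of `a b / (a + b)` at `(x i, r i)`.
    set p : ι → ℝ := fun i => (r i / (x i + r i)) ^ 2 with hp
    set q : ι → ℝ := fun i => (x i / (x i + r i)) ^ 2 with hq
    -- The tangent planes, combined according to the recursion and regrouped by variables.
    have hre : ∀ y : ι → ℝ, ((m : ℝ) + 2)⁻¹ *
        ∑ i ∈ S, (p i * y i + q i * ∑ j ∈ S.erase i, l i j * y j) =
        ∑ j ∈ S, (((m : ℝ) + 2)⁻¹ * (p j + ∑ i ∈ S.erase j, q i * l i j)) * y j := by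
      intro y
      rw [Finset.mul_sum]
      simp only [mul_add, add_mul, Finset.sum_add_distrib, Finset.mul_sum, Finset.sum_mul]
      congr 1
      · exact Finset.sum_congr rfl fun i _ => by ring
      · have e : ∀ g : ι → ι → ℝ, ∑ i ∈ S, ∑ j ∈ S.erase i, g i j =
            ∑ j ∈ S, ∑ i ∈ S.erase j, g i j := by
          intro g
          refine Finset.sum_comm' fun a b => ?_
          simp only [Finset.mem_erase]
          constructor
          · rintro ⟨h1, h2, h3⟩; exact ⟨⟨Ne.symm h2, h1⟩, h3⟩
          · rintro ⟨⟨h1, h2⟩, h3⟩; exact ⟨h2, Ne.symm h1, h3⟩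
        rw [e]
        exact Finset.sum_congr rfl fun j _ => Finset.sum_congr rfl fun i _ => by ring
    refine ⟨fun j => ((m : ℝ) + 2)⁻¹ * (p j + ∑ i ∈ S.erase j, q i * l i j), ?_, ?_, ?_⟩
    · intro j
      have : 0 ≤ ∑ i ∈ S.erase j, q i * l i j :=
        Finset.sum_nonneg fun i _ => mul_nonneg (sq_nonneg _) (hl0 i j)
      have : 0 ≤ p j := sq_nonneg _
      positivity
    · intro y hy
      rw [symmQuot_succ (by omega) hy, ← hre]
      gcongr with i hi
      refine (mul_div_add_le (hy i) (symmQuot_pos (hcard i hi) hy) (hx i)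
        (symmQuot_pos (hcard i hi) hx)).trans ?_
      have := ((hl i) hi).1 y hy
      have h2 : 0 ≤ q i := sq_nonneg _
      exact add_le_add le_rfl (mul_le_mul_of_nonneg_left this h2)
    · rw [symmQuot_succ (by omega) hx, ← hre]
      congr 1
      refine Finset.sum_congr rfl fun i hi => ?_
      rw [← ((hl i) hi).2]
      have h1 := symmQuot_pos (hcard i hi) hx
      have h2 := hx i
      simp only [hp, hq, hr]
      field_simp
      ring

/-- The harmonic sum `(∑ H i)⁻¹` is concave in the reciprocals `(H i)⁻¹`. -/
lemma inv_sum_le {S : Finset ι} {H w : ι → ℝ} (hH : ∀ i ∈ S, 0 < H i) (hS : S.Nonempty)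
    (hw : ∑ i ∈ S, w i = 1) : (∑ i ∈ S, H i)⁻¹ ≤ ∑ i ∈ S, w i ^ 2 * (H i)⁻¹ := by
  have hpos : 0 < ∑ i ∈ S, H i := Finset.sum_pos hH hS
  have h := Finset.sum_sq_le_sum_mul_sum_of_sq_le_mul S (r := w) (f := H)
    (g := fun i => w i ^ 2 * (H i)⁻¹) (fun i hi => (hH i hi).le)
    (fun i hi => by have := hH i hi; positivity)
    (fun i hi => by have := hH i hi; field_simp; rfl)
  rw [hw] at h
  rw [inv_le_iff_one_le_mul₀ hpos]
  linarith

/-- `σ_{m+1} / σ_m` is inverse concave: its reciprocal, as a function of the reciprocals of the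
variables, has a supporting linear function at each point of the positive cone. -/
lemma exists_supergradient_inv_symmQuot (m : ℕ) : ∀ (S : Finset ι), m + 1 ≤ S.card →
    ∀ x : ι → ℝ, (∀ i, 0 < x i) → ∃ l : ι → ℝ, (∀ i, 0 ≤ l i) ∧
      (∀ y : ι → ℝ, (∀ i, 0 < y i) → (symmQuot S m y)⁻¹ ≤ ∑ i ∈ S, l i * (y i)⁻¹) ∧
      (symmQuot S m x)⁻¹ = ∑ i ∈ S, l i * (x i)⁻¹ := by
  induction m with
  | zero =>
    intro S hS x hx
    have hne : S.Nonempty := Finset.card_pos.1 (by omega)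
    have hpos : 0 < ∑ i ∈ S, x i := Finset.sum_pos (fun i _ => hx i) hne
    refine ⟨fun i => (x i / ∑ i ∈ S, x i) ^ 2, fun _ => sq_nonneg _, fun y hy => ?_, ?_⟩
    · rw [symmQuot_zero]
      refine inv_sum_le (fun i _ => hy i) hne ?_
      rw [← Finset.sum_div, div_self hpos.ne']
    · rw [symmQuot_zero]
      have : ∀ i ∈ S, (x i / ∑ i ∈ S, x i) ^ 2 * (x i)⁻¹ = ((∑ i ∈ S, x i) ^ 2)⁻¹ * x i := by
        intro i _
        have := hx i
        field_simp
      rw [Finset.sum_congr rfl this, ← Finset.mul_sum]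
      field_simp
  | succ m ih =>
    intro S hS x hx
    have hne : S.Nonempty := Finset.card_pos.1 (by omega)
    have hcard : ∀ i ∈ S, m + 1 ≤ (S.erase i).card := fun i hi => by
      rw [Finset.card_erase_of_mem hi]; omega
    have key : ∀ i, ∃ l : ι → ℝ, (∀ j, 0 ≤ l j) ∧ (i ∈ S →
        (∀ y : ι → ℝ, (∀ i, 0 < y i) →
          (symmQuot (S.erase i) m y)⁻¹ ≤ ∑ j ∈ S.erase i, l j * (y j)⁻¹) ∧
        (symmQuot (S.erase i) m x)⁻¹ = ∑ j ∈ S.erase i, l j * (x j)⁻¹) := by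
      intro i
      by_cases hi : i ∈ S
      · obtain ⟨l, h1, h2, h3⟩ := ih (S.erase i) (hcard i hi) x hx
        exact ⟨l, h1, fun _ => ⟨h2, h3⟩⟩
      · exact ⟨fun _ => 0, fun _ => le_rfl, fun h => absurd h hi⟩
    choose l hl0 hl using key
    have hrpos : ∀ y : ι → ℝ, (∀ i, 0 < y i) → ∀ i ∈ S, 0 < symmQuot (S.erase i) m y :=
      fun y hy i hi => symmQuot_pos (hcard i hi) hy
    -- `H y i` is the `i`-th term of the recursion; its reciprocal is affine in the reciprocals of
    -- `y i` and of the quotient of the remaining variables.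
    set H : (ι → ℝ) → ι → ℝ := fun y i =>
      ((m : ℝ) + 2)⁻¹ * (y i * symmQuot (S.erase i) m y / (y i + symmQuot (S.erase i) m y)) with hH
    have hHpos : ∀ y : ι → ℝ, (∀ i, 0 < y i) → ∀ i ∈ S, 0 < H y i := by
      intro y hy i hi
      have := hrpos y hy i hi
      have := hy i
      simp only [hH]
      positivity
    have hHinv : ∀ y : ι → ℝ, (∀ i, 0 < y i) → ∀ i ∈ S,
        (H y i)⁻¹ = ((m : ℝ) + 2) * ((y i)⁻¹ + (symmQuot (S.erase i) m y)⁻¹) := by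
      intro y hy i hi
      have := hrpos y hy i hi
      have := hy i
      simp only [hH]
      field_simp
      ring
    have hquot : ∀ y : ι → ℝ, (∀ i, 0 < y i) → symmQuot S (m + 1) y = ∑ i ∈ S, H y i := by
      intro y hy
      rw [symmQuot_succ (by omega) hy, Finset.mul_sum]
    have hsum : 0 < ∑ i ∈ S, H x i := Finset.sum_pos (hHpos x hx) hne
    -- With these weights `inv_sum_le` is an equality at `x`.
    set w : ι → ℝ := fun i => H x i / ∑ i ∈ S, H x i with hw
    have hw1 : ∑ i ∈ S, w i = 1 := by rw [← Finset.sum_div, div_self hsum.ne']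
    have hre : ∀ y : ι → ℝ,
        ∑ i ∈ S, w i ^ 2 * (((m : ℝ) + 2) * ((y i)⁻¹ + ∑ j ∈ S.erase i, l i j * (y j)⁻¹)) =
        ∑ j ∈ S, (((m : ℝ) + 2) * (w j ^ 2 + ∑ i ∈ S.erase j, w i ^ 2 * l i j)) * (y j)⁻¹ := by
      intro y
      generalize (m : ℝ) + 2 = c
      simp only [mul_add, add_mul, Finset.sum_add_distrib, Finset.mul_sum, Finset.sum_mul]
      congr 1
      · exact Finset.sum_congr rfl fun i _ => by ring
      · have e : ∀ g : ι → ι → ℝ, ∑ i ∈ S, ∑ j ∈ S.erase i, g i j =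
            ∑ j ∈ S, ∑ i ∈ S.erase j, g i j := by
          intro g
          refine Finset.sum_comm' fun a b => ?_
          simp only [Finset.mem_erase]
          constructor
          · rintro ⟨h1, h2, h3⟩; exact ⟨⟨Ne.symm h2, h1⟩, h3⟩
          · rintro ⟨⟨h1, h2⟩, h3⟩; exact ⟨h2, Ne.symm h1, h3⟩
        rw [e]
        exact Finset.sum_congr rfl fun j _ => Finset.sum_congr rfl fun i _ => by ring
    refine ⟨fun j => ((m : ℝ) + 2) * (w j ^ 2 + ∑ i ∈ S.erase j, w i ^ 2 * l i j), ?_, ?_, ?_⟩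
    · intro j
      have : 0 ≤ ∑ i ∈ S.erase j, w i ^ 2 * l i j :=
        Finset.sum_nonneg fun i _ => mul_nonneg (sq_nonneg _) (hl0 i j)
      positivity
    · intro y hy
      rw [hquot y hy, ← hre]
      refine (inv_sum_le (hHpos y hy) hne hw1).trans (Finset.sum_le_sum fun i hi => ?_)
      rw [hHinv y hy i hi]
      have := ((hl i) hi).1 y hy
      gcongr
    · rw [hquot x hx, ← hre]
      have : ∀ i ∈ S, w i ^ 2 * (((m : ℝ) + 2) * ((x i)⁻¹ + ∑ j ∈ S.erase i, l i j * (x j)⁻¹)) =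
          ((∑ i ∈ S, H x i) ^ 2)⁻¹ * H x i := by
        intro i hi
        rw [← ((hl i) hi).2, ← hHinv x hx i hi]
        have := hHpos x hx i hi
        simp only [hw]
        field_simp
      rw [Finset.sum_congr rfl this, ← Finset.mul_sum S (fun i => H x i)]
      rw [pow_two, mul_inv, mul_assoc, inv_mul_cancel₀ hsum.ne', mul_one]

/-- `c_{n,k} = (n - k) / (k + 1)` is the value of `σ_{k+1} / σ_k` at `(1, …, 1)`. -/
lemma symmQuot_const_one {n k : ℕ} (hk : k < n) :
    symmQuot (Finset.univ : Finset (Fin n)) k (fun _ => 1) = ((n : ℝ) - k) / (k + 1) := by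
  have h : ∀ m, elemSymm (Finset.univ : Finset (Fin n)) m (fun _ => 1) = (n.choose m : ℝ) := by
    intro m
    simp [elemSymm, Finset.card_powersetCard]
  unfold symmQuot
  rw [h, h]
  have h2 : (n.choose (k + 1) : ℝ) * (k + 1) = n.choose k * ((n : ℝ) - k) := by
    have := Nat.choose_succ_right_eq n k
    rw [← Nat.cast_sub hk.le]
    exact_mod_cast this
  have h3 : (0 : ℝ) < n.choose k := by exact_mod_cast Nat.choose_pos hk.le
  field_simp
  linarith

lemma symmQuot_perm {n : ℕ} (m : ℕ) (x : Fin n → ℝ) (p : Equiv.Perm (Fin n)) :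
    symmQuot Finset.univ m (fun i => x (p i)) = symmQuot Finset.univ m x := by
  have h : ∀ m, elemSymm Finset.univ m (fun i => x (p i)) = elemSymm Finset.univ m x := by
    intro m
    have h1 : elemSymm Finset.univ m x = (Finset.univ.val.map x).esymm m :=
      (Finset.esymm_map_val x Finset.univ m).symm
    have h2 : elemSymm Finset.univ m (fun i => x (p i)) =
        (Finset.univ.val.map fun i => x (p i)).esymm m :=
      (Finset.esymm_map_val _ Finset.univ m).symm
    rw [h1, h2]
    congr 1
    have : (Finset.univ : Finset (Fin n)).val.map (fun i => x (p i)) =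
        ((Finset.univ : Finset (Fin n)).val.map p).map x := by rw [Multiset.map_map]; rfl
    rw [this]
    congr 1
    have := Finset.map_univ_equiv p
    exact congrArg Finset.val this
  unfold symmQuot
  rw [h, h]

/-- The quotient dominates the smallest entry times its value at `(1, …, 1)`. -/
lemma mul_le_symmQuot {n k : ℕ} (hk : k < n) {x : Fin n → ℝ} (hx : ∀ i, 0 < x i) {a : ℝ}
    (ha : ∀ i, a ≤ x i) : ((n : ℝ) - k) / (k + 1) * a ≤ symmQuot Finset.univ k x := by
  obtain ⟨l, h0, h1, h2⟩ := exists_supergradient_symmQuot k (Finset.univ : Finset (Fin n))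
    (by simpa using hk) x hx
  have h3 := h1 (fun _ => 1) (fun _ => one_pos)
  rw [symmQuot_const_one hk] at h3
  have h4 : ∑ i, l i * a ≤ ∑ i, l i * x i :=
    Finset.sum_le_sum fun i _ => mul_le_mul_of_nonneg_left (ha i) (h0 i)
  rcases le_or_gt 0 a with h | h
  · rw [h2]
    refine le_trans (mul_le_mul_of_nonneg_right h3 h) ?_
    rw [Finset.sum_mul]
    simpa using h4
  · have h5 : 0 < symmQuot Finset.univ k x :=
      symmQuot_pos (S := (Finset.univ : Finset (Fin n))) (by simpa using hk) hx
    have h6 : (0 : ℝ) < (n : ℝ) - k := by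
      have : (k : ℝ) < n := by exact_mod_cast hk
      linarith
    have h7 : 0 < ((n : ℝ) - k) / (k + 1) := by positivity
    nlinarith

/-- The trace `∑ ∂F/∂κ_i` of the derivative of `F = σ_{k+1} / σ_k` is at least `c_{n,k}`. Here the
derivative is expressed through a supporting linear function `l` of `1 / F` in the variables
`1 / κ_i`, that is `∂F/∂κ_i = F² l_i / κ_i²`. -/
lemma le_sq_mul_sum_supergradient {n k : ℕ} (hk : k < n) {x l : Fin n → ℝ} (hx : ∀ i, 0 < x i)
    (h1 : ∀ y : Fin n → ℝ, (∀ i, 0 < y i) →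
      (symmQuot Finset.univ k y)⁻¹ ≤ ∑ i, l i * (y i)⁻¹)
    (h2 : (symmQuot Finset.univ k x)⁻¹ = ∑ i, l i * (x i)⁻¹) :
    ((n : ℝ) - k) / (k + 1) ≤ (symmQuot Finset.univ k x) ^ 2 * ∑ i, l i * (x i)⁻¹ ^ 2 := by
  set c : ℝ := ((n : ℝ) - k) / (k + 1)
  set F := symmQuot Finset.univ k x
  have hF : 0 < F := symmQuot_pos (S := (Finset.univ : Finset (Fin n))) (by simpa using hk) hx
  obtain ⟨g, g0, g1, g2⟩ := exists_supergradient_symmQuot k (Finset.univ : Finset (Fin n))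
    (by simpa using hk) x hx
  have hc : c ≤ ∑ i, g i := by
    have := g1 (fun _ => 1) (fun _ => one_pos)
    rw [symmQuot_const_one hk] at this
    simpa using this
  -- `w s` is nonnegative for small `s ≥ 0` and vanishes at `0`, so its derivative there is `≥ 0`.
  set w : ℝ → ℝ := fun s => ∑ i, l i * (x i - s)⁻¹ - (F - c * s)⁻¹ with hw
  have hw0 : w 0 = 0 := by simp [hw, ← h2]
  have hder : HasDerivAt w (∑ i, l i * (x i)⁻¹ ^ 2 - c / F ^ 2) 0 := by
    have e1 : ∀ i, HasDerivAt (fun s : ℝ => l i * (x i - s)⁻¹) (l i * (x i)⁻¹ ^ 2) 0 := by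
      intro i
      have h := ((hasDerivAt_id (0 : ℝ)).const_sub (x i)).inv (by simpa using (hx i).ne')
      exact (h.const_mul (l i)).congr_deriv (by simp)
    have e2 : HasDerivAt (fun s : ℝ => (F - c * s)⁻¹) (c / F ^ 2) 0 := by
      have h := (((hasDerivAt_id (0 : ℝ)).const_mul c).const_sub F).inv (by simpa using hF.ne')
      exact h.congr_deriv (by simp)
    have h := (HasDerivAt.fun_sum (u := Finset.univ) fun i _ => e1 i).sub e2
    exact h
  have hnonneg : ∀ᶠ s in 𝓝[>] (0 : ℝ), 0 ≤ w s := by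
    have p1 : ∀ᶠ s in 𝓝 (0 : ℝ), ∀ i, 0 < x i - s := by
      rw [Filter.eventually_all]
      intro i
      exact (continuous_const.sub continuous_id).continuousAt.eventually_const_lt (by simpa using hx i)
    have p2 : ∀ᶠ s in 𝓝 (0 : ℝ), 0 < F - c * s :=
      (continuous_const.sub (continuous_const.mul continuous_id)).continuousAt.eventually_const_lt
        (by simpa using hF)
    filter_upwards [nhdsWithin_le_nhds p1, nhdsWithin_le_nhds p2, self_mem_nhdsWithin]
      with s q1 q2 q3
    have q3' : (0 : ℝ) < s := q3
    have k1 := h1 (fun i => x i - s) q1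
    have k2 := g1 (fun i => x i - s) q1
    have k3 : symmQuot Finset.univ k (fun i => x i - s) ≤ F - c * s := by
      have : ∑ i, g i * (x i - s) = F - (∑ i, g i) * s := by
        rw [show F = ∑ i, g i * x i from g2, Finset.sum_mul, ← Finset.sum_sub_distrib]
        exact Finset.sum_congr rfl fun i _ => by ring
      rw [this] at k2
      nlinarith
    have k4 : 0 < symmQuot Finset.univ k (fun i => x i - s) :=
      symmQuot_pos (S := (Finset.univ : Finset (Fin n))) (by simpa using hk) q1
    have k5 := inv_anti₀ k4 k3
    simp only [hw]
    linarith
  have hd0 : 0 ≤ ∑ i, l i * (x i)⁻¹ ^ 2 - c / F ^ 2 := by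
    have ht := (hasDerivAt_iff_tendsto_slope.1 hder).mono_left
      (nhdsWithin_mono (0 : ℝ)
      (show Set.Ioi (0 : ℝ) ⊆ {0}ᶜ from fun s hs => ne_of_gt hs))
    refine ge_of_tendsto ht ?_
    filter_upwards [hnonneg, self_mem_nhdsWithin] with s q1 q2
    have q2' : (0 : ℝ) < s := q2
    rw [slope_def_field, hw0]
    simp only [sub_zero]
    positivity
  have : c / F ^ 2 ≤ ∑ i, l i * (x i)⁻¹ ^ 2 := by linarith
  rw [div_le_iff₀ (by positivity)] at this
  linarith

end SymmetricFunctions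

/-! ### Frames of the tangent space and principal curvatures at a point -/

section Frames

variable {n : ℕ}

/-- The vectors `e i` form an orthonormal basis of the tangent space of a hypersurface of the
sphere at the point `X` with unit normal `N`. -/
structure IsTangentFrame (e : Fin n → Amb n) (X N : Amb n) : Prop where
  inner_frame : ∀ i j, ⟪e i, e j⟫ = if i = j then 1 else 0
  inner_frame_pos : ∀ i, ⟪e i, X⟫ = 0
  inner_frame_normal : ∀ i, ⟪e i, N⟫ = 0
  inner_pos : ⟪X, X⟫ = 1
  inner_normal : ⟪N, N⟫ = 1
  inner_pos_normal : ⟪X, N⟫ = 0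

/-- Parseval's identity for the orthonormal basis `e 1, …, e n, X, N` of `ℝⁿ⁺²`. -/
lemma IsTangentFrame.inner_eq {e : Fin n → Amb n} {X N : Amb n} (h : IsTangentFrame e X N)
    (v w : Amb n) :
    ⟪v, w⟫ = ∑ i, ⟪v, e i⟫ * ⟪w, e i⟫ + ⟪v, X⟫ * ⟪w, X⟫ + ⟪v, N⟫ * ⟪w, N⟫ := by
  let b : Fin n ⊕ Fin 2 → Amb n := Sum.elim e ![X, N]
  have hb : Orthonormal ℝ b := by
    rw [orthonormal_iff_ite]
    rintro (i | i) (j | j)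
    · simpa [b] using h.inner_frame i j
    · fin_cases j
      · simpa [b] using h.inner_frame_pos i
      · simpa [b] using h.inner_frame_normal i
    · fin_cases i
      · simpa [b, real_inner_comm] using h.inner_frame_pos j
      · simpa [b, real_inner_comm] using h.inner_frame_normal j
    · have h1 := h.inner_pos_normal
      have h2 : ⟪N, X⟫ = 0 := by rw [real_inner_comm]; exact h1
      fin_cases i <;> fin_cases j
      · simpa [b] using h.inner_pos
      · simpa [b] using h1
      · simpa [b] using h2
      · simpa [b] using h.inner_normal
  have hc : Fintype.card (Fin n ⊕ Fin 2) = Module.finrank ℝ (Amb n) := by simp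
  let B := (basisOfOrthonormalOfCardEqFinrank hb hc).toOrthonormalBasis (by simpa using hb)
  have hB : ∀ i, B i = b i := fun i => by simp [B]
  have h1 := B.sum_inner_mul_inner v w
  rw [← h1, Fintype.sum_sum_type]
  simp only [hB, Fin.sum_univ_two]
  simp [b, real_inner_comm, add_assoc]

lemma IsTangentFrame.ext {e : Fin n → Amb n} {X N : Amb n} (h : IsTangentFrame e X N)
    {v w : Amb n} (h1 : ∀ i, ⟪v, e i⟫ = ⟪w, e i⟫) (h2 : ⟪v, X⟫ = ⟪w, X⟫) (h3 : ⟪v, N⟫ = ⟪w, N⟫) :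
    v = w := by
  rw [← sub_eq_zero, ← inner_self_eq_zero (𝕜 := ℝ), h.inner_eq]
  simp [inner_sub_left, h1, h2, h3]

/-- For orthogonal unit vectors `X`, `N` in `ℝⁿ⁺²`, an `n`-dimensional space of vectors orthogonal
to both contains all such vectors. -/
lemma mem_range_of_inner_eq_zero {A : EuclideanSpace ℝ (Fin n) →L[ℝ] Amb n} {X N : Amb n}
    (hA : Function.Injective A) (hX : ⟪X, X⟫ = 1) (hN : ⟪N, N⟫ = 1) (hXN : ⟪X, N⟫ = 0)
    (hAX : ∀ v, ⟪A v, X⟫ = 0) (hAN : ∀ v, ⟪A v, N⟫ = 0) {w : Amb n} (hwX : ⟪w, X⟫ = 0)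
    (hwN : ⟪w, N⟫ = 0) : w ∈ A.toLinearMap.range := by
  have horth : Orthonormal ℝ ![X, N] := by
    rw [orthonormal_iff_ite]
    have h2 : ⟪N, X⟫ = 0 := by rw [real_inner_comm]; exact hXN
    intro i j
    fin_cases i <;> fin_cases j <;> simp only [Fin.zero_eta, Fin.mk_one, Matrix.cons_val_zero,
      Matrix.cons_val_one, hX, hN, hXN, h2] <;> simp
  set P := Submodule.span ℝ (Set.range ![X, N]) with hP
  have hfin : Module.finrank ℝ P = 2 := by
    rw [finrank_span_eq_card horth.linearIndependent]; simp
  have hfin2 : Module.finrank ℝ Pᗮ = n := by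
    have := P.finrank_add_finrank_orthogonal
    rw [hfin, finrank_euclideanSpace_fin] at this
    omega
  have hmem : ∀ v : Amb n, v ∈ Pᗮ ↔ ⟪v, X⟫ = 0 ∧ ⟪v, N⟫ = 0 := by
    intro v
    rw [hP, Submodule.mem_orthogonal']
    constructor
    · intro h
      exact ⟨h X (Submodule.subset_span ⟨0, rfl⟩), h N (Submodule.subset_span ⟨1, rfl⟩)⟩
    · rintro ⟨h1, h2⟩ u hu
      induction hu using Submodule.span_induction with
      | mem u hu =>
        obtain ⟨i, rfl⟩ := hu
        fin_cases i
        · exact h1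
        · exact h2
      | zero => simp
      | add a b _ _ ha hb => rw [inner_add_right, ha, hb, add_zero]
      | smul c a _ ha => rw [inner_smul_right, ha, mul_zero]
  have hle : A.toLinearMap.range ≤ Pᗮ := by
    rintro _ ⟨v, rfl⟩
    exact (hmem _).2 ⟨hAX v, hAN v⟩
  have hfin3 : Module.finrank ℝ A.toLinearMap.range = n := by
    rw [LinearMap.finrank_range_of_inj hA, finrank_euclideanSpace_fin]
  have heq := Submodule.eq_of_le_of_finrank_le hle (by rw [hfin2, hfin3])
  rw [heq]
  exact (hmem w).2 ⟨hwX, hwN⟩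

/-- At a point `X` of a hypersurface of the sphere with differential `A` and unit normal `N`, whose
differential is `B`, there is an orthonormal frame of principal directions. The second conclusion
is Rodrigues' formula. -/
lemma exists_principal_frame {A B : EuclideanSpace ℝ (Fin n) →L[ℝ] Amb n} {X N : Amb n}
    (hA : Function.Injective A) (hX : ⟪X, X⟫ = 1) (hN : ⟪N, N⟫ = 1) (hXN : ⟪X, N⟫ = 0)
    (hAX : ∀ v, ⟪A v, X⟫ = 0) (hAN : ∀ v, ⟪A v, N⟫ = 0)
    (hBX : ∀ v, ⟪B v, X⟫ = 0) (hBN : ∀ v, ⟪B v, N⟫ = 0)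
    (hsymm : ∀ v w, ⟪B v, A w⟫ = ⟪B w, A v⟫) :
    ∃ (q : Fin n → EuclideanSpace ℝ (Fin n)) (κ : Fin n → ℝ),
      IsTangentFrame (fun a => A (q a)) X N ∧ (∀ a, B (q a) = κ a • A (q a)) ∧
      ((Matrix.of fun i j => ⟪A (EuclideanSpace.single i 1), A (EuclideanSpace.single j 1)⟫)⁻¹ *
        Matrix.of fun i j =>
          ⟪B (EuclideanSpace.single i 1), A (EuclideanSpace.single j 1)⟫).charpoly.roots =
        Finset.univ.val.map κ := by
  have hrange : ∀ v, B.toLinearMap v ∈ A.toLinearMap.range := fun v =>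
    mem_range_of_inner_eq_zero hA hX hN hXN hAX hAN (hBX v) (hBN v)
  let T := A.toLinearMap.range
  let A' : EuclideanSpace ℝ (Fin n) ≃ₗ[ℝ] T := LinearEquiv.ofInjective A.toLinearMap hA
  let B' : EuclideanSpace ℝ (Fin n) →ₗ[ℝ] T := B.toLinearMap.codRestrict T hrange
  have hA' : ∀ v, (A' v : Amb n) = A v := fun v => rfl
  have hB' : ∀ v, (B' v : Amb n) = B v := fun v => rfl
  let S : T →ₗ[ℝ] T := B' ∘ₗ A'.symm.toLinearMap
  have hS : S.IsSymmetric := by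
    intro x y
    obtain ⟨v, rfl⟩ := A'.surjective x
    obtain ⟨w, rfl⟩ := A'.surjective y
    simp only [S, LinearMap.comp_apply, LinearEquiv.coe_coe, LinearEquiv.symm_apply_apply,
      Submodule.coe_inner, hA', hB']
    rw [hsymm v w, real_inner_comm]
  have hT : Module.finrank ℝ T = n := by
    rw [← A'.finrank_eq, finrank_euclideanSpace_fin]
  let b := hS.eigenvectorBasis hT
  let κ := hS.eigenvalues hT
  let q : Fin n → EuclideanSpace ℝ (Fin n) := fun a => A'.symm (b a)
  have hAq : ∀ a, A (q a) = b a := fun a => by rw [← hA']; simp [q]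
  have hBq' : ∀ a, B' (q a) = κ a • A' (q a) := by
    intro a
    have := hS.apply_eigenvectorBasis hT a
    simp only [S, LinearMap.comp_apply, LinearEquiv.coe_coe] at this
    simp only [q, LinearEquiv.apply_symm_apply]
    exact this
  have hBq : ∀ a, B (q a) = κ a • A (q a) := by
    intro a
    have := congrArg (Subtype.val) (hBq' a)
    simpa [hA', hB'] using this
  refine ⟨q, κ, ⟨?_, fun i => hAX _, fun i => hAN _, hX, hN, hXN⟩, hBq, ?_⟩
  · intro i j
    simp only [hAq]
    rw [← Submodule.coe_inner]
    exact orthonormal_iff_ite.1 b.orthonormal i j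
  · -- In the standard basis, `g⁻¹ h` is the matrix of `A⁻¹ B`, which is diagonal in the basis `q`.
    let W : EuclideanSpace ℝ (Fin n) →ₗ[ℝ] EuclideanSpace ℝ (Fin n) := A'.symm.toLinearMap ∘ₗ B'
    have hAW : ∀ v, A (W v) = B v := by
      intro v
      rw [← hA', ← hB']
      simp [W]
    let e := (EuclideanSpace.basisFun (Fin n) ℝ).toBasis
    have he : ∀ i, e i = EuclideanSpace.single i 1 := fun i => by simp [e]
    set Gm : Matrix (Fin n) (Fin n) ℝ := Matrix.of fun i j =>
      ⟪A (EuclideanSpace.single i 1), A (EuclideanSpace.single j 1)⟫ with hGm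
    set Hm : Matrix (Fin n) (Fin n) ℝ := Matrix.of fun i j =>
      ⟪B (EuclideanSpace.single i 1), A (EuclideanSpace.single j 1)⟫ with hHm
    have hGH : Gm * LinearMap.toMatrix e e W = Hm := by
      ext i j
      rw [Matrix.mul_apply, hHm, Matrix.of_apply, hsymm, ← hAW, ← he j, ← he i]
      have h1 : W (e j) = ∑ k, LinearMap.toMatrix e e W k j • e k := by
        simp only [LinearMap.toMatrix_apply]
        exact (e.sum_repr (W (e j))).symm
      conv_rhs => rw [h1, map_sum, sum_inner]
      refine Finset.sum_congr rfl fun k _ => ?_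
      rw [map_smul, inner_smul_left, hGm, Matrix.of_apply, ← he k, ← he i, real_inner_comm]
      simp [mul_comm]
    have hdet : IsUnit Gm.det := by
      rw [← Matrix.isUnit_iff_isUnit_det, ← Matrix.mulVec_injective_iff_isUnit]
      rw [← Matrix.coe_mulVecLin, ← LinearMap.ker_eq_bot, LinearMap.ker_eq_bot']
      intro v hv
      have hv' : Gm.mulVec v = 0 := hv
      set z : EuclideanSpace ℝ (Fin n) := ∑ j, v j • EuclideanSpace.single j (1 : ℝ) with hz
      have h0 : ⟪A z, A z⟫ = 0 := by
        conv_lhs => rw [hz, map_sum, sum_inner]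
        refine Finset.sum_eq_zero fun i _ => ?_
        have := congrFun hv' i
        rw [map_smul, inner_smul_left, inner_sum]
        simp only [map_smul, inner_smul_right]
        simp only [Matrix.mulVec, dotProduct, hGm, Matrix.of_apply, Pi.zero_apply] at this
        have h3 : ∑ j, v j * ⟪A (EuclideanSpace.single i 1), A (EuclideanSpace.single j 1)⟫ = 0 := by
          rw [← this]
          exact Finset.sum_congr rfl fun j _ => mul_comm _ _
        rw [h3, mul_zero]
      have h1 : z = 0 := by
        have := inner_self_eq_zero.1 h0
        exact hA (by rw [this, map_zero])
      ext j
      have := congrArg (fun y : EuclideanSpace ℝ (Fin n) => y j) h1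
      simpa [hz, Finset.sum_apply, Pi.single_apply] using this
    have hGinv : Gm⁻¹ * Hm = LinearMap.toMatrix e e W := by
      rw [← hGH, ← Matrix.mul_assoc, Matrix.nonsing_inv_mul _ hdet, Matrix.one_mul]
    rw [hGinv, LinearMap.charpoly_toMatrix]
    let b' : Module.Basis (Fin n) ℝ (EuclideanSpace ℝ (Fin n)) := b.toBasis.map A'.symm
    have hb' : ∀ a, b' a = q a := fun a => by simp [b', q]
    have hdiag : LinearMap.toMatrix b' b' W = Matrix.diagonal κ := by
      ext i j
      rw [LinearMap.toMatrix_apply, hb']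
      have : W (q j) = κ j • b' j := by
        rw [hb']
        simp only [W, LinearMap.comp_apply, hBq' j, LinearEquiv.coe_coe, map_smul,
          LinearEquiv.symm_apply_apply]
      rw [this, map_smul, b'.repr_self, Finsupp.smul_apply, Finsupp.single_apply,
        Matrix.diagonal_apply]
      by_cases hij : i = j
      · subst hij; simp
      · rw [if_neg hij, if_neg (Ne.symm hij), smul_zero]
    rw [← LinearMap.charpoly_toMatrix W b', hdiag, Matrix.charpoly_diagonal]
    have : ∏ i, (Polynomial.X - Polynomial.C (κ i)) =
        ((Finset.univ.val.map κ).map fun a => Polynomial.X - Polynomial.C a).prod := by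
      rw [Multiset.map_map]; rfl
    rw [this, Polynomial.roots_multiset_prod_X_sub_C]

/-- The image of `v` under the rotation in the plane of the unit vectors `a`, `a'` that takes `a`
to `a'`, for `v` orthogonal to `a`. -/
def tilt {V : Type*} [NormedAddCommGroup V] [InnerProductSpace ℝ V] (a a' v : V) : V :=
  v - ((1 + ⟪a, a'⟫)⁻¹ * ⟪a', v⟫) • (a + a')

lemma inner_tilt_target {V : Type*} [NormedAddCommGroup V] [InnerProductSpace ℝ V] {a a' v : V}
    (ha' : ⟪a', a'⟫ = 1) (h : 1 + ⟪a, a'⟫ ≠ 0) : ⟪tilt a a' v, a'⟫ = 0 := by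
  unfold tilt
  rw [inner_sub_left, inner_smul_left, inner_add_left, ha', real_inner_comm a' v]
  simp only [conj_trivial]
  field_simp
  ring

lemma inner_tilt_tilt {V : Type*} [NormedAddCommGroup V] [InnerProductSpace ℝ V] {a a' v w : V}
    (ha : ⟪a, a⟫ = 1) (ha' : ⟪a', a'⟫ = 1) (h : 1 + ⟪a, a'⟫ ≠ 0) (hv : ⟪a, v⟫ = 0)
    (hw : ⟪a, w⟫ = 0) : ⟪tilt a a' v, tilt a a' w⟫ = ⟪v, w⟫ := by
  unfold tilt
  simp only [inner_sub_left, inner_sub_right, inner_smul_left, inner_smul_right, inner_add_left,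
    inner_add_right, ha, ha', real_inner_comm a v, real_inner_comm a' v, hv, hw,
    real_inner_comm a a', conj_trivial]
  field_simp
  ring

lemma inner_tilt_of_orthogonal {V : Type*} [NormedAddCommGroup V] [InnerProductSpace ℝ V]
    {a a' v z : V} (ha : ⟪a, z⟫ = 0) (ha' : ⟪a', z⟫ = 0) (hv : ⟪v, z⟫ = 0) :
    ⟪tilt a a' v, z⟫ = 0 := by
  unfold tilt
  simp [inner_sub_left, inner_smul_left, inner_add_left, ha, ha', hv]

/-- The rotation taking `N₀` to `N`, followed by the rotation taking the image of `X₀` to `X`. -/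
def tiltFrame (X₀ N₀ X N v : Amb n) : Amb n :=
  tilt (tilt N₀ N X₀) X (tilt N₀ N v)

/-- A tangent frame at one point is rotated to a tangent frame at a nearby point. -/
lemma IsTangentFrame.tiltFrame {e : Fin n → Amb n} {X₀ N₀ X N : Amb n}
    (h : IsTangentFrame e X₀ N₀) (hX : ⟪X, X⟫ = 1) (hN : ⟪N, N⟫ = 1) (hXN : ⟪X, N⟫ = 0)
    (h1 : 1 + ⟪N₀, N⟫ ≠ 0) (h2 : 1 + ⟪tilt N₀ N X₀, X⟫ ≠ 0) :
    IsTangentFrame (fun i => tiltFrame X₀ N₀ X N (e i)) X N := by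
  have hNX : ⟪N₀, X₀⟫ = 0 := by rw [real_inner_comm]; exact h.inner_pos_normal
  have hNe : ∀ i, ⟪N₀, e i⟫ = 0 := fun i => by rw [real_inner_comm]; exact h.inner_frame_normal i
  have hXe : ∀ i, ⟪X₀, e i⟫ = 0 := fun i => by rw [real_inner_comm]; exact h.inner_frame_pos i
  have hb : ⟪tilt N₀ N X₀, tilt N₀ N X₀⟫ = 1 := by
    rw [inner_tilt_tilt h.inner_normal hN h1 hNX hNX, h.inner_pos]
  have hbe : ∀ i, ⟪tilt N₀ N X₀, tilt N₀ N (e i)⟫ = 0 := fun i => by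
    rw [inner_tilt_tilt h.inner_normal hN h1 hNX (hNe i), hXe i]
  refine ⟨fun i j => ?_, fun i => inner_tilt_target hX h2, fun i => ?_, hX, hN, hXN⟩
  · unfold SphereFlow.tiltFrame
    rw [inner_tilt_tilt hb hX h2 (hbe i) (hbe j), inner_tilt_tilt h.inner_normal hN h1 (hNe i)
      (hNe j), h.inner_frame]
  · exact inner_tilt_of_orthogonal (inner_tilt_target hN h1) hXN (inner_tilt_target hN h1)

/-- Schur's inequality for concave functions of the radii of curvature `1 / κ_a`: a supporting
linear function of `1 / F` may be evaluated at the diagonal entries in any orthonormal frame. -/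
lemma inv_symmQuot_le_sum_sq {k : ℕ} {l κ : Fin n → ℝ} {O : Matrix (Fin n) (Fin n) ℝ}
    (hO : O * O.transpose = 1) (hκ : ∀ i, 0 < κ i)
    (hl : ∀ y : Fin n → ℝ, (∀ i, 0 < y i) → (symmQuot Finset.univ k y)⁻¹ ≤ ∑ i, l i * (y i)⁻¹) :
    (symmQuot Finset.univ k κ)⁻¹ ≤ ∑ i, l i * ∑ a, O i a ^ 2 * (κ a)⁻¹ := by
  have hO' : O.transpose * O = 1 := mul_eq_one_comm.1 hO
  have hds : (Matrix.of fun i a => O i a ^ 2) ∈ doublyStochastic ℝ (Fin n) := by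
    rw [mem_doublyStochastic_iff_sum]
    refine ⟨fun i j => sq_nonneg _, fun i => ?_, fun j => ?_⟩
    · have := congrFun (congrFun hO i) i
      simpa [Matrix.mul_apply, pow_two] using this
    · have := congrFun (congrFun hO' j) j
      simpa [Matrix.mul_apply, pow_two] using this
  obtain ⟨w, hw0, hw1, hw2⟩ := exists_eq_sum_perm_of_mem_doublyStochastic hds
  have hO2 : ∀ i a, O i a ^ 2 = ∑ σ, w σ * σ.permMatrix ℝ i a := by
    intro i a
    have := congrFun (congrFun hw2 i) a
    rw [Matrix.sum_apply] at this
    simpa using this.symm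
  have hrow : ∀ i, ∑ a, O i a ^ 2 * (κ a)⁻¹ = ∑ σ, w σ * (κ (σ i))⁻¹ := by
    intro i
    simp only [hO2, Finset.sum_mul]
    rw [Finset.sum_comm]
    refine Finset.sum_congr rfl fun σ _ => ?_
    rw [Finset.sum_eq_single (σ i)]
    · simp [Equiv.Perm.permMatrix, PEquiv.toMatrix_apply]
    · intro a _ ha
      simp [Equiv.Perm.permMatrix, PEquiv.toMatrix_apply, ha.symm]
    · simp
  simp only [hrow, Finset.mul_sum]
  rw [Finset.sum_comm]
  calc (symmQuot Finset.univ k κ)⁻¹ = ∑ σ, w σ * (symmQuot Finset.univ k κ)⁻¹ := by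
        rw [← Finset.sum_mul, hw1, one_mul]
    _ ≤ ∑ σ, ∑ i, l i * (w σ * (κ (σ i))⁻¹) := by
        refine Finset.sum_le_sum fun σ _ => ?_
        have h1 := hl (fun i => κ (σ i)) (fun i => hκ _)
        rw [symmQuot_perm] at h1
        calc w σ * (symmQuot Finset.univ k κ)⁻¹ ≤ w σ * ∑ i, l i * (κ (σ i))⁻¹ :=
              mul_le_mul_of_nonneg_left h1 (hw0 σ)
          _ = _ := by
              rw [Finset.mul_sum]
              exact Finset.sum_congr rfl fun i _ => by ring

/-- If `E' i` is a tangent frame and `dν` maps `ε i` to `E' i`, then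
`1 / F ≤ ∑ l_i h(ε_i, ε_i)`. -/
lemma inv_symmQuot_le_sum_inner {k : ℕ} {l κ : Fin n → ℝ}
    {A B : EuclideanSpace ℝ (Fin n) →L[ℝ] Amb n} {X N : Amb n}
    {q ε : Fin n → EuclideanSpace ℝ (Fin n)} {E' : Fin n → Amb n}
    (hq : IsTangentFrame (fun a => A (q a)) X N) (hBq : ∀ a, B (q a) = κ a • A (q a))
    (hκ : ∀ i, 0 < κ i) (hE' : IsTangentFrame E' X N) (hB : Function.Injective B)
    (hε : ∀ i, B (ε i) = E' i)
    (hl : ∀ y : Fin n → ℝ, (∀ i, 0 < y i) → (symmQuot Finset.univ k y)⁻¹ ≤ ∑ i, l i * (y i)⁻¹) :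
    (symmQuot Finset.univ k κ)⁻¹ ≤ ∑ i, l i * ⟪A (ε i), B (ε i)⟫ := by
  set O : Matrix (Fin n) (Fin n) ℝ := Matrix.of fun i a => ⟪E' i, A (q a)⟫ with hOdef
  have hO : O * O.transpose = 1 := by
    ext i j
    have h1 := hq.inner_eq (E' i) (E' j)
    rw [hE'.inner_frame_pos, hE'.inner_frame_normal, hE'.inner_frame] at h1
    simp only [Matrix.mul_apply, Matrix.transpose_apply, hOdef, Matrix.of_apply, Matrix.one_apply]
    rw [h1]
    simp
  have hexp : ∀ i, ε i = ∑ a, (O i a * (κ a)⁻¹) • q a := by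
    intro i
    apply hB
    rw [hε, map_sum]
    refine hq.ext (fun b => ?_) ?_ ?_
    · rw [sum_inner, Finset.sum_eq_single b]
      · rw [map_smul, hBq, inner_smul_left, inner_smul_left, hq.inner_frame]
        have := (hκ b).ne'
        simp [hOdef]
        field_simp
      · intro a _ hab
        rw [map_smul, hBq, inner_smul_left, inner_smul_left, hq.inner_frame, if_neg hab]
        simp
      · simp
    · rw [sum_inner, hE'.inner_frame_pos, Finset.sum_eq_zero]
      intro a _
      rw [map_smul, hBq, inner_smul_left, inner_smul_left, hq.inner_frame_pos]
      simp
    · rw [sum_inner, hE'.inner_frame_normal, Finset.sum_eq_zero]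
      intro a _
      rw [map_smul, hBq, inner_smul_left, inner_smul_left, hq.inner_frame_normal]
      simp
  have hval : ∀ i, ⟪A (ε i), B (ε i)⟫ = ∑ a, O i a ^ 2 * (κ a)⁻¹ := by
    intro i
    rw [hε]
    conv_lhs => rw [hexp i, map_sum, sum_inner]
    refine Finset.sum_congr rfl fun a _ => ?_
    rw [map_smul, inner_smul_left, real_inner_comm]
    simp [hOdef]
    ring
  simp only [hval]
  exact inv_symmQuot_le_sum_sq hO hκ hl

end Frames

/-! ### Iterated directional derivatives -/

section Calculus

variable {W V : Type*} [NormedAddCommGroup W] [NormedSpace ℝ W] [NormedAddCommGroup V]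
  [InnerProductSpace ℝ V]

/-- The derivative of `f` in the direction `v`, as a function of the point. -/
def dirDeriv {F : Type*} [NormedAddCommGroup F] [NormedSpace ℝ F] (v : W) (f : W → F) : W → F :=
  fun p => fderiv ℝ f p v

variable {F : Type*} [NormedAddCommGroup F] [NormedSpace ℝ F] {U : Set W} {p : W}

lemma differentiableAt_of_smooth {f : W → F} (hU : IsOpen U) (hf : ContDiffOn ℝ ∞ f U)
    (hp : p ∈ U) : DifferentiableAt ℝ f p :=
  (hf.contDiffAt (hU.mem_nhds hp)).differentiableAt (by simp)

lemma smooth_dirDeriv {f : W → F} (hU : IsOpen U) (hf : ContDiffOn ℝ ∞ f U) (v : W) :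
    ContDiffOn ℝ ∞ (dirDeriv v f) U :=
  (hf.fderiv_of_isOpen hU (by simp)).clm_apply contDiffOn_const

lemma dirDeriv_congr {f g : W → F} (hU : IsOpen U) (h : ∀ p ∈ U, f p = g p) (v : W) (hp : p ∈ U) :
    dirDeriv v f p = dirDeriv v g p := by
  unfold dirDeriv
  rw [Filter.EventuallyEq.fderiv_eq]
  filter_upwards [hU.mem_nhds hp] with q hq using h q hq

lemma dirDeriv_comm {f : W → F} (hU : IsOpen U) (hf : ContDiffOn ℝ ∞ f U) (v w : W) (hp : p ∈ U) :
    dirDeriv v (dirDeriv w f) p = dirDeriv w (dirDeriv v f) p := by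
  have hfa := hf.contDiffAt (hU.mem_nhds hp)
  have hd : DifferentiableAt ℝ (fderiv ℝ f) p :=
    differentiableAt_of_smooth hU (hf.fderiv_of_isOpen (m := ∞) hU (by simp)) hp
  have h1 : ∀ v w : W, dirDeriv v (dirDeriv w f) p = fderiv ℝ (fderiv ℝ f) p v w := by
    intro v w
    unfold dirDeriv
    rw [fderiv_clm_apply hd (differentiableAt_const _)]
    simp
  have h2 : IsSymmSndFDerivAt ℝ f p := hfa.isSymmSndFDerivAt (by
    rw [minSmoothness_of_isRCLikeNormedField]; exact WithTop.coe_le_coe.2 le_top)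
  rw [h1, h1]
  exact h2.eq v w

lemma dirDeriv_const (v : W) (c : F) (p : W) : dirDeriv v (fun _ => c) p = 0 := by
  simp [dirDeriv]

lemma dirDeriv_add {f g : W → F} (hU : IsOpen U) (hf : ContDiffOn ℝ ∞ f U)
    (hg : ContDiffOn ℝ ∞ g U) (v : W) (hp : p ∈ U) :
    dirDeriv v (fun p => f p + g p) p = dirDeriv v f p + dirDeriv v g p := by
  unfold dirDeriv
  rw [fderiv_fun_add (differentiableAt_of_smooth hU hf hp) (differentiableAt_of_smooth hU hg hp)]
  rfl

lemma dirDeriv_sub {f g : W → F} (hU : IsOpen U) (hf : ContDiffOn ℝ ∞ f U)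
    (hg : ContDiffOn ℝ ∞ g U) (v : W) (hp : p ∈ U) :
    dirDeriv v (fun p => f p - g p) p = dirDeriv v f p - dirDeriv v g p := by
  unfold dirDeriv
  rw [fderiv_fun_sub (differentiableAt_of_smooth hU hf hp) (differentiableAt_of_smooth hU hg hp)]
  rfl

lemma dirDeriv_neg {f : W → F} (v : W) :
    dirDeriv v (fun p => -f p) p = -dirDeriv v f p := by
  unfold dirDeriv
  rw [fderiv_fun_neg]
  rfl

lemma dirDeriv_sum {ι : Type*} {s : Finset ι} {f : ι → W → F} (hU : IsOpen U)
    (hf : ∀ i, ContDiffOn ℝ ∞ (f i) U) (v : W) (hp : p ∈ U) :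
    dirDeriv v (fun p => ∑ i ∈ s, f i p) p = ∑ i ∈ s, dirDeriv v (f i) p := by
  unfold dirDeriv
  rw [fderiv_fun_sum fun i _ => differentiableAt_of_smooth hU (hf i) hp]
  simp

lemma dirDeriv_mul {f g : W → ℝ} (hU : IsOpen U) (hf : ContDiffOn ℝ ∞ f U)
    (hg : ContDiffOn ℝ ∞ g U) (v : W) (hp : p ∈ U) :
    dirDeriv v (fun p => f p * g p) p = dirDeriv v f p * g p + f p * dirDeriv v g p := by
  unfold dirDeriv
  rw [fderiv_fun_mul (differentiableAt_of_smooth hU hf hp) (differentiableAt_of_smooth hU hg hp)]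
  simp
  ring

lemma dirDeriv_const_mul {g : W → ℝ} (hU : IsOpen U) (c : ℝ)
    (hg : ContDiffOn ℝ ∞ g U) (v : W) (hp : p ∈ U) :
    dirDeriv v (fun p => c * g p) p = c * dirDeriv v g p := by
  rw [dirDeriv_mul hU contDiffOn_const hg v hp, dirDeriv_const]
  ring

lemma dirDeriv_smul {f : W → ℝ} {g : W → F} (hU : IsOpen U) (hf : ContDiffOn ℝ ∞ f U)
    (hg : ContDiffOn ℝ ∞ g U) (v : W) (hp : p ∈ U) :
    dirDeriv v (fun p => f p • g p) p = dirDeriv v f p • g p + f p • dirDeriv v g p := by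
  unfold dirDeriv
  rw [fderiv_fun_smul (differentiableAt_of_smooth hU hf hp) (differentiableAt_of_smooth hU hg hp)]
  simp [add_comm]

lemma dirDeriv_inner {f g : W → V} (hU : IsOpen U) (hf : ContDiffOn ℝ ∞ f U)
    (hg : ContDiffOn ℝ ∞ g U) (v : W) (hp : p ∈ U) :
    dirDeriv v (fun p => ⟪f p, g p⟫) p = ⟪dirDeriv v f p, g p⟫ + ⟪f p, dirDeriv v g p⟫ := by
  unfold dirDeriv
  rw [fderiv_inner_apply ℝ (differentiableAt_of_smooth hU hf hp)
    (differentiableAt_of_smooth hU hg hp), add_comm]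

lemma dirDeriv_const_inner {g : W → V} (hU : IsOpen U) (c : V)
    (hg : ContDiffOn ℝ ∞ g U) (v : W) (hp : p ∈ U) :
    dirDeriv v (fun p => ⟪c, g p⟫) p = ⟪c, dirDeriv v g p⟫ := by
  rw [dirDeriv_inner hU contDiffOn_const hg v hp, dirDeriv_const]
  simp

/-- Second derivative of a product. -/
lemma dirDeriv_dirDeriv_mul {f g : W → ℝ} (hU : IsOpen U) (hf : ContDiffOn ℝ ∞ f U)
    (hg : ContDiffOn ℝ ∞ g U) (v w : W) (hp : p ∈ U) :
    dirDeriv v (dirDeriv w (fun p => f p * g p)) p =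
      dirDeriv v (dirDeriv w f) p * g p + dirDeriv w f p * dirDeriv v g p +
        (dirDeriv v f p * dirDeriv w g p + f p * dirDeriv v (dirDeriv w g) p) := by
  rw [dirDeriv_congr hU (fun p hp => dirDeriv_mul hU hf hg w hp) v hp,
    dirDeriv_add hU ((smooth_dirDeriv hU hf w).mul hg) (hf.mul (smooth_dirDeriv hU hg w)) v hp,
    dirDeriv_mul hU (smooth_dirDeriv hU hf w) hg v hp,
    dirDeriv_mul hU hf (smooth_dirDeriv hU hg w) v hp]

/-- Second derivative of an inner product. -/
lemma dirDeriv_dirDeriv_inner {f g : W → V} (hU : IsOpen U) (hf : ContDiffOn ℝ ∞ f U)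
    (hg : ContDiffOn ℝ ∞ g U) (v w : W) (hp : p ∈ U) :
    dirDeriv v (dirDeriv w (fun p => ⟪f p, g p⟫)) p =
      ⟪dirDeriv v (dirDeriv w f) p, g p⟫ + ⟪dirDeriv w f p, dirDeriv v g p⟫ +
        (⟪dirDeriv v f p, dirDeriv w g p⟫ + ⟪f p, dirDeriv v (dirDeriv w g) p⟫) := by
  rw [dirDeriv_congr hU (fun p hp => dirDeriv_inner hU hf hg w hp) v hp,
    dirDeriv_add hU ((smooth_dirDeriv hU hf w).inner ℝ hg) (hf.inner ℝ (smooth_dirDeriv hU hg w))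
      v hp,
    dirDeriv_inner hU (smooth_dirDeriv hU hf w) hg v hp,
    dirDeriv_inner hU hf (smooth_dirDeriv hU hg w) v hp]

lemma hasDerivAt_line {f : W → F} (hU : IsOpen U) (hf : ContDiffOn ℝ ∞ f U) (v : W) {s : ℝ}
    (hp : p + s • v ∈ U) : HasDerivAt (fun s : ℝ => f (p + s • v)) (dirDeriv v f (p + s • v)) s := by
  have h1 : HasDerivAt (fun s : ℝ => p + s • v) v s := by
    simpa using ((hasDerivAt_id s).smul_const v).const_add p
  exact (differentiableAt_of_smooth hU hf hp).hasFDerivAt.comp_hasDerivAt s h1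

lemma eventually_line_mem (hU : IsOpen U) (hp : p ∈ U) (v : W) :
    ∀ᶠ s : ℝ in 𝓝 0, p + s • v ∈ U := by
  have hc : Continuous fun s : ℝ => p + s • v := by fun_prop
  exact hc.continuousAt.eventually_mem (hU.mem_nhds (by simpa using hp))

lemma dirDeriv_congr_line {f g : W → F} (hU : IsOpen U) (hf : ContDiffOn ℝ ∞ f U)
    (hg : ContDiffOn ℝ ∞ g U) (v : W) (hp : p ∈ U)
    (h : ∀ᶠ s : ℝ in 𝓝 0, f (p + s • v) = g (p + s • v)) : dirDeriv v f p = dirDeriv v g p := by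
  have hp' : p + (0 : ℝ) • v ∈ U := by simpa using hp
  have h1 := hasDerivAt_line hU hf v hp'
  have h2 := hasDerivAt_line hU hg v hp'
  have h3 := h1.unique (h2.congr_of_eventuallyEq h)
  simpa using h3

/-- First and second derivative test for a function whose restriction to a line has a minimum. -/
lemma dirDeriv_of_line_min {f : W → ℝ} (hU : IsOpen U) (hf : ContDiffOn ℝ ∞ f U) (v : W)
    (hp : p ∈ U) (h0 : f p = 0) (h : ∀ᶠ s : ℝ in 𝓝 0, 0 ≤ f (p + s • v)) :
    dirDeriv v f p = 0 ∧ 0 ≤ dirDeriv v (dirDeriv v f) p := by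
  have hp' : p + (0 : ℝ) • v ∈ U := by simpa using hp
  set g : ℝ → ℝ := fun s => f (p + s • v) with hg
  have hg0 : g 0 = 0 := by simp [hg, h0]
  have h1 : ∀ᶠ s in 𝓝 (0 : ℝ), HasDerivAt g (dirDeriv v f (p + s • v)) s := by
    filter_upwards [eventually_line_mem hU hp v] with s hs using hasDerivAt_line hU hf v hs
  have hmin : IsLocalMin g 0 := by
    filter_upwards [h] with s hs
    rw [hg0]
    exact hs
  have hd : deriv g =ᶠ[𝓝 0] fun s => dirDeriv v f (p + s • v) := by
    filter_upwards [h1] with s hs using hs.deriv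
  have hd1 : deriv g 0 = dirDeriv v f p := by simpa using hd.self_of_nhds
  have hd2 : deriv (deriv g) 0 = dirDeriv v (dirDeriv v f) p := by
    rw [hd.deriv_eq]
    simpa using (hasDerivAt_line hU (smooth_dirDeriv hU hf v) v hp').deriv
  have hd0 : deriv g 0 = 0 := hmin.deriv_eq_zero
  refine ⟨by rw [← hd1, hd0], ?_⟩
  rw [← hd2]
  by_contra hneg
  push Not at hneg
  have hmax : IsLocalMax g 0 :=
    isLocalMax_of_deriv_deriv_neg hneg hd0 h1.self_of_nhds.continuousAt
  have hconst : g =ᶠ[𝓝 0] fun _ => 0 := by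
    filter_upwards [hmax, h] with s hs1 hs2
    exact le_antisymm (by rw [hg0] at hs1; exact hs1) hs2
  have := hconst.deriv.deriv_eq
  rw [this] at hneg
  simp at hneg

/-- One-sided first derivative test, for a function that is nonnegative backwards along a line. -/
lemma dirDeriv_nonpos_of_line {f : W → ℝ} (hU : IsOpen U) (hf : ContDiffOn ℝ ∞ f U) (v : W)
    (hp : p ∈ U) (h0 : f p = 0) (h : ∀ᶠ s : ℝ in 𝓝 0, s ≤ 0 → 0 ≤ f (p + s • v)) :
    dirDeriv v f p ≤ 0 := by
  have hp' : p + (0 : ℝ) • v ∈ U := by simpa using hp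
  have h1 := hasDerivAt_line hU hf v hp'
  rw [zero_smul, add_zero] at h1
  have ht := (hasDerivAt_iff_tendsto_slope.1 h1).mono_left
      (nhdsWithin_mono (0 : ℝ) (show Set.Iio (0 : ℝ) ⊆ {0}ᶜ from fun s hs => ne_of_lt hs))
  refine le_of_tendsto ht ?_
  filter_upwards [nhdsWithin_le_nhds h, self_mem_nhdsWithin] with s q1 q2
  have q2' : s < 0 := q2
  have q3 := q1 q2'.le
  rw [slope_def_field]
  simp only [zero_smul, add_zero, h0, sub_zero]
  exact div_nonpos_of_nonneg_of_nonpos q3 q2'.le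

end Calculus

/-! ### The hypersurface in coordinates given by its Gauss map -/

section NormalForm

variable {n : ℕ}

/-- Space-time: local coordinates of the hypersurface, and the time. -/
abbrev SpaceTime (n : ℕ) : Type := EuclideanSpace ℝ (Fin n) × ℝ

/-- The partial derivative in the `i`-th space coordinate. -/
def dx {F : Type*} [NormedAddCommGroup F] [NormedSpace ℝ F] (i : Fin n) (f : SpaceTime n → F) :
    SpaceTime n → F :=
  dirDeriv (EuclideanSpace.single i (1 : ℝ), (0 : ℝ)) f

/-- The time derivative. -/
def dt {F : Type*} [NormedAddCommGroup F] [NormedSpace ℝ F] (f : SpaceTime n → F) :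
    SpaceTime n → F :=
  dirDeriv ((0 : EuclideanSpace ℝ (Fin n)), (1 : ℝ)) f

/-- The derivative of `f` at `p` as a linear function of the space direction. -/
def spaceDeriv (f : SpaceTime n → Amb n) (p : SpaceTime n) :
    EuclideanSpace ℝ (Fin n) →L[ℝ] Amb n :=
  (fderiv ℝ f p).comp (ContinuousLinearMap.inl ℝ _ _)

lemma spaceDeriv_apply (f : SpaceTime n → Amb n) (p : SpaceTime n)
    (v : EuclideanSpace ℝ (Fin n)) : spaceDeriv f p v = dirDeriv (v, (0 : ℝ)) f p := rfl

lemma spaceDeriv_eq_sum (f : SpaceTime n → Amb n) (p : SpaceTime n)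
    (v : EuclideanSpace ℝ (Fin n)) : spaceDeriv f p v = ∑ j, v j • dx j f p := by
  have hv : v = ∑ j, v j • EuclideanSpace.single j (1 : ℝ) := by
    ext i
    simp [Finset.sum_apply, Pi.single_apply]
  conv_lhs => rw [hv, map_sum]
  refine Finset.sum_congr rfl fun j _ => ?_
  rw [map_smul]
  rfl

section Partial

variable {V F : Type*} [NormedAddCommGroup V] [InnerProductSpace ℝ V] [NormedAddCommGroup F]
  [NormedSpace ℝ F] {U : Set (SpaceTime n)} {p : SpaceTime n}

lemma smooth_dx {f : SpaceTime n → F} (hU : IsOpen U) (hf : ContDiffOn ℝ ∞ f U) (i : Fin n) :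
    ContDiffOn ℝ ∞ (dx i f) U := smooth_dirDeriv hU hf _

lemma dx_congr {f g : SpaceTime n → F} (hU : IsOpen U) (h : ∀ p ∈ U, f p = g p) (i : Fin n)
    (hp : p ∈ U) : dx i f p = dx i g p := dirDeriv_congr hU h _ hp

lemma dx_const (i : Fin n) (c : F) : dx i (fun _ => c) p = 0 := dirDeriv_const _ c p

lemma dx_neg {f : SpaceTime n → F} (i : Fin n) : dx i (fun p => -f p) p = -dx i f p :=
  dirDeriv_neg _

lemma dx_add {f g : SpaceTime n → F} (hU : IsOpen U) (hf : ContDiffOn ℝ ∞ f U)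
    (hg : ContDiffOn ℝ ∞ g U) (i : Fin n) (hp : p ∈ U) :
    dx i (fun p => f p + g p) p = dx i f p + dx i g p := dirDeriv_add hU hf hg _ hp

lemma dx_sub {f g : SpaceTime n → F} (hU : IsOpen U) (hf : ContDiffOn ℝ ∞ f U)
    (hg : ContDiffOn ℝ ∞ g U) (i : Fin n) (hp : p ∈ U) :
    dx i (fun p => f p - g p) p = dx i f p - dx i g p := dirDeriv_sub hU hf hg _ hp

lemma dx_sum {ι : Type*} {s : Finset ι} {f : ι → SpaceTime n → F} (hU : IsOpen U)
    (hf : ∀ j, ContDiffOn ℝ ∞ (f j) U) (i : Fin n) (hp : p ∈ U) :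
    dx i (fun p => ∑ j ∈ s, f j p) p = ∑ j ∈ s, dx i (f j) p := dirDeriv_sum hU hf _ hp

lemma dx_mul {f g : SpaceTime n → ℝ} (hU : IsOpen U) (hf : ContDiffOn ℝ ∞ f U)
    (hg : ContDiffOn ℝ ∞ g U) (i : Fin n) (hp : p ∈ U) :
    dx i (fun p => f p * g p) p = dx i f p * g p + f p * dx i g p := dirDeriv_mul hU hf hg _ hp

lemma dx_const_mul {g : SpaceTime n → ℝ} (hU : IsOpen U) (c : ℝ) (hg : ContDiffOn ℝ ∞ g U)
    (i : Fin n) (hp : p ∈ U) : dx i (fun p => c * g p) p = c * dx i g p :=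
  dirDeriv_const_mul hU c hg _ hp

lemma dx_smul {f : SpaceTime n → ℝ} {g : SpaceTime n → F} (hU : IsOpen U) (hf : ContDiffOn ℝ ∞ f U)
    (hg : ContDiffOn ℝ ∞ g U) (i : Fin n) (hp : p ∈ U) :
    dx i (fun p => f p • g p) p = dx i f p • g p + f p • dx i g p := dirDeriv_smul hU hf hg _ hp

lemma dx_inner {f g : SpaceTime n → V} (hU : IsOpen U) (hf : ContDiffOn ℝ ∞ f U)
    (hg : ContDiffOn ℝ ∞ g U) (i : Fin n) (hp : p ∈ U) :
    dx i (fun p => ⟪f p, g p⟫) p = ⟪dx i f p, g p⟫ + ⟪f p, dx i g p⟫ := dirDeriv_inner hU hf hg _ hp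

lemma dx_const_inner {g : SpaceTime n → V} (hU : IsOpen U) (c : V) (hg : ContDiffOn ℝ ∞ g U)
    (i : Fin n) (hp : p ∈ U) : dx i (fun p => ⟪c, g p⟫) p = ⟪c, dx i g p⟫ :=
  dirDeriv_const_inner hU c hg _ hp

lemma dx_inner_const {g : SpaceTime n → V} (hU : IsOpen U) (c : V) (hg : ContDiffOn ℝ ∞ g U)
    (i : Fin n) (hp : p ∈ U) : dx i (fun p => ⟪g p, c⟫) p = ⟪dx i g p, c⟫ := by
  rw [dx_inner hU hg contDiffOn_const i hp, dx_const, inner_zero_right, add_zero]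

lemma dx_dx_mul {f g : SpaceTime n → ℝ} (hU : IsOpen U) (hf : ContDiffOn ℝ ∞ f U)
    (hg : ContDiffOn ℝ ∞ g U) (i j : Fin n) (hp : p ∈ U) :
    dx i (dx j (fun p => f p * g p)) p = dx i (dx j f) p * g p + dx j f p * dx i g p +
      (dx i f p * dx j g p + f p * dx i (dx j g) p) := dirDeriv_dirDeriv_mul hU hf hg _ _ hp

lemma dx_dx_inner {f g : SpaceTime n → V} (hU : IsOpen U) (hf : ContDiffOn ℝ ∞ f U)
    (hg : ContDiffOn ℝ ∞ g U) (i j : Fin n) (hp : p ∈ U) :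
    dx i (dx j (fun p => ⟪f p, g p⟫)) p = ⟪dx i (dx j f) p, g p⟫ + ⟪dx j f p, dx i g p⟫ +
      (⟪dx i f p, dx j g p⟫ + ⟪f p, dx i (dx j g) p⟫) := dirDeriv_dirDeriv_inner hU hf hg _ _ hp

lemma dx_comm {f : SpaceTime n → F} (hU : IsOpen U) (hf : ContDiffOn ℝ ∞ f U) (i j : Fin n)
    (hp : p ∈ U) : dx i (dx j f) p = dx j (dx i f) p := dirDeriv_comm hU hf _ _ hp

end Partial

/-- A family of hypersurfaces `X` of the sphere with unit normals `N`, in coordinates near the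
origin such that at the time `t₀` the coordinates of a point are the components of its normal in a
tangent frame `e` of principal directions at the origin. The numbers `lam i` are the principal radii
of curvature at the origin at the time `t₀`. -/
structure NormalForm (U : Set (SpaceTime n)) (t₀ : ℝ) (X N : SpaceTime n → Amb n)
    (e : Fin n → Amb n) (lam : Fin n → ℝ) : Prop where
  isOpen : IsOpen U
  mem : ((0 : EuclideanSpace ℝ (Fin n)), t₀) ∈ U
  smooth : ContDiffOn ℝ ∞ X U
  smooth_normal : ContDiffOn ℝ ∞ N U
  inner_pos : ∀ p ∈ U, ⟪X p, X p⟫ = 1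
  inner_normal : ∀ p ∈ U, ⟪N p, N p⟫ = 1
  inner_pos_normal : ∀ p ∈ U, ⟪X p, N p⟫ = 0
  normal : ∀ p ∈ U, ∀ v : EuclideanSpace ℝ (Fin n), ⟪dirDeriv (v, (0 : ℝ)) X p, N p⟫ = 0
  frame : IsTangentFrame e (X (0, t₀)) (N (0, t₀))
  deriv_normal : ∀ i, dx i N (0, t₀) = e i
  deriv_pos : ∀ i, dx i X (0, t₀) = lam i • e i
  graph : ∀ p ∈ U, p.2 = t₀ → ∀ i, ⟪N p, e i⟫ = p.1 i
  one_add_inner_ne : ∀ p ∈ U, 1 + ⟪N (0, t₀), N p⟫ ≠ 0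
  one_add_inner_tilt_ne : ∀ p ∈ U, 1 + ⟪tilt (N (0, t₀)) (N p) (X (0, t₀)), X p⟫ ≠ 0

namespace NormalForm

variable {U : Set (SpaceTime n)} {t₀ : ℝ} {X N : SpaceTime n → Amb n} {e : Fin n → Amb n}
  {lam : Fin n → ℝ} {p : SpaceTime n}

lemma smooth_dx_pos (H : NormalForm U t₀ X N e lam) (i : Fin n) : ContDiffOn ℝ ∞ (dx i X) U :=
  smooth_dirDeriv H.isOpen H.smooth _

lemma smooth_dx_normal (H : NormalForm U t₀ X N e lam) (i : Fin n) : ContDiffOn ℝ ∞ (dx i N) U :=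
  smooth_dirDeriv H.isOpen H.smooth_normal _

/-- Space derivatives vanish where a function is constant on the time slice `t₀`; the equations
`graph` hold only on this slice. -/
lemma dx_eq_zero_of_slice {F : Type*} [NormedAddCommGroup F] [NormedSpace ℝ F]
    (H : NormalForm U t₀ X N e lam) {f : SpaceTime n → F} (hf : ContDiffOn ℝ ∞ f U) {c : F}
    (h : ∀ p ∈ U, p.2 = t₀ → f p = c) (i : Fin n) (hp : p ∈ U) (hpt : p.2 = t₀) :
    dx i f p = 0 := by
  rw [← dirDeriv_const (EuclideanSpace.single i (1 : ℝ), (0 : ℝ)) c p]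
  refine dirDeriv_congr_line H.isOpen hf contDiffOn_const _ hp ?_
  filter_upwards [eventually_line_mem H.isOpen hp (EuclideanSpace.single i (1 : ℝ), (0 : ℝ))]
    with s hs
  exact h _ hs (by simp [hpt])

lemma inner_dx_normal_frame (H : NormalForm U t₀ X N e lam) (i j : Fin n) (hp : p ∈ U)
    (hpt : p.2 = t₀) : ⟪dx i N p, e j⟫ = if i = j then 1 else 0 := by
  have h1 : dx i (fun p => ⟪N p, e j⟫ - p.1 j) p = 0 := by
    refine H.dx_eq_zero_of_slice (c := 0) ?_ (fun p hp hpt => ?_) i hp hpt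
    · exact (H.smooth_normal.inner ℝ contDiffOn_const).sub (by fun_prop)
    · rw [H.graph p hp hpt, sub_self]
  have h2 : dx i (fun p : SpaceTime n => p.1 j) p = if i = j then 1 else 0 := by
    let L : SpaceTime n →L[ℝ] ℝ :=
      (EuclideanSpace.proj j).comp (ContinuousLinearMap.fst ℝ _ _)
    have : fderiv ℝ (fun p : SpaceTime n => p.1 j) p = L := L.hasFDerivAt.fderiv
    unfold dx dirDeriv
    rw [this]
    simp [L, eq_comm]
  rw [dx_sub H.isOpen (H.smooth_normal.inner ℝ contDiffOn_const) (by fun_prop) _ hp,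
    dx_inner_const H.isOpen _ H.smooth_normal _ hp, h2] at h1
  linarith

lemma inner_dx_dx_normal_frame (H : NormalForm U t₀ X N e lam) (i j m : Fin n) (hp : p ∈ U)
    (hpt : p.2 = t₀) : ⟪dx i (dx j N) p, e m⟫ = 0 := by
  have h1 := H.dx_eq_zero_of_slice (f := fun p => ⟪dx j N p, e m⟫)
    ((H.smooth_dx_normal j).inner ℝ contDiffOn_const)
    (fun p hp hpt => H.inner_dx_normal_frame j m hp hpt) i hp hpt
  rwa [dx_inner_const H.isOpen _ (H.smooth_dx_normal j) _ hp] at h1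

lemma inner_dx_dx_dx_normal_frame (H : NormalForm U t₀ X N e lam) (i j k m : Fin n) (hp : p ∈ U)
    (hpt : p.2 = t₀) : ⟪dx i (dx j (dx k N)) p, e m⟫ = 0 := by
  have hs := smooth_dx H.isOpen (H.smooth_dx_normal k) j
  have h1 := H.dx_eq_zero_of_slice (f := fun p => ⟪dx j (dx k N) p, e m⟫)
    (hs.inner ℝ contDiffOn_const)
    (fun p hp hpt => H.inner_dx_dx_normal_frame j k m hp hpt) i hp hpt
  rwa [dx_inner_const H.isOpen _ hs _ hp] at h1

/-! Identities valid at all points and times. -/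

lemma inner_dx_pos_normal (H : NormalForm U t₀ X N e lam) (i : Fin n) (hp : p ∈ U) :
    ⟪dx i X p, N p⟫ = 0 := H.normal p hp _

lemma inner_dirDeriv_normal_normal (H : NormalForm U t₀ X N e lam) (v : SpaceTime n) (hp : p ∈ U) :
    ⟪dirDeriv v N p, N p⟫ = 0 := by
  have h := dirDeriv_congr H.isOpen (g := fun _ => (1 : ℝ)) H.inner_normal v hp
  rw [dirDeriv_const, dirDeriv_inner H.isOpen H.smooth_normal H.smooth_normal _ hp,
    real_inner_comm (dirDeriv v N p)] at h
  linarith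

lemma inner_dirDeriv_pos_pos (H : NormalForm U t₀ X N e lam) (v : SpaceTime n) (hp : p ∈ U) :
    ⟪dirDeriv v X p, X p⟫ = 0 := by
  have h := dirDeriv_congr H.isOpen (g := fun _ => (1 : ℝ)) H.inner_pos v hp
  rw [dirDeriv_const, dirDeriv_inner H.isOpen H.smooth H.smooth _ hp,
    real_inner_comm (dirDeriv v X p)] at h
  linarith

lemma inner_pos_dirDeriv_normal (H : NormalForm U t₀ X N e lam) (v : SpaceTime n) (hp : p ∈ U) :
    ⟪X p, dirDeriv v N p⟫ = -⟪dirDeriv v X p, N p⟫ := by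
  have h := dirDeriv_congr H.isOpen (g := fun _ => (0 : ℝ)) H.inner_pos_normal v hp
  rw [dirDeriv_const, dirDeriv_inner H.isOpen H.smooth H.smooth_normal _ hp] at h
  linarith

lemma inner_pos_dx_normal (H : NormalForm U t₀ X N e lam) (i : Fin n) (hp : p ∈ U) :
    ⟪X p, dx i N p⟫ = 0 := by
  unfold dx
  rw [H.inner_pos_dirDeriv_normal _ hp, H.normal p hp, neg_zero]

lemma inner_dx_dx_pos_normal (H : NormalForm U t₀ X N e lam) (i j : Fin n) (hp : p ∈ U) :
    ⟪dx i (dx j X) p, N p⟫ = -⟪dx j X p, dx i N p⟫ := by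
  have h := dx_congr H.isOpen (g := fun _ => (0 : ℝ))
    (fun p hp => H.inner_dx_pos_normal j hp) i hp
  rw [dx_const, dx_inner H.isOpen (H.smooth_dx_pos j) H.smooth_normal _ hp] at h
  linarith

lemma inner_dx_pos_dx_normal (H : NormalForm U t₀ X N e lam) (i j : Fin n) (hp : p ∈ U) :
    ⟪dx i X p, dx j N p⟫ = -⟪X p, dx i (dx j N) p⟫ := by
  have h := dx_congr H.isOpen (g := fun _ => (0 : ℝ))
    (fun p hp => H.inner_pos_dx_normal j hp) i hp
  rw [dx_const, dx_inner H.isOpen H.smooth (H.smooth_dx_normal j) _ hp] at h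
  linarith

lemma inner_dx_comm (H : NormalForm U t₀ X N e lam) (i j : Fin n) (hp : p ∈ U) :
    ⟪dx i X p, dx j N p⟫ = ⟪dx j X p, dx i N p⟫ := by
  rw [H.inner_dx_pos_dx_normal i j hp, H.inner_dx_pos_dx_normal j i hp,
    dx_comm H.isOpen H.smooth_normal _ _ hp]

lemma inner_dx_dx_pos_pos (H : NormalForm U t₀ X N e lam) (i j : Fin n) (hp : p ∈ U) :
    ⟪dx i (dx j X) p, X p⟫ = -⟪dx j X p, dx i X p⟫ := by
  have h := dx_congr H.isOpen (f := fun p => ⟪dx j X p, X p⟫) (g := fun _ => (0 : ℝ))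
    (fun p hp => H.inner_dirDeriv_pos_pos _ hp) i hp
  rw [dx_const, dx_inner H.isOpen (H.smooth_dx_pos j) H.smooth _ hp] at h
  linarith

lemma inner_dx_dx_normal_normal (H : NormalForm U t₀ X N e lam) (i j : Fin n) (hp : p ∈ U) :
    ⟪dx i (dx j N) p, N p⟫ = -⟪dx j N p, dx i N p⟫ := by
  have h := dx_congr H.isOpen (f := fun p => ⟪dx j N p, N p⟫) (g := fun _ => (0 : ℝ))
    (fun p hp => H.inner_dirDeriv_normal_normal _ hp) i hp
  rw [dx_const, dx_inner H.isOpen (H.smooth_dx_normal j) H.smooth_normal _ hp] at h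
  linarith

/-! Values at the origin at the time `t₀`. -/

lemma inner_dx_dx_normal_normal_zero (H : NormalForm U t₀ X N e lam) (i j : Fin n) :
    ⟪dx i (dx j N) (0, t₀), N (0, t₀)⟫ = if i = j then -1 else 0 := by
  rw [H.inner_dx_dx_normal_normal i j H.mem, H.deriv_normal, H.deriv_normal, H.frame.inner_frame]
  by_cases h : i = j
  · simp [h]
  · simp [h, Ne.symm h]

lemma inner_dx_dx_normal_pos_zero (H : NormalForm U t₀ X N e lam) (i j : Fin n) :
    ⟪dx i (dx j N) (0, t₀), X (0, t₀)⟫ = if i = j then -lam i else 0 := by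
  have := H.inner_dx_pos_dx_normal i j H.mem
  rw [H.deriv_pos, H.deriv_normal, inner_smul_left, H.frame.inner_frame] at this
  rw [real_inner_comm]
  by_cases h : i = j
  · simp [h] at this ⊢; linarith
  · simp [h] at this ⊢; linarith

lemma inner_dx_dx_pos_normal_zero (H : NormalForm U t₀ X N e lam) (i j : Fin n) :
    ⟪dx i (dx j X) (0, t₀), N (0, t₀)⟫ = if i = j then -lam i else 0 := by
  rw [H.inner_dx_dx_pos_normal i j H.mem, H.deriv_pos, H.deriv_normal, inner_smul_left,
    H.frame.inner_frame]
  by_cases h : i = j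
  · simp [h]
  · simp [h, Ne.symm h]

lemma inner_dx_dx_pos_pos_zero (H : NormalForm U t₀ X N e lam) (i j : Fin n) :
    ⟪dx i (dx j X) (0, t₀), X (0, t₀)⟫ = if i = j then -(lam i ^ 2) else 0 := by
  rw [H.inner_dx_dx_pos_pos i j H.mem, H.deriv_pos, H.deriv_pos, inner_smul_left, inner_smul_right,
    H.frame.inner_frame]
  by_cases h : i = j
  · simp [h, pow_two]
  · simp [h, Ne.symm h]

/-- The first derivatives of the second fundamental form at the origin. -/
lemma dx_inner_zero (H : NormalForm U t₀ X N e lam) (i j m : Fin n) :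
    dx i (fun p => ⟪dx j X p, dx m N p⟫) (0, t₀) = ⟪dx i (dx j X) (0, t₀), e m⟫ := by
  rw [dx_inner H.isOpen (H.smooth_dx_pos j) (H.smooth_dx_normal m) _ H.mem, H.deriv_pos,
    H.deriv_normal, inner_smul_left, real_inner_comm _ (e j),
    H.inner_dx_dx_normal_frame i m j H.mem rfl, mul_zero, add_zero]

/-- The Codazzi equations at the origin, together with `dx_dx_pos_comm`. -/
lemma codazzi (H : NormalForm U t₀ X N e lam) (i j m : Fin n) :
    ⟪dx i (dx j X) (0, t₀), e m⟫ = ⟪dx i (dx m X) (0, t₀), e j⟫ := by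
  rw [← H.dx_inner_zero, ← H.dx_inner_zero]
  exact dirDeriv_congr H.isOpen (fun p hp => H.inner_dx_comm j m hp) _ H.mem

lemma dx_dx_pos_comm (H : NormalForm U t₀ X N e lam) (i j : Fin n) :
    dx i (dx j X) (0, t₀) = dx j (dx i X) (0, t₀) :=
  dirDeriv_comm H.isOpen H.smooth _ _ H.mem

lemma dx_inner_normal_zero (H : NormalForm U t₀ X N e lam) (i m : Fin n) :
    dx i (fun p => ⟪dx m N p, dx m N p⟫) (0, t₀) = 0 := by
  rw [dx_inner H.isOpen (H.smooth_dx_normal m) (H.smooth_dx_normal m) _ H.mem, H.deriv_normal,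
    real_inner_comm _ (e m), H.inner_dx_dx_normal_frame i m m H.mem rfl, add_zero]

lemma dx_dx_inner_normal_zero (H : NormalForm U t₀ X N e lam) (i m : Fin n) :
    dx i (dx i (fun p => ⟪dx m N p, dx m N p⟫)) (0, t₀) =
      if i = m then 2 * (1 + lam m ^ 2) else 0 := by
  have h1 := H.inner_dx_dx_dx_normal_frame i i m m H.mem rfl
  have h2 : ⟪dx i (dx m N) (0, t₀), dx i (dx m N) (0, t₀)⟫ = if i = m then 1 + lam m ^ 2 else 0 := by
    rw [H.frame.inner_eq, H.inner_dx_dx_normal_normal_zero, H.inner_dx_dx_normal_pos_zero]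
    simp only [H.inner_dx_dx_normal_frame i m _ H.mem rfl]
    by_cases h : i = m
    · simp [h]; ring
    · simp [h]
  rw [dx_dx_inner H.isOpen (H.smooth_dx_normal m) (H.smooth_dx_normal m) _ _ H.mem, h2,
    H.deriv_normal, real_inner_comm _ (e m), h1]
  by_cases h : i = m
  · simp [h]; ring
  · simp [h]

/-- Simons' identity at the origin: the second derivatives of the second fundamental form commute
up to terms given by the Gauss equation. -/
lemma simons (H : NormalForm U t₀ X N e lam) (k m : Fin n) :
    dx m (dx m (fun p => ⟪dx k X p, dx k N p⟫)) (0, t₀) -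
      dx k (dx k (fun p => ⟪dx m X p, dx m N p⟫)) (0, t₀) =
      (lam k - lam m) * (1 + lam m * lam k) := by
  have hs : ∀ m, ContDiffOn ℝ ∞ (dx m (dx m N)) U := fun m =>
    smooth_dirDeriv H.isOpen (H.smooth_dx_normal m) _
  -- The entry `⟪∂ₘ X, ∂ₘ N⟫` equals `-⟪X, ∂ₘ² N⟫`, and `∂ₖ² ∂ₘ² N` is symmetric in `k` and `m`.
  have h : ∀ k m : Fin n, dx k (dx k (fun p => ⟪dx m X p, dx m N p⟫)) (0, t₀) =
      -(⟪dx k (dx k X) (0, t₀), dx m (dx m N) (0, t₀)⟫ +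
        ⟪X (0, t₀), dx k (dx k (dx m (dx m N))) (0, t₀)⟫) := by
    intro k m
    have e1 : ∀ p ∈ U, dx k (fun p => ⟪dx m X p, dx m N p⟫) p =
        -dx k (fun p => ⟪X p, dx m (dx m N) p⟫) p := by
      intro p hp
      rw [← dx_neg]
      exact dx_congr H.isOpen (fun p hp => H.inner_dx_pos_dx_normal m m hp) _ hp
    have h1 := H.inner_dx_dx_dx_normal_frame k m m k H.mem rfl
    rw [dx_congr H.isOpen e1 _ H.mem, dx_neg, dx_dx_inner H.isOpen H.smooth (hs m) _ _ H.mem,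
      H.deriv_pos, inner_smul_left, real_inner_comm _ (e k), h1]
    simp
  have hcomm : dx k (dx k (dx m (dx m N))) (0, t₀) = dx m (dx m (dx k (dx k N))) (0, t₀) := by
    have hU := H.isOpen
    have c1 : ∀ p ∈ U, dx k (dx m (dx m N)) p = dx m (dx k (dx m N)) p := fun p hp =>
      dirDeriv_comm hU (H.smooth_dx_normal m) _ _ hp
    have c2 : ∀ p ∈ U, dx k (dx m N) p = dx m (dx k N) p := fun p hp =>
      dirDeriv_comm hU H.smooth_normal _ _ hp
    have c3 : ∀ p ∈ U, dx k (dx k (dx m N)) p = dx m (dx k (dx k N)) p := fun p hp => by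
      have a1 : dx k (dx k (dx m N)) p = dx k (dx m (dx k N)) p := dirDeriv_congr hU c2 _ hp
      rw [a1]
      exact dirDeriv_comm hU (H.smooth_dx_normal k) _ _ hp
    have a1 : dx k (dx k (dx m (dx m N))) (0, t₀) = dx k (dx m (dx k (dx m N))) (0, t₀) :=
      dirDeriv_congr hU c1 _ H.mem
    have a2 : dx k (dx m (dx k (dx m N))) (0, t₀) = dx m (dx k (dx k (dx m N))) (0, t₀) :=
      dirDeriv_comm hU (smooth_dirDeriv hU (H.smooth_dx_normal m) _) _ _ H.mem
    have a3 : dx m (dx k (dx k (dx m N))) (0, t₀) = dx m (dx m (dx k (dx k N))) (0, t₀) :=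
      dirDeriv_congr hU c3 _ H.mem
    rw [a1, a2, a3]
  have hin : ∀ k m : Fin n, ⟪dx k (dx k X) (0, t₀), dx m (dx m N) (0, t₀)⟫ =
      lam k + lam k ^ 2 * lam m := by
    intro k m
    rw [H.frame.inner_eq, H.inner_dx_dx_normal_normal_zero, H.inner_dx_dx_normal_pos_zero,
      H.inner_dx_dx_pos_normal_zero, H.inner_dx_dx_pos_pos_zero]
    simp only [H.inner_dx_dx_normal_frame m m _ H.mem rfl]
    simp
    ring
  rw [h m k, h k m, hcomm, hin, hin]
  ring

/-! Time derivatives, for the flow with normal speed `f`. -/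

lemma inner_dt_normal_frame (H : NormalForm U t₀ X N e lam) {f : SpaceTime n → ℝ}
    (hf : ContDiffOn ℝ ∞ f U) (hflow : ∀ p ∈ U, dt X p = f p • N p) (hlam : ∀ i, 0 < lam i)
    (k : Fin n) : ⟪dt N (0, t₀), e k⟫ = -(dx k f (0, t₀) / lam k) := by
  have h := dirDeriv_congr H.isOpen (g := fun _ => (0 : ℝ))
    (fun p hp => H.inner_dx_pos_normal k hp)
    ((0 : EuclideanSpace ℝ (Fin n)), (1 : ℝ)) H.mem
  rw [dirDeriv_const, dirDeriv_inner H.isOpen (H.smooth_dx_pos k) H.smooth_normal _ H.mem] at h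
  have h1 : dirDeriv ((0 : EuclideanSpace ℝ (Fin n)), (1 : ℝ)) (dx k X) (0, t₀) =
      dx k f (0, t₀) • N (0, t₀) + f (0, t₀) • dx k N (0, t₀) := by
    have a1 : dirDeriv ((0 : EuclideanSpace ℝ (Fin n)), (1 : ℝ)) (dx k X) (0, t₀) =
      dx k (dt X) (0, t₀) := dirDeriv_comm H.isOpen H.smooth _ _ H.mem
    rw [a1]
    have a2 : dx k (dt X) (0, t₀) = dx k (fun p => f p • N p) (0, t₀) :=
      dirDeriv_congr H.isOpen hflow _ H.mem
    rw [a2]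
    exact dirDeriv_smul H.isOpen hf H.smooth_normal _ H.mem
  rw [h1, H.deriv_pos, H.deriv_normal, inner_add_left, inner_smul_left, inner_smul_left,
    inner_smul_left, H.frame.inner_normal, H.frame.inner_frame_normal] at h
  have := (hlam k).ne'
  simp only [conj_trivial, mul_one, mul_zero, add_zero] at h
  unfold dt
  rw [real_inner_comm] at h
  field_simp
  linarith

lemma inner_dt_normal_pos (H : NormalForm U t₀ X N e lam) {f : SpaceTime n → ℝ}
    (hflow : ∀ p ∈ U, dt X p = f p • N p) : ⟪dt N (0, t₀), X (0, t₀)⟫ = -f (0, t₀) := by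
  have h := H.inner_pos_dirDeriv_normal ((0 : EuclideanSpace ℝ (Fin n)), (1 : ℝ)) H.mem
  have h1 := hflow _ H.mem
  unfold dt at h1 ⊢
  rw [real_inner_comm, h, h1, inner_smul_left, H.frame.inner_normal]
  simp

/-- Evolution of the second fundamental form at the origin. -/
lemma dt_inner (H : NormalForm U t₀ X N e lam) {f : SpaceTime n → ℝ}
    (hf : ContDiffOn ℝ ∞ f U) (hflow : ∀ p ∈ U, dt X p = f p • N p) (hlam : ∀ i, 0 < lam i)
    (m : Fin n) : dt (fun p => ⟪dx m X p, dx m N p⟫) (0, t₀) =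
      -dx m (dx m f) (0, t₀) + f (0, t₀) - lam m ^ 2 * f (0, t₀) +
        ∑ k, ⟪dx m (dx m X) (0, t₀), e k⟫ * (dx k f (0, t₀) / lam k) := by
  have hU := H.isOpen
  set τ : SpaceTime n := ((0 : EuclideanSpace ℝ (Fin n)), (1 : ℝ)) with hτ
  have hs : ContDiffOn ℝ ∞ (dx m (dx m X)) U := smooth_dirDeriv hU (H.smooth_dx_pos m) _
  have e1 : dt (fun p => ⟪dx m X p, dx m N p⟫) (0, t₀) =
      -dirDeriv τ (fun p => ⟪dx m (dx m X) p, N p⟫) (0, t₀) := by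
    rw [← dirDeriv_neg]
    exact dirDeriv_congr hU (fun p hp => by
      have := H.inner_dx_dx_pos_normal m m hp
      linarith) _ H.mem
  rw [e1, dirDeriv_inner hU hs H.smooth_normal _ H.mem]
  have e2 : dirDeriv τ (dx m (dx m X)) (0, t₀) = dx m (dx m (fun p => f p • N p)) (0, t₀) := by
    have a1 : dirDeriv τ (dx m (dx m X)) (0, t₀) = dx m (dirDeriv τ (dx m X)) (0, t₀) :=
      dirDeriv_comm hU (H.smooth_dx_pos m) _ _ H.mem
    have a2 : ∀ p ∈ U, dirDeriv τ (dx m X) p = dx m (dt X) p := fun p hp =>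
      dirDeriv_comm hU H.smooth _ _ hp
    have a3 : ∀ p ∈ U, dx m (dt X) p = dx m (fun p => f p • N p) p := fun p hp =>
      dirDeriv_congr hU hflow _ hp
    rw [a1]
    exact dirDeriv_congr hU (fun p hp => (a2 p hp).trans (a3 p hp)) _ H.mem
  have e3 : dx m (dx m (fun p => f p • N p)) (0, t₀) =
      dx m (dx m f) (0, t₀) • N (0, t₀) + dx m f (0, t₀) • dx m N (0, t₀) +
        (dx m f (0, t₀) • dx m N (0, t₀) + f (0, t₀) • dx m (dx m N) (0, t₀)) := by
    rw [dx_congr hU (fun p hp => dx_smul hU hf H.smooth_normal m hp) m H.mem,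
      dx_add hU (f := fun p => dx m f p • N p) (g := fun p => f p • dx m N p)
        ((smooth_dx hU hf m).smul H.smooth_normal) (hf.smul (H.smooth_dx_normal m)) m H.mem,
      dx_smul hU (smooth_dx hU hf m) H.smooth_normal m H.mem,
      dx_smul hU hf (H.smooth_dx_normal m) m H.mem]
  rw [e2, e3, H.deriv_normal]
  have e4 : ⟪dx m (dx m X) (0, t₀), dirDeriv τ N (0, t₀)⟫ =
      -∑ k, ⟪dx m (dx m X) (0, t₀), e k⟫ * (dx k f (0, t₀) / lam k) + lam m ^ 2 * f (0, t₀) := by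
    rw [H.frame.inner_eq, H.inner_dirDeriv_normal_normal τ H.mem, H.inner_dx_dx_pos_pos_zero]
    have b1 : ⟪dirDeriv τ N (0, t₀), X (0, t₀)⟫ = -f (0, t₀) := H.inner_dt_normal_pos hflow
    have b2 : ∀ k, ⟪dirDeriv τ N (0, t₀), e k⟫ = -(dx k f (0, t₀) / lam k) :=
      H.inner_dt_normal_frame hf hflow hlam
    rw [b1]
    simp only [b2, mul_neg, Finset.sum_neg_distrib]
    simp
  rw [e4]
  simp only [inner_add_left, inner_smul_left, H.frame.inner_normal, H.frame.inner_frame_normal,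
    H.inner_dx_dx_normal_normal_zero]
  simp
  ring

/-- Since `∂ₘ X = lam m • ∂ₘ N` at the origin, the time derivatives of `⟪∂ₘ X, ∂ₘ N⟫` and of
`⟪∂ₘ N, ∂ₘ N⟫` both come from `⟪∂ₘ N, ∂ₜ ∂ₘ N⟫`, up to the motion of `X`. -/
lemma lam_mul_dt_inner_normal (H : NormalForm U t₀ X N e lam) {f : SpaceTime n → ℝ}
    (hf : ContDiffOn ℝ ∞ f U) (hflow : ∀ p ∈ U, dt X p = f p • N p) (m : Fin n) :
    lam m * dt (fun p => ⟪dx m N p, dx m N p⟫) (0, t₀) =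
      2 * (dt (fun p => ⟪dx m X p, dx m N p⟫) (0, t₀) - f (0, t₀)) := by
  have hU := H.isOpen
  set τ : SpaceTime n := ((0 : EuclideanSpace ℝ (Fin n)), (1 : ℝ)) with hτ
  have e1 : dt (fun p => ⟪dx m X p, dx m N p⟫) (0, t₀) = _ :=
    dirDeriv_inner hU (H.smooth_dx_pos m) (H.smooth_dx_normal m) τ H.mem
  have e2 : dt (fun p => ⟪dx m N p, dx m N p⟫) (0, t₀) = _ :=
    dirDeriv_inner hU (H.smooth_dx_normal m) (H.smooth_dx_normal m) τ H.mem
  have e3 : dirDeriv τ (dx m X) (0, t₀) =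
      dx m f (0, t₀) • N (0, t₀) + f (0, t₀) • dx m N (0, t₀) := by
    have a1 : dirDeriv τ (dx m X) (0, t₀) = dx m (dt X) (0, t₀) :=
      dirDeriv_comm hU H.smooth _ _ H.mem
    have a2 : dx m (dt X) (0, t₀) = dx m (fun p => f p • N p) (0, t₀) :=
      dirDeriv_congr hU hflow _ H.mem
    rw [a1, a2]
    exact dirDeriv_smul hU hf H.smooth_normal _ H.mem
  rw [e1, e2, e3, H.deriv_pos, H.deriv_normal]
  simp only [inner_add_left, inner_smul_left, H.frame.inner_frame, real_inner_comm (e m) (N (0, t₀)),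
    H.frame.inner_frame_normal, conj_trivial, if_true]
  rw [real_inner_comm (e m)]
  ring

end NormalForm
end NormalForm

/-! ### A supporting function for the reciprocal of the curvature quotient -/

namespace NormalForm

variable {n : ℕ} {U : Set (SpaceTime n)} {t₀ : ℝ} {X N : SpaceTime n → Amb n} {e : Fin n → Amb n}
  {lam : Fin n → ℝ} {p : SpaceTime n}

lemma dx_mul_of_eq_zero {f g : SpaceTime n → ℝ} (hU : IsOpen U) (hf : ContDiffOn ℝ ∞ f U)
    (hg : ContDiffOn ℝ ∞ g U) (i : Fin n) (hp : p ∈ U) (hf0 : f p = 0) (hg0 : g p = 0) :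
    dx i (fun p => f p * g p) p = 0 := by
  rw [dx_mul hU hf hg i hp, hf0, hg0]; ring

lemma dx_dx_mul_of_eq_zero {f g : SpaceTime n → ℝ} (hU : IsOpen U) (hf : ContDiffOn ℝ ∞ f U)
    (hg : ContDiffOn ℝ ∞ g U) (i : Fin n) (hp : p ∈ U) (hf0 : f p = 0) (hg0 : g p = 0) :
    dx i (dx i (fun p => f p * g p)) p = 2 * (dx i f p * dx i g p) := by
  rw [dx_dx_mul hU hf hg i i hp, hf0, hg0]; ring

/-- The components, in the tangent frame `e` at the origin, of the frame at `p` that is obtained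
from `e` by rotation. -/
def frameCoeff (t₀ : ℝ) (X N : SpaceTime n → Amb n) (e : Fin n → Amb n) (i j : Fin n) :
    SpaceTime n → ℝ :=
  fun p => ⟪tiltFrame (X (0, t₀)) (N (0, t₀)) (X p) (N p) (e i), e j⟫

/-- The first derivatives of the coefficients vanish at the origin; the pure second derivatives only
record the tilting of `e m` towards the normal and position vectors. -/
lemma frameCoeff_spec (H : NormalForm U t₀ X N e lam) (i j : Fin n) :
    ContDiffOn ℝ ∞ (frameCoeff t₀ X N e i j) U ∧
    frameCoeff t₀ X N e i j (0, t₀) = (if i = j then 1 else 0) ∧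
    (∀ m, dx m (frameCoeff t₀ X N e i j) (0, t₀) = 0) ∧
    ∀ m, dx m (dx m (frameCoeff t₀ X N e i j)) (0, t₀) =
      if i = m ∧ j = m then -(1 + lam m ^ 2) else 0 := by
  have hU := H.isOpen
  set X₀ := X (0, t₀) with hX₀
  set N₀ := N (0, t₀) with hN₀
  set α : SpaceTime n → ℝ := fun p => (1 + ⟪N₀, N p⟫)⁻¹ with hα
  set β : SpaceTime n → ℝ := fun p => (1 + ⟪tilt N₀ (N p) X₀, X p⟫)⁻¹ with hβ
  set P : Fin n → SpaceTime n → ℝ := fun i p => ⟪N p, e i⟫ with hP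
  set R : Fin n → SpaceTime n → ℝ := fun i p => ⟪X p, e i⟫ - (α p * P i p) * ⟪X p, N₀⟫ with hR
  set T : Fin n → SpaceTime n → ℝ := fun j p => ⟪X p, e j⟫ - (α p * ⟪N p, X₀⟫) * P j p with hT
  have sc : ∀ c : Amb n, ContDiffOn ℝ ∞ (fun p => ⟪X p, c⟫) U := fun c =>
    H.smooth.inner ℝ contDiffOn_const
  have sn : ∀ c : Amb n, ContDiffOn ℝ ∞ (fun p => ⟪N p, c⟫) U := fun c =>
    H.smooth_normal.inner ℝ contDiffOn_const
  have sα : ContDiffOn ℝ ∞ α U :=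
    (contDiffOn_const.add (contDiffOn_const.inner ℝ H.smooth_normal)).inv
      fun p hp => H.one_add_inner_ne p hp
  have st : ContDiffOn ℝ ∞ (fun p => tilt N₀ (N p) X₀) U := by
    unfold tilt
    exact contDiffOn_const.sub ((sα.mul (sn X₀)).smul (contDiffOn_const.add H.smooth_normal))
  have sβ : ContDiffOn ℝ ∞ β U :=
    (contDiffOn_const.add (st.inner ℝ H.smooth)).inv fun p hp => H.one_add_inner_tilt_ne p hp
  have sP : ∀ i, ContDiffOn ℝ ∞ (P i) U := fun i => sn _
  have sR : ∀ i, ContDiffOn ℝ ∞ (R i) U := fun i => (sc _).sub ((sα.mul (sP i)).mul (sc _))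
  have sT : ∀ i, ContDiffOn ℝ ∞ (T i) U := fun i => (sc _).sub ((sα.mul (sn _)).mul (sP i))
  have hNe : ∀ j, ⟪N₀, e j⟫ = 0 := fun j => by rw [real_inner_comm]; exact H.frame.inner_frame_normal j
  have hXe : ∀ j, ⟪X₀, e j⟫ = 0 := fun j => by rw [real_inner_comm]; exact H.frame.inner_frame_pos j
  have hXN : ⟪X₀, N₀⟫ = 0 := H.frame.inner_pos_normal
  have hNX : ⟪N₀, X₀⟫ = 0 := by rw [real_inner_comm]; exact hXN
  have hN1 : ⟪N₀, N₀⟫ = 1 := H.frame.inner_normal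
  have hX1 : ⟪X₀, X₀⟫ = 1 := H.frame.inner_pos
  -- The explicit form of the coefficients.
  have key : ∀ p ∈ U, frameCoeff t₀ X N e i j p =
      (if i = j then 1 else 0) - (α p * P i p) * P j p - (β p * R i p) * T j p := by
    intro p hp
    have h1 : ∀ i j, ⟪tilt N₀ (N p) (e i), e j⟫ = (if i = j then 1 else 0) - (α p * P i p) * P j p := by
      intro i j
      unfold tilt
      simp only [inner_sub_left, inner_smul_left, inner_add_left, hNe, H.frame.inner_frame,
        conj_trivial, hα, hP]
      ring
    have h2 : ⟪X p, tilt N₀ (N p) (e i)⟫ = R i p := by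
      unfold tilt
      simp only [inner_sub_right, inner_smul_right, inner_add_right, H.inner_pos_normal p hp,
        hα, hP, hR]
      ring
    have h3 : ⟪tilt N₀ (N p) X₀ + X p, e j⟫ = T j p := by
      unfold tilt
      simp only [inner_sub_left, inner_smul_left, inner_add_left, hNe, hXe, conj_trivial,
        hα, hP, hT]
      ring
    unfold frameCoeff tiltFrame
    rw [← hX₀, ← hN₀]
    rw [show ∀ a x v : Amb n, tilt a x v = v - ((1 + ⟪a, x⟫)⁻¹ * ⟪x, v⟫) • (a + x) from
      fun _ _ _ => rfl, inner_sub_left, h1, inner_smul_left, h2, h3]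
    simp only [conj_trivial, hβ]
  have sM : ContDiffOn ℝ ∞ (fun p => (if i = j then (1 : ℝ) else 0) - (α p * P i p) * P j p -
      (β p * R i p) * T j p) U :=
    (contDiffOn_const.sub ((sα.mul (sP i)).mul (sP j))).sub ((sβ.mul (sR i)).mul (sT j))
  have smooth : ContDiffOn ℝ ∞ (frameCoeff t₀ X N e i j) U := sM.congr key
  have mem := H.mem
  -- Values and derivatives of the factors at the origin.
  have P0 : ∀ i, P i (0, t₀) = 0 := fun i => hNe i
  have R0 : ∀ i, R i (0, t₀) = 0 := fun i => by
    simp only [hR]; rw [← hX₀, hXe, hXN]; ring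
  have T0 : ∀ i, T i (0, t₀) = 0 := fun i => by
    simp only [hT]; rw [P0, ← hX₀, hXe]; ring
  have α0 : α (0, t₀) = 1 / 2 := by
    simp only [hα]; rw [← hN₀, hN1]; norm_num
  have β0 : β (0, t₀) = 1 / 2 := by
    simp only [hβ]
    rw [← hN₀, ← hX₀]
    have : tilt N₀ N₀ X₀ = X₀ := by unfold tilt; rw [hNX]; simp
    rw [this, hX1]; norm_num
  have dP : ∀ m i, dx m (P i) (0, t₀) = if m = i then 1 else 0 := fun m i => by
    simp only [hP]
    rw [dx_inner_const hU _ H.smooth_normal _ mem]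
    exact H.inner_dx_normal_frame m i mem rfl
  have dX : ∀ m i, dx m (fun p => ⟪X p, e i⟫) (0, t₀) = if m = i then lam m else 0 := fun m i => by
    rw [dx_inner_const hU _ H.smooth _ mem, H.deriv_pos, inner_smul_left, H.frame.inner_frame]
    simp
  have dR : ∀ m i, dx m (R i) (0, t₀) = if m = i then lam m else 0 := fun m i => by
    simp only [hR]
    rw [dx_sub hU (sc _) ((sα.mul (sP i)).mul (sc _)) m mem, dX,
      dx_mul_of_eq_zero hU (sα.mul (sP i)) (sc _) m mem (by rw [P0, mul_zero]) hXN, sub_zero]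
  have dT : ∀ m i, dx m (T i) (0, t₀) = if m = i then lam m else 0 := fun m i => by
    simp only [hT]
    rw [dx_sub hU (sc _) ((sα.mul (sn _)).mul (sP i)) m mem, dX,
      dx_mul_of_eq_zero hU (sα.mul (sn _)) (sP i) m mem
        (by rw [show ⟪N (0, t₀), X₀⟫ = 0 from hNX, mul_zero]) (P0 i), sub_zero]
  have dαP : ∀ m i, dx m (fun p => α p * P i p) (0, t₀) = 1 / 2 * if m = i then 1 else 0 :=
    fun m i => by rw [dx_mul hU sα (sP i) m mem, P0, dP, α0]; ring
  have dβR : ∀ m i, dx m (fun p => β p * R i p) (0, t₀) = 1 / 2 * if m = i then lam m else 0 :=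
    fun m i => by rw [dx_mul hU sβ (sR i) m mem, R0, dR, β0]; ring
  have s1 := (sα.mul (sP i)).mul (sP j)
  have s2 := (sβ.mul (sR i)).mul (sT j)
  have d1 : ∀ m, ∀ p ∈ U, dx m (frameCoeff t₀ X N e i j) p =
      -(dx m (fun p => (α p * P i p) * P j p) p + dx m (fun p => (β p * R i p) * T j p) p) := by
    intro m p hp
    rw [dx_congr hU key m hp, dx_sub hU (contDiffOn_const.sub s1) s2 m hp,
      dx_sub hU contDiffOn_const s1 m hp, dx_const]
    ring
  refine ⟨smooth, ?_, fun m => ?_, fun m => ?_⟩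
  · rw [key _ mem, P0, R0]; simp
  · rw [d1 m _ mem,
      dx_mul_of_eq_zero hU (sα.mul (sP i)) (sP j) m mem (by rw [P0, mul_zero]) (P0 j),
      dx_mul_of_eq_zero hU (sβ.mul (sR i)) (sT j) m mem (by rw [R0, mul_zero]) (T0 j)]
    ring
  · rw [dx_congr hU (d1 m) m mem, dx_neg, dx_add hU (smooth_dx hU s1 m) (smooth_dx hU s2 m) m mem,
      dx_dx_mul_of_eq_zero hU (sα.mul (sP i)) (sP j) m mem (by rw [P0, mul_zero]) (P0 j),
      dx_dx_mul_of_eq_zero hU (sβ.mul (sR i)) (sT j) m mem (by rw [R0, mul_zero]) (T0 j),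
      dαP, dβR, dP, dT]
    by_cases h1 : m = i <;> by_cases h2 : m = j
    · subst h1; subst h2; simp; ring
    · subst h1; simp [h2, Ne.symm h2]
    · subst h2; simp [h1, Ne.symm h1]
    · simp [h1, h2, Ne.symm h1, Ne.symm h2]

/-- The linear function with coefficients `l` of the principal radii, evaluated at the diagonal
entries of the inverse Weingarten map in the rotated frame. -/
def supportFun (t₀ : ℝ) (X N : SpaceTime n → Amb n) (e : Fin n → Amb n) (l : Fin n → ℝ) :
    SpaceTime n → ℝ :=
  fun p => ∑ i, l i * ∑ j, ∑ r, (frameCoeff t₀ X N e i j p * frameCoeff t₀ X N e i r p) *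
    ⟪dx j X p, dx r N p⟫

/-- The supporting function at the origin, to second order. The rotation of the frame contributes
the last term, which compensates the second derivatives of `⟪dx m N, dx m N⟫` in the maximum
principle. -/
lemma supportFun_spec (H : NormalForm U t₀ X N e lam) (l : Fin n → ℝ) :
    ContDiffOn ℝ ∞ (supportFun t₀ X N e l) U ∧
    supportFun t₀ X N e l (0, t₀) = ∑ i, l i * lam i ∧
    (∀ m, dx m (supportFun t₀ X N e l) (0, t₀) = ∑ i, l i * ⟪dx m (dx i X) (0, t₀), e i⟫) ∧
    ∀ m, dx m (dx m (supportFun t₀ X N e l)) (0, t₀) =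
      ∑ i, l i * dx m (dx m (fun p => ⟪dx i X p, dx i N p⟫)) (0, t₀) -
        2 * l m * lam m * (1 + lam m ^ 2) := by
  have hU := H.isOpen
  have mem := H.mem
  set M := frameCoeff t₀ X N e with hM
  set h : Fin n → Fin n → SpaceTime n → ℝ := fun j r p => ⟪dx j X p, dx r N p⟫ with hh
  have sh : ∀ j r, ContDiffOn ℝ ∞ (h j r) U := fun j r =>
    (H.smooth_dx_pos j).inner ℝ (H.smooth_dx_normal r)
  have sM : ∀ i j, ContDiffOn ℝ ∞ (M i j) U := fun i j => (H.frameCoeff_spec i j).1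
  have sMM : ∀ i j r, ContDiffOn ℝ ∞ (fun p => M i j p * M i r p) U := fun i j r =>
    (sM i j).mul (sM i r)
  have M0 : ∀ i j, M i j (0, t₀) = if i = j then 1 else 0 := fun i j => (H.frameCoeff_spec i j).2.1
  have M1 : ∀ i j m, dx m (M i j) (0, t₀) = 0 := fun i j => (H.frameCoeff_spec i j).2.2.1
  have M2 : ∀ i j m, dx m (dx m (M i j)) (0, t₀) = if i = m ∧ j = m then -(1 + lam m ^ 2) else 0 :=
    fun i j => (H.frameCoeff_spec i j).2.2.2
  have h0 : ∀ j r, h j r (0, t₀) = if j = r then lam j else 0 := fun j r => by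
    simp only [hh]
    rw [H.deriv_pos, H.deriv_normal, inner_smul_left, H.frame.inner_frame]
    simp
  have sMMh : ∀ i j r, ContDiffOn ℝ ∞ (fun p => (M i j p * M i r p) * h j r p) U := fun i j r =>
    (sMM i j r).mul (sh j r)
  have MM1 : ∀ i j r m, dx m (fun p => M i j p * M i r p) (0, t₀) = 0 := fun i j r m => by
    rw [dx_mul hU (sM i j) (sM i r) m mem, M1, M1]; ring
  have srow : ∀ i, ContDiffOn ℝ ∞ (fun p => ∑ j, ∑ r, (M i j p * M i r p) * h j r p) U := fun i =>
    ContDiffOn.sum fun j _ => ContDiffOn.sum fun r _ => sMMh i j r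
  have d1row : ∀ i m, ∀ p ∈ U, dx m (fun p => ∑ j, ∑ r, (M i j p * M i r p) * h j r p) p =
      ∑ j, ∑ r, dx m (fun p => (M i j p * M i r p) * h j r p) p := by
    intro i m p hp
    rw [dx_sum hU (f := fun j p => ∑ r, (M i j p * M i r p) * h j r p)
      (fun j => ContDiffOn.sum fun r _ => sMMh i j r) m hp]
    refine Finset.sum_congr rfl fun j _ => ?_
    exact dx_sum hU (f := fun r p => (M i j p * M i r p) * h j r p) (fun r => sMMh i j r) m hp
  have d1 : ∀ m, ∀ p ∈ U, dx m (supportFun t₀ X N e l) p =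
      ∑ i, l i * dx m (fun p => ∑ j, ∑ r, (M i j p * M i r p) * h j r p) p := by
    intro m p hp
    have := dx_sum (s := Finset.univ) hU
      (f := fun i p => l i * ∑ j, ∑ r, (M i j p * M i r p) * h j r p)
      (fun i => contDiffOn_const.mul (srow i)) m hp
    refine this.trans (Finset.sum_congr rfl fun i _ => ?_)
    exact dx_const_mul hU _ (srow i) m hp
  refine ⟨ContDiffOn.sum fun i _ => contDiffOn_const.mul (srow i), ?_, fun m => ?_, fun m => ?_⟩
  · refine Finset.sum_congr rfl fun i _ => ?_
    congr 1
    rw [Finset.sum_eq_single i, Finset.sum_eq_single i]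
    · have := h0 i i
      simp only [hh] at this
      rw [this, ← hM, M0]; simp
    · intro r _ hr
      rw [← hM, M0 i r, if_neg (Ne.symm hr)]; ring
    · simp
    · intro j _ hj
      refine Finset.sum_eq_zero fun r _ => ?_
      rw [← hM, M0 i j, if_neg (Ne.symm hj)]; ring
    · simp
  · rw [d1 m _ mem]
    refine Finset.sum_congr rfl fun i _ => ?_
    congr 1
    rw [d1row i m _ mem, ← H.dx_inner_zero]
    have hterm : ∀ j r, dx m (fun p => (M i j p * M i r p) * h j r p) (0, t₀) =
        (if i = j then 1 else 0) * (if i = r then 1 else 0) * dx m (h j r) (0, t₀) := fun j r => by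
      rw [dx_mul hU (sMM i j r) (sh j r) m mem, MM1, M0, M0]; ring
    simp only [hterm]
    rw [Finset.sum_eq_single i, Finset.sum_eq_single i]
    · simp [hh]
    · intro r _ hr
      rw [if_neg (Ne.symm hr)]; ring
    · simp
    · intro j _ hj
      refine Finset.sum_eq_zero fun r _ => ?_
      rw [if_neg (Ne.symm hj)]; ring
    · simp
  · have hsum : ∀ i, dx m (dx m (fun p => ∑ j, ∑ r, (M i j p * M i r p) * h j r p)) (0, t₀) =
        dx m (dx m (h i i)) (0, t₀) - if i = m then 2 * lam m * (1 + lam m ^ 2) else 0 := by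
      intro i
      rw [dx_congr hU (d1row i m) m mem, dx_sum hU
        (f := fun j p => ∑ r, dx m (fun p => (M i j p * M i r p) * h j r p) p)
        (fun j => ContDiffOn.sum fun r _ => smooth_dx hU (sMMh i j r) m) m mem]
      have hterm : ∀ j r, dx m (dx m (fun p => (M i j p * M i r p) * h j r p)) (0, t₀) =
          ((if i = m ∧ j = m then -(1 + lam m ^ 2) else 0) * (if i = r then 1 else 0) +
            (if i = j then 1 else 0) * (if i = m ∧ r = m then -(1 + lam m ^ 2) else 0)) *
              (if j = r then lam j else 0) +
          (if i = j then 1 else 0) * (if i = r then 1 else 0) * dx m (dx m (h j r)) (0, t₀) := by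
        intro j r
        rw [dx_dx_mul hU (sMM i j r) (sh j r) m m mem, MM1, dx_dx_mul hU (sM i j) (sM i r) m m mem]
        simp only [M0, M1, M2, h0]
        ring
      have hinner : ∀ j, dx m (fun p => ∑ r, dx m (fun p => (M i j p * M i r p) * h j r p) p) (0, t₀) =
          ∑ r, dx m (dx m (fun p => (M i j p * M i r p) * h j r p)) (0, t₀) := fun j =>
        dx_sum hU (f := fun r p => dx m (fun p => (M i j p * M i r p) * h j r p) p)
          (fun r => smooth_dx hU (sMMh i j r) m) m mem
      simp only [hinner, hterm]
      rw [Finset.sum_eq_single i, Finset.sum_eq_single i]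
      · by_cases him : i = m
        · subst him; simp; ring
        · simp [him]
      · intro r _ hr
        simp [Ne.symm hr]
      · simp
      · intro j _ hj
        refine Finset.sum_eq_zero fun r _ => ?_
        by_cases him : i = m
        · subst him
          simp [hj, Ne.symm hj]
        · simp [him, Ne.symm hj]
      · simp
    rw [dx_congr hU (d1 m) m mem, dx_sum hU
      (f := fun i p => l i * dx m (fun p => ∑ j, ∑ r, (M i j p * M i r p) * h j r p) p)
      (fun i => contDiffOn_const.mul (smooth_dx hU (srow i) m)) m mem]
    have : ∀ i, dx m (fun p => l i * dx m (fun p => ∑ j, ∑ r, (M i j p * M i r p) * h j r p) p)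
        (0, t₀) = l i * dx m (dx m (h i i)) (0, t₀) -
          l i * if i = m then 2 * lam m * (1 + lam m ^ 2) else 0 := fun i => by
      rw [dx_const_mul hU _ (smooth_dx hU (srow i) m) m mem]
      have := hsum i
      rw [this]; ring
    simp only [this, Finset.sum_sub_distrib]
    congr 1
    simp
    ring

lemma inner_spaceDeriv_normal_frame (H : NormalForm U t₀ X N e lam) (hp : p ∈ U) (hpt : p.2 = t₀)
    (v : EuclideanSpace ℝ (Fin n)) (j : Fin n) : ⟪spaceDeriv N p v, e j⟫ = v j := by
  rw [spaceDeriv_eq_sum, sum_inner]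
  simp only [inner_smul_left, H.inner_dx_normal_frame _ j hp hpt]
  simp

/-- At the time `t₀` the reciprocal of the curvature quotient lies below the supporting function. -/
lemma inv_symmQuot_le_supportFun (H : NormalForm U t₀ X N e lam) (hp : p ∈ U) (hpt : p.2 = t₀)
    {k : ℕ} {l κ : Fin n → ℝ} {q : Fin n → EuclideanSpace ℝ (Fin n)}
    (hq : IsTangentFrame (fun a => spaceDeriv X p (q a)) (X p) (N p))
    (hBq : ∀ a, spaceDeriv N p (q a) = κ a • spaceDeriv X p (q a)) (hκ : ∀ i, 0 < κ i)
    (hl : ∀ y : Fin n → ℝ, (∀ i, 0 < y i) → (symmQuot Finset.univ k y)⁻¹ ≤ ∑ i, l i * (y i)⁻¹) :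
    (symmQuot Finset.univ k κ)⁻¹ ≤ supportFun t₀ X N e l p := by
  have hB : Function.Injective (spaceDeriv N p) := by
    intro v w hvw
    ext j
    rw [← H.inner_spaceDeriv_normal_frame hp hpt v j, hvw, H.inner_spaceDeriv_normal_frame hp hpt]
  have hE := H.frame.tiltFrame (H.inner_pos p hp) (H.inner_normal p hp) (H.inner_pos_normal p hp)
    (H.one_add_inner_ne p hp) (H.one_add_inner_tilt_ne p hp)
  have hεex : ∀ i, ∃ v, spaceDeriv N p v =
      tiltFrame (X (0, t₀)) (N (0, t₀)) (X p) (N p) (e i) := fun i =>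
    mem_range_of_inner_eq_zero hB (H.inner_pos p hp) (H.inner_normal p hp)
      (H.inner_pos_normal p hp) (fun v => by
        rw [real_inner_comm, spaceDeriv_apply, H.inner_pos_dirDeriv_normal _ hp, H.normal p hp,
          neg_zero])
      (fun v => H.inner_dirDeriv_normal_normal _ hp) (hE.inner_frame_pos i)
      (hE.inner_frame_normal i)
  choose ε hε using hεex
  refine (inv_symmQuot_le_sum_inner hq hBq hκ hE hB hε hl).trans_eq ?_
  refine Finset.sum_congr rfl fun i _ => ?_
  congr 1
  have hcoef : ∀ j, ε i j = frameCoeff t₀ X N e i j p := fun j => by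
    rw [← H.inner_spaceDeriv_normal_frame hp hpt (ε i) j, hε]
    rfl
  rw [spaceDeriv_eq_sum, spaceDeriv_eq_sum, sum_inner]
  refine Finset.sum_congr rfl fun j _ => ?_
  rw [inner_sum]
  refine Finset.sum_congr rfl fun r _ => ?_
  rw [inner_smul_left, inner_smul_right, hcoef, hcoef]
  simp
  ring

end NormalForm

/-! ### The maximum principle inequality -/

/-- The algebra behind the maximum principle. The data are the derivatives at a point where the
largest radius of curvature `lam m` touches the test function `C₀ (φ' - β + ε u)`; here `f` is the
speed, `Λ` the supporting function of `1 / F`, `a k j` are first derivatives of the second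
fundamental form, and `hm k`, `hk k` second derivatives of its entries `(k, k)` in the direction
`m` and `(m, m)` in the direction `k`. -/
lemma maximum_principle_algebra {n : ℕ} (m : Fin n) {lam l o fd Ld hm hk : Fin n → ℝ}
    {a : Fin n → Fin n → ℝ} {C₀ ε c φ u f fmm F Λ Λmm : ℝ}
    (hl : ∀ k, 0 ≤ l k) (hlam : ∀ k, 0 < lam k) (hu : 0 < u) (hF : 0 < F)
    (h1 : ∀ k, a m k = C₀ * (lam k * o k - ε * o k))
    (h2 : ∀ k, 0 ≤ C₀ * ((∑ j, o j * a k j - lam k ^ 2 * φ + lam k * u) - ε * (u - lam k * φ)) +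
      lam m * (if k = m then 2 * (1 + lam m ^ 2) else 0) - hk k)
    (h3 : ∀ k, hm k - hk k = (lam k - lam m) * (1 + lam m * lam k))
    (h4 : C₀ * (-(u * f) - ε * (-∑ k, o k * (fd k / lam k) - φ * f)) +
      (-fmm + f - lam m ^ 2 * f + ∑ k, a m k * (fd k / lam k)) - 2 * f ≤ 0)
    (h5 : ∀ k, (c * (lam k * o k) - fd k) * Λ + (c * φ - f) * Ld k + o k = 0)
    (h5' : 0 ≤ (c * (∑ j, o j * a m j - lam m ^ 2 * φ + lam m * u) - fmm) * Λ +
      2 * (c * (lam m * o m) - fd m) * Ld m + (c * φ - f) * Λmm + (u - lam m * φ))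
    (h6 : Λmm = ∑ k, l k * hm k - 2 * l m * lam m * (1 + lam m ^ 2))
    (h7 : f = c * φ - F * u) (h8 : Λ = ∑ k, l k * lam k) (h9 : F * Λ = 1)
    (h10 : ∀ j, Ld j = ∑ k, l k * a k j) :
    0 ≤ u * lam m * (F ^ 2 * ∑ k, l k * lam k ^ 2 + c) + c * φ + u * F - F * lam m * φ +
      F * o m ^ 2 / (2 * u) - u * lam m * (F ^ 2 * ∑ k, l k) - 2 * u * lam m ^ 2 * F +
      C₀ * (-(u * φ * (F ^ 2 * ∑ k, l k * lam k ^ 2 - c)) - F * ∑ k, o k ^ 2) +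
      C₀ * ε * (-(c * (φ ^ 2 + ∑ k, o k ^ 2)) + 2 * u * φ * F - u ^ 2 * (F ^ 2 * ∑ k, l k)) := by
  set S₁ := ∑ k, l k with hS1
  set S₂ := ∑ k, l k * lam k ^ 2 with hS2
  set B := ∑ k, o k ^ 2 with hB
  set A := ∑ k, lam k * o k ^ 2 with hA
  set P := ∑ k, o k * Ld k with hP
  -- Second derivatives of the supporting function.
  have i1 : ∑ k, l k * hk k ≤ C₀ * (P - S₂ * φ + Λ * u - ε * (S₁ * u - Λ * φ)) +
      2 * l m * lam m * (1 + lam m ^ 2) := by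
    have e1 : ∑ k, l k * hk k ≤ ∑ k, l k * (C₀ * ((∑ j, o j * a k j - lam k ^ 2 * φ + lam k * u) -
        ε * (u - lam k * φ)) + lam m * (if k = m then 2 * (1 + lam m ^ 2) else 0)) :=
      Finset.sum_le_sum fun k _ => mul_le_mul_of_nonneg_left (by linarith [h2 k]) (hl k)
    refine e1.trans_eq ?_
    have e2 : ∑ k, l k * ∑ j, o j * a k j = P := by
      simp only [hP, h10, Finset.mul_sum]
      rw [Finset.sum_comm]
      exact Finset.sum_congr rfl fun j _ => Finset.sum_congr rfl fun k _ => by ring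
    have e3 : ∑ k, l k * (lam m * (if k = m then 2 * (1 + lam m ^ 2) else 0)) =
        2 * l m * lam m * (1 + lam m ^ 2) := by
      simp; ring
    obtain ⟨w, hw⟩ : ∃ w : Fin n → ℝ, ∀ k, ∑ j, o j * a k j = w k := ⟨_, fun _ => rfl⟩
    simp only [hw] at e2 ⊢
    rw [← e3, ← e2, h8, hS1, hS2]
    simp only [Finset.sum_mul, Finset.mul_sum, ← Finset.sum_add_distrib, ← Finset.sum_sub_distrib]
    refine Finset.sum_congr rfl fun k _ => ?_
    ring
  have i2 : ∑ k, l k * hm k = ∑ k, l k * hk k + (Λ + lam m * S₂ - lam m * S₁ - lam m ^ 2 * Λ) := by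
    rw [h8, hS1, hS2]
    simp only [Finset.mul_sum, ← Finset.sum_add_distrib, ← Finset.sum_sub_distrib]
    refine Finset.sum_congr rfl fun k _ => ?_
    linear_combination l k * h3 k
  have i3 : Λmm ≤ C₀ * (P - S₂ * φ + Λ * u - ε * (S₁ * u - Λ * φ)) +
      (Λ + lam m * S₂ - lam m * S₁ - lam m ^ 2 * Λ) := by
    rw [h6, i2]; linarith
  -- First derivatives of the speed.
  have hfd : ∀ k, fd k = c * (lam k * o k) + (F * u * Ld k + o k) * F := by
    intro k
    have := h5 k
    rw [h7] at this
    linear_combination (-F) * this + (c * (lam k * o k) - fd k) * h9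
  have i4 : ∑ k, o k * fd k = c * A + F ^ 2 * u * P + F * B := by
    rw [hA, hP, hB]
    simp only [Finset.mul_sum, ← Finset.sum_add_distrib]
    refine Finset.sum_congr rfl fun k _ => ?_
    rw [hfd k]; ring
  have i5 : C₀ * (-(u * f) + ε * φ * f + (c * A + F ^ 2 * u * P + F * B)) - f - lam m ^ 2 * f ≤
      fmm := by
    have e1 : ∑ k, a m k * (fd k / lam k) =
        C₀ * ∑ k, o k * fd k - C₀ * ε * ∑ k, o k * (fd k / lam k) := by
      simp only [Finset.mul_sum, ← Finset.sum_sub_distrib]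
      refine Finset.sum_congr rfl fun k _ => ?_
      rw [h1 k]
      have := (hlam k).ne'
      field_simp
    rw [e1, i4] at h4
    linarith
  have i6 : ∑ j, o j * a m j = C₀ * (A - ε * B) := by
    rw [hA, hB]
    simp only [Finset.mul_sum, ← Finset.sum_sub_distrib]
    refine Finset.sum_congr rfl fun k _ => ?_
    rw [h1 k]; ring
  rw [i6] at h5'
  -- Multiply by `F` to remove `Λ`.
  have i7 : 0 ≤ (c * (C₀ * (A - ε * B) - lam m ^ 2 * φ + lam m * u) - fmm) -
      2 * F ^ 2 * (F * u * Ld m + o m) * Ld m + F ^ 2 * u * Λmm + F * (u - lam m * φ) := by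
    have e1 := mul_nonneg hF.le h5'
    rw [hfd m, h7] at e1
    refine e1.trans_eq ?_
    linear_combination (c * (C₀ * (A - ε * B) - lam m ^ 2 * φ + lam m * u) - fmm) * h9
  -- Completing the square in the gradient of the curvature function.
  have i8 : -(2 * F ^ 2 * (F * u * Ld m + o m) * Ld m) ≤ F * o m ^ 2 / (2 * u) := by
    have : F * o m ^ 2 / (2 * u) + 2 * F ^ 2 * (F * u * Ld m + o m) * Ld m =
        F / (2 * u) * (o m + 2 * u * F * Ld m) ^ 2 := by
      field_simp
      ring
    have h0 : 0 ≤ F / (2 * u) * (o m + 2 * u * F * Ld m) ^ 2 := by positivity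
    linarith
  have i9 := mul_le_mul_of_nonneg_left i3 (show 0 ≤ F ^ 2 * u by positivity)
  have i10 : 0 ≤ (c * (C₀ * (A - ε * B) - lam m ^ 2 * φ + lam m * u) -
      (C₀ * (-(u * f) + ε * φ * f + (c * A + F ^ 2 * u * P + F * B)) - f - lam m ^ 2 * f)) +
      F * o m ^ 2 / (2 * u) + F ^ 2 * u * (C₀ * (P - S₂ * φ + Λ * u - ε * (S₁ * u - Λ * φ)) +
      (Λ + lam m * S₂ - lam m * S₁ - lam m ^ 2 * Λ)) + F * (u - lam m * φ) := by
    linarith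
  refine i10.trans_eq ?_
  rw [h7]
  linear_combination F * u * (C₀ * (u + ε * φ) + 1 - lam m ^ 2) * h9

/-- With `C₀` large the inequality of the maximum principle is violated. -/
lemma maximum_principle_contradiction {lam C₀ μ c φ u F F₀ u₀ om S₁ S₂ B : ℝ}
    (hμ : 0 < μ) (hc : 0 < c) (hF : 0 < F) (hF₀ : F ≤ F₀) (hu₀ : 0 < u₀)
    (hu : u₀ ≤ u) (hφ : μ ≤ φ) (hφ1 : φ ≤ 1) (hu1 : u ≤ 1) (hB : 0 ≤ B)
    (hom : om ^ 2 ≤ 1) (hS₁ : 0 ≤ S₁) (hS₂ : c ≤ F ^ 2 * S₂) (hlamF : c ≤ lam * F)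
    (hlam : lam = C₀ * (φ - μ / 2 + μ / 8 * u)) (hC₀ : 0 < C₀)
    (hC : c + F₀ + F₀ / (2 * u₀) < C₀ * (μ / 8) * (c * μ ^ 2))
    (hmain : 0 ≤ u * lam * (F ^ 2 * S₂ + c) + c * φ + u * F - F * lam * φ +
      F * om ^ 2 / (2 * u) - u * lam * (F ^ 2 * S₁) - 2 * u * lam ^ 2 * F +
      C₀ * (-(u * φ * (F ^ 2 * S₂ - c)) - F * B) +
      C₀ * (μ / 8) * (-(c * (φ ^ 2 + B)) + 2 * u * φ * F - u ^ 2 * (F ^ 2 * S₁))) : False := by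
  have hup : 0 < u := hu₀.trans_le hu
  have huμ : μ / 8 * u ≤ μ / 8 := mul_le_of_le_one_right (by positivity) hu1
  have huμ0 : 0 ≤ μ / 8 * u := by positivity
  have hlam0 : C₀ * (μ / 2) ≤ lam := by
    rw [hlam]
    exact mul_le_mul_of_nonneg_left (by linarith) hC₀.le
  have hlampos : 0 < lam := lt_of_lt_of_le (by positivity) hlam0
  have hlam1 : lam ≤ C₀ * φ := by
    rw [hlam]
    exact mul_le_mul_of_nonneg_left (by linarith) hC₀.le
  have hφ0 : 0 ≤ φ := hμ.le.trans hφ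
  have t1 : u * lam * (F ^ 2 * S₂ - c) ≤ C₀ * (u * φ * (F ^ 2 * S₂ - c)) := by
    have := mul_le_mul_of_nonneg_right (mul_le_mul_of_nonneg_left hlam1 hup.le)
      (sub_nonneg.2 hS₂)
    exact this.trans_eq (by ring)
  have t2 : 0 ≤ 2 * u * lam * (lam * F - c) :=
    mul_nonneg (by positivity) (sub_nonneg.2 hlamF)
  have t3 : C₀ * (μ / 8) * (2 * u * φ * F) ≤ F * lam * φ := by
    have e : C₀ * (μ / 8 * u) * 2 ≤ lam := by
      have e1 := mul_le_mul_of_nonneg_left huμ hC₀.le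
      have e2 : 0 ≤ C₀ * μ := by positivity
      linarith
    exact (by ring : _ = C₀ * (μ / 8 * u) * 2 * (φ * F)).trans_le
      ((mul_le_mul_of_nonneg_right e (mul_nonneg hφ0 hF.le)).trans_eq (by ring))
  have t4 : 0 ≤ C₀ * (F * B) := by positivity
  have t5 : 0 ≤ u * lam * (F ^ 2 * S₁) := by positivity
  have t6 : 0 ≤ C₀ * (μ / 8) * (u ^ 2 * (F ^ 2 * S₁)) := by positivity
  have t7 : c * φ ≤ c := mul_le_of_le_one_right hc.le hφ1
  have t8 : u * F ≤ F₀ := (mul_le_of_le_one_left hF.le hu1).trans hF₀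
  have t9 : F * om ^ 2 / (2 * u) ≤ F₀ / (2 * u₀) :=
    div_le_div₀ (hF.le.trans hF₀) ((mul_le_of_le_one_right hF.le hom).trans hF₀)
      (by positivity) (by linarith)
  have t10 : C₀ * (μ / 8) * (c * μ ^ 2) ≤ C₀ * (μ / 8) * (c * (φ ^ 2 + B)) := by
    have : μ ^ 2 ≤ φ ^ 2 + B := le_add_of_le_of_nonneg (pow_le_pow_left₀ hμ.le hφ 2) hB
    gcongr
  linarith

/-! ### The maximum principle in the coordinates given by the Gauss map -/

section Touching

variable {n : ℕ} {U : Set (SpaceTime n)} {t₀ : ℝ} {X N : SpaceTime n → Amb n} {e : Fin n → Amb n}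
  {lam : Fin n → ℝ} {p : SpaceTime n}

/-- The test function `C₀ (φ' - μ / 2 + (μ / 8) u)` to which the radii of curvature are compared,
with `φ' = ⟪o, X⟫` and `u = -⟪o, N⟫`. -/
def barrier (C₀ μ : ℝ) (o X N : Amb n) : ℝ := C₀ * (⟪o, X⟫ - μ / 2 - μ / 8 * ⟪o, N⟫)

lemma smooth_barrier {C₀ μ : ℝ} {o : Amb n} (hX : ContDiffOn ℝ ∞ X U) (hN : ContDiffOn ℝ ∞ N U) :
    ContDiffOn ℝ ∞ (fun p => barrier C₀ μ o (X p) (N p)) U :=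
  contDiffOn_const.mul (((contDiffOn_const.inner ℝ hX).sub contDiffOn_const).sub
    (contDiffOn_const.mul (contDiffOn_const.inner ℝ hN)))

lemma dirDeriv_barrier {C₀ μ : ℝ} {o : Amb n} (hU : IsOpen U) (hX : ContDiffOn ℝ ∞ X U)
    (hN : ContDiffOn ℝ ∞ N U) (v : SpaceTime n) (hp : p ∈ U) :
    dirDeriv v (fun p => barrier C₀ μ o (X p) (N p)) p =
      C₀ * (⟪o, dirDeriv v X p⟫ - μ / 8 * ⟪o, dirDeriv v N p⟫) := by
  have hx : ContDiffOn ℝ ∞ (fun p => ⟪o, X p⟫) U := contDiffOn_const.inner ℝ hX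
  have hy : ContDiffOn ℝ ∞ (fun p => ⟪o, N p⟫) U := contDiffOn_const.inner ℝ hN
  unfold barrier
  rw [dirDeriv_const_mul hU _ ((hx.sub contDiffOn_const).sub (contDiffOn_const.mul hy)) v hp,
    dirDeriv_sub hU (hx.sub contDiffOn_const) (contDiffOn_const.mul hy) v hp,
    dirDeriv_sub hU hx contDiffOn_const v hp, dirDeriv_const, dirDeriv_const_mul hU _ hy v hp,
    dirDeriv_const_inner hU _ hX v hp, dirDeriv_const_inner hU _ hN v hp, sub_zero]

lemma dirDeriv_dirDeriv_barrier {C₀ μ : ℝ} {o : Amb n} (hU : IsOpen U) (hX : ContDiffOn ℝ ∞ X U)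
    (hN : ContDiffOn ℝ ∞ N U) (v : SpaceTime n) (hp : p ∈ U) :
    dirDeriv v (dirDeriv v (fun p => barrier C₀ μ o (X p) (N p))) p =
      C₀ * (⟪o, dirDeriv v (dirDeriv v X) p⟫ - μ / 8 * ⟪o, dirDeriv v (dirDeriv v N) p⟫) := by
  rw [dirDeriv_congr hU (fun p hp => dirDeriv_barrier hU hX hN v hp) v hp]
  have hX' := smooth_dirDeriv hU hX v
  have hN' := smooth_dirDeriv hU hN v
  have hx : ContDiffOn ℝ ∞ (fun p => ⟪o, dirDeriv v X p⟫) U := contDiffOn_const.inner ℝ hX'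
  have hy : ContDiffOn ℝ ∞ (fun p => ⟪o, dirDeriv v N p⟫) U := contDiffOn_const.inner ℝ hN'
  rw [dirDeriv_const_mul hU _ (hx.sub (contDiffOn_const.mul hy)) v hp,
    dirDeriv_sub hU hx (contDiffOn_const.mul hy) v hp, dirDeriv_const_mul hU _ hy v hp,
    dirDeriv_const_inner hU _ hX' v hp, dirDeriv_const_inner hU _ hN' v hp]

/-- The conditions at a point where the largest radius of curvature `lam m` touches the barrier from
below for the first time. -/
lemma NormalForm.barrier_conditions (H : NormalForm U t₀ X N e lam) {f : SpaceTime n → ℝ}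
    (hf : ContDiffOn ℝ ∞ f U) (hflow : ∀ p ∈ U, dt X p = f p • N p) (hlam : ∀ i, 0 < lam i)
    {C₀ μ : ℝ} {o : Amb n} (m : Fin n)
    (hQ : lam m = barrier C₀ μ o (X (0, t₀)) (N (0, t₀)))
    (hZ : ∀ p ∈ U, p.2 ≤ t₀ → ⟪dx m X p, dx m N p⟫ ≤
      barrier C₀ μ o (X p) (N p) * ⟪dx m N p, dx m N p⟫) :
    (∀ k, ⟪dx m (dx m X) (0, t₀), e k⟫ = C₀ * (lam k * ⟪o, e k⟫ - μ / 8 * ⟪o, e k⟫)) ∧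
    (∀ k, 0 ≤ C₀ * (⟪o, dx k (dx k X) (0, t₀)⟫ - μ / 8 * ⟪o, dx k (dx k N) (0, t₀)⟫) +
      lam m * (if k = m then 2 * (1 + lam m ^ 2) else 0) -
        dx k (dx k (fun p => ⟪dx m X p, dx m N p⟫)) (0, t₀)) ∧
    C₀ * (⟪o, dt X (0, t₀)⟫ - μ / 8 * ⟪o, dt N (0, t₀)⟫) +
      (-dx m (dx m f) (0, t₀) + f (0, t₀) - lam m ^ 2 * f (0, t₀) +
        ∑ k, ⟪dx m (dx m X) (0, t₀), e k⟫ * (dx k f (0, t₀) / lam k)) - 2 * f (0, t₀) ≤ 0 := by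
  have hU := H.isOpen
  have mem := H.mem
  have hX := H.smooth
  have hN := H.smooth_normal
  set Q : SpaceTime n → ℝ := fun p => barrier C₀ μ o (X p) (N p) with hQdef
  set ν₂ : SpaceTime n → ℝ := fun p => ⟪dx m N p, dx m N p⟫ with hν₂
  set h : SpaceTime n → ℝ := fun p => ⟪dx m X p, dx m N p⟫ with hh
  have hQs : ContDiffOn ℝ ∞ Q U := smooth_barrier hX hN
  have hνs : ContDiffOn ℝ ∞ ν₂ U := (H.smooth_dx_normal m).inner ℝ (H.smooth_dx_normal m)
  have hhs : ContDiffOn ℝ ∞ h U := (H.smooth_dx_pos m).inner ℝ (H.smooth_dx_normal m)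
  have hQνs := hQs.mul hνs
  set Z : SpaceTime n → ℝ := fun p => Q p * ν₂ p - h p with hZdef
  have hZs : ContDiffOn ℝ ∞ Z U := hQνs.sub hhs
  have hν0 : ν₂ (0, t₀) = 1 := by
    simp only [hν₂, H.deriv_normal, H.frame.inner_frame]; simp
  have hh0 : h (0, t₀) = lam m := by
    simp only [hh, H.deriv_normal, H.deriv_pos, inner_smul_left, H.frame.inner_frame]; simp
  have hQ0 : Q (0, t₀) = lam m := hQ.symm
  have hZ0 : Z (0, t₀) = 0 := by simp only [hZdef, hν0, hh0, hQ0]; ring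
  have hslice : ∀ k, dx k Z (0, t₀) = 0 ∧ 0 ≤ dx k (dx k Z) (0, t₀) := fun k => by
    refine dirDeriv_of_line_min hU hZs _ mem hZ0 ?_
    filter_upwards [eventually_line_mem hU mem (EuclideanSpace.single k (1 : ℝ), (0 : ℝ))]
      with s hs
    exact sub_nonneg.2 (hZ _ hs (by simp))
  have htime : dt Z (0, t₀) ≤ 0 := by
    refine dirDeriv_nonpos_of_line hU hZs _ mem hZ0 ?_
    filter_upwards [eventually_line_mem hU mem ((0 : EuclideanSpace ℝ (Fin n)), (1 : ℝ))]
      with s hs hs0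
    exact sub_nonneg.2 (hZ _ hs (by simpa using hs0))
  have hdQ : ∀ k, dx k Q (0, t₀) = C₀ * (lam k * ⟪o, e k⟫ - μ / 8 * ⟪o, e k⟫) := fun k => by
    have := dirDeriv_barrier (C₀ := C₀) (μ := μ) (o := o) hU hX hN
      (EuclideanSpace.single k (1 : ℝ), (0 : ℝ)) mem
    refine this.trans ?_
    change C₀ * (⟪o, dx k X (0, t₀)⟫ - μ / 8 * ⟪o, dx k N (0, t₀)⟫) = _
    rw [H.deriv_pos, H.deriv_normal, inner_smul_right]
  refine ⟨fun k => ?_, fun k => ?_, ?_⟩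
  · have h1 := (hslice k).1
    rw [hZdef, dx_sub hU hQνs hhs k mem, dx_mul hU hQs hνs k mem, hν0, H.dx_inner_normal_zero,
      hh, H.dx_inner_zero, hdQ] at h1
    rw [H.codazzi, H.dx_dx_pos_comm]
    linarith
  · have h1 := (hslice k).2
    have e1 : dx k (dx k Z) (0, t₀) =
        dx k (dx k fun p => Q p * ν₂ p) (0, t₀) - dx k (dx k h) (0, t₀) := by
      rw [dx_congr hU (fun p hp => dx_sub hU hQνs hhs k hp) k mem,
        dx_sub hU (smooth_dx hU hQνs k) (smooth_dx hU hhs k) k mem]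
    rw [e1, dx_dx_mul hU hQs hνs k k mem, hν0, hQ0, H.dx_dx_inner_normal_zero,
      H.dx_inner_normal_zero] at h1
    have e2 : dx k (dx k Q) (0, t₀) =
        C₀ * (⟪o, dx k (dx k X) (0, t₀)⟫ - μ / 8 * ⟪o, dx k (dx k N) (0, t₀)⟫) :=
      dirDeriv_dirDeriv_barrier hU hX hN _ mem
    rw [e2] at h1
    linarith
  · have e1 : dt Z (0, t₀) = dt Q (0, t₀) * ν₂ (0, t₀) + Q (0, t₀) * dt ν₂ (0, t₀) -
        dt h (0, t₀) := by
      unfold dt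
      rw [hZdef, dirDeriv_sub hU hQνs hhs _ mem, dirDeriv_mul hU hQs hνs _ mem]
    have e2 : dt Q (0, t₀) = C₀ * (⟪o, dt X (0, t₀)⟫ - μ / 8 * ⟪o, dt N (0, t₀)⟫) :=
      dirDeriv_barrier hU hX hN _ mem
    have e3 := H.lam_mul_dt_inner_normal hf hflow m
    have e4 := H.dt_inner hf hflow hlam m
    rw [e1, hν0, hQ0, e3, e2, ← hh, e4] at htime
    linarith

/-- The conditions satisfied by the speed, since `1 / F` lies below its supporting function. -/
lemma NormalForm.speed_conditions (H : NormalForm U t₀ X N e lam) {f Λ : SpaceTime n → ℝ}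
    (hf : ContDiffOn ℝ ∞ f U) (hΛ : ContDiffOn ℝ ∞ Λ U) {o : Amb n} {c : ℝ}
    (hω0 : (c * ⟪o, X (0, t₀)⟫ - f (0, t₀)) * Λ (0, t₀) + ⟪o, N (0, t₀)⟫ = 0)
    (hω : ∀ p ∈ U, p.2 = t₀ → 0 ≤ (c * ⟪o, X p⟫ - f p) * Λ p + ⟪o, N p⟫) (m : Fin n) :
    (c * (lam m * ⟪o, e m⟫) - dx m f (0, t₀)) * Λ (0, t₀) +
      (c * ⟪o, X (0, t₀)⟫ - f (0, t₀)) * dx m Λ (0, t₀) + ⟪o, e m⟫ = 0 ∧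
    0 ≤ (c * ⟪o, dx m (dx m X) (0, t₀)⟫ - dx m (dx m f) (0, t₀)) * Λ (0, t₀) +
      2 * (c * (lam m * ⟪o, e m⟫) - dx m f (0, t₀)) * dx m Λ (0, t₀) +
      (c * ⟪o, X (0, t₀)⟫ - f (0, t₀)) * dx m (dx m Λ) (0, t₀) +
      ⟪o, dx m (dx m N) (0, t₀)⟫ := by
  have hU := H.isOpen
  have mem := H.mem
  have hX := H.smooth
  have hN := H.smooth_normal
  have hx : ContDiffOn ℝ ∞ (fun p => c * ⟪o, X p⟫) U :=
    contDiffOn_const.mul (contDiffOn_const.inner ℝ hX)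
  have hy : ContDiffOn ℝ ∞ (fun p => ⟪o, N p⟫) U := contDiffOn_const.inner ℝ hN
  set g : SpaceTime n → ℝ := fun p => c * ⟪o, X p⟫ - f p with hg
  have hgs : ContDiffOn ℝ ∞ g U := hx.sub hf
  have hgΛ := hgs.mul hΛ
  have hmin := dirDeriv_of_line_min hU (hgΛ.add hy)
    (EuclideanSpace.single m (1 : ℝ), (0 : ℝ)) mem hω0 (by
      filter_upwards [eventually_line_mem hU mem (EuclideanSpace.single m (1 : ℝ), (0 : ℝ))]
        with s hs
      exact hω _ hs (by simp))
  have hxd : ∀ p ∈ U, dx m g p = c * ⟪o, dx m X p⟫ - dx m f p := fun p hp => by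
    rw [hg, dx_sub hU hx hf m hp, dx_const_mul hU _ (contDiffOn_const.inner ℝ hX) m hp,
      dx_const_inner hU _ hX m hp]
  have hxd0 : dx m g (0, t₀) = c * (lam m * ⟪o, e m⟫) - dx m f (0, t₀) := by
    rw [hxd _ mem, H.deriv_pos, inner_smul_right]
  have hxdd : dx m (dx m g) (0, t₀) =
      c * ⟪o, dx m (dx m X) (0, t₀)⟫ - dx m (dx m f) (0, t₀) := by
    have hX' := smooth_dx hU hX m
    rw [dx_congr hU hxd m mem, dx_sub hU (contDiffOn_const.mul (contDiffOn_const.inner ℝ hX'))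
      (smooth_dx hU hf m) m mem, dx_const_mul hU _ (contDiffOn_const.inner ℝ hX') m mem,
      dx_const_inner hU _ hX' m mem]
  have hyd : ∀ p ∈ U, dx m (fun p => ⟪o, N p⟫) p = ⟪o, dx m N p⟫ := fun p hp =>
    dx_const_inner hU _ hN m hp
  constructor
  · have h1 : dx m (fun p => g p * Λ p + ⟪o, N p⟫) (0, t₀) = 0 := hmin.1
    rwa [dx_add hU hgΛ hy m mem, dx_mul hU hgs hΛ m mem, hxd0, hyd _ mem, H.deriv_normal] at h1
  · have h1 : 0 ≤ dx m (dx m (fun p => g p * Λ p + ⟪o, N p⟫)) (0, t₀) := hmin.2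
    rw [dx_congr hU (fun p hp => dx_add hU hgΛ hy m hp) m mem,
      dx_add hU (smooth_dx hU hgΛ m) (smooth_dx hU hy m) m mem, dx_dx_mul hU hgs hΛ m m mem,
      dx_congr hU hyd m mem, dx_const_inner hU _ (smooth_dx hU hN m) m mem, hxd0, hxdd] at h1
    linarith

/-- The largest radius of curvature cannot touch the barrier from below for the first time, if the
constant `C₀` of the barrier is large. -/
lemma NormalForm.not_touching (H : NormalForm U t₀ X N e lam) {k : ℕ} (hk : k < n)
    {f : SpaceTime n → ℝ} (hf : ContDiffOn ℝ ∞ f U) (hflow : ∀ p ∈ U, dt X p = f p • N p)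
    (hlam : ∀ i, 0 < lam i) {C₀ μ F₀ u₀ : ℝ} {o : Amb n} (ho : ⟪o, o⟫ = 1) (m : Fin n)
    (hm : ∀ i, lam i ≤ lam m) (hu : ∀ p ∈ U, ⟪o, N p⟫ < 0)
    (hspeed : ∀ p ∈ U, p.2 = t₀ → ∃ (q : Fin n → EuclideanSpace ℝ (Fin n)) (κ : Fin n → ℝ),
      IsTangentFrame (fun a => spaceDeriv X p (q a)) (X p) (N p) ∧
      (∀ a, spaceDeriv N p (q a) = κ a • spaceDeriv X p (q a)) ∧ (∀ a, 0 < κ a) ∧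
      f p = ((n : ℝ) - k) / (k + 1) * ⟪o, X p⟫ + symmQuot Finset.univ k κ * ⟪o, N p⟫)
    (hspeed0 : f (0, t₀) = ((n : ℝ) - k) / (k + 1) * ⟪o, X (0, t₀)⟫ +
      symmQuot Finset.univ k (fun i => (lam i)⁻¹) * ⟪o, N (0, t₀)⟫)
    (hF₀ : symmQuot Finset.univ k (fun i => (lam i)⁻¹) ≤ F₀)
    (hμ : 0 < μ) (hμX : μ ≤ ⟪o, X (0, t₀)⟫) (hu₀ : 0 < u₀) (huN : u₀ ≤ -⟪o, N (0, t₀)⟫)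
    (hC₀ : 0 < C₀) (hC : ((n : ℝ) - k) / (k + 1) + F₀ + F₀ / (2 * u₀) <
      C₀ * (μ / 8) * (((n : ℝ) - k) / (k + 1) * μ ^ 2))
    (hQ : lam m = barrier C₀ μ o (X (0, t₀)) (N (0, t₀)))
    (hZ : ∀ p ∈ U, p.2 ≤ t₀ → ⟪dx m X p, dx m N p⟫ ≤
      barrier C₀ μ o (X p) (N p) * ⟪dx m N p, dx m N p⟫) : False := by
  have mem := H.mem
  have hκ : ∀ i, 0 < (lam i)⁻¹ := fun i => inv_pos.2 (hlam i)
  set c : ℝ := ((n : ℝ) - k) / (k + 1) with hc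
  have hcpos : 0 < c := by
    have : (k : ℝ) < n := by exact_mod_cast hk
    exact div_pos (by linarith) (by positivity)
  set F := symmQuot Finset.univ k (fun i => (lam i)⁻¹) with hF
  have hFpos : 0 < F := symmQuot_pos (S := (Finset.univ : Finset (Fin n))) (by simpa using hk) hκ
  obtain ⟨l, hl0, hl1, hl2⟩ := exists_supergradient_inv_symmQuot k (Finset.univ : Finset (Fin n))
    (by simpa using hk) _ hκ
  obtain ⟨hΛs, hΛ0, hΛ1, hΛ2⟩ := supportFun_spec H l
  set Λ := supportFun t₀ X N e l with hΛdef
  set φ : ℝ := ⟪o, X (0, t₀)⟫ with hφ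
  set u : ℝ := -⟪o, N (0, t₀)⟫ with hudef
  have hupos : 0 < u := hu₀.trans_le huN
  have hFΛ : F * Λ (0, t₀) = 1 := by
    rw [hΛ0]
    have : F⁻¹ = ∑ i, l i * lam i := by simpa using hl2
    rw [← this, mul_inv_cancel₀ hFpos.ne']
  have hinner : ∀ w : Amb n, ⟪o, w⟫ = ∑ i, ⟪o, e i⟫ * ⟪w, e i⟫ + φ * ⟪w, X (0, t₀)⟫ -
      u * ⟪w, N (0, t₀)⟫ := fun w => by
    rw [H.frame.inner_eq o w, hudef, hφ]; ring
  have hsum : ∑ i, ⟪o, e i⟫ ^ 2 + φ ^ 2 + u ^ 2 = 1 := by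
    rw [← ho, H.frame.inner_eq o o, hudef, hφ]
    simp only [pow_two]
    ring
  have hB0 : 0 ≤ ∑ i, ⟪o, e i⟫ ^ 2 := Finset.sum_nonneg fun i _ => sq_nonneg _
  have hom : ⟪o, e m⟫ ^ 2 ≤ ∑ i, ⟪o, e i⟫ ^ 2 :=
    Finset.single_le_sum (f := fun i => ⟪o, e i⟫ ^ 2) (fun i _ => sq_nonneg _) (Finset.mem_univ m)
  have hφsq : φ ^ 2 ≤ 1 := by nlinarith [sq_nonneg u]
  have husq : u ^ 2 ≤ 1 := by nlinarith [sq_nonneg φ]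
  have hXX : ∀ k, ⟪o, dx k (dx k X) (0, t₀)⟫ =
      ∑ j, ⟪o, e j⟫ * ⟪dx k (dx k X) (0, t₀), e j⟫ - lam k ^ 2 * φ + lam k * u := fun k => by
    rw [hinner, H.inner_dx_dx_pos_pos_zero, H.inner_dx_dx_pos_normal_zero]
    simp only [if_true]
    ring
  have hNN : ∀ k, ⟪o, dx k (dx k N) (0, t₀)⟫ = u - lam k * φ := fun k => by
    rw [hinner, H.inner_dx_dx_normal_pos_zero, H.inner_dx_dx_normal_normal_zero]
    simp only [if_true, H.inner_dx_dx_normal_frame k k _ mem rfl, mul_zero, Finset.sum_const_zero]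
    ring
  obtain ⟨b1, b2, b3⟩ := H.barrier_conditions hf hflow hlam m hQ hZ
  have hω0 : (c * φ - f (0, t₀)) * Λ (0, t₀) + ⟪o, N (0, t₀)⟫ = 0 := by
    rw [hspeed0]
    linear_combination -⟪o, N (0, t₀)⟫ * hFΛ
  have hω : ∀ p ∈ U, p.2 = t₀ → 0 ≤ (c * ⟪o, X p⟫ - f p) * Λ p + ⟪o, N p⟫ := by
    intro p hp hpt
    obtain ⟨q, κ, hq1, hq2, hq3, hq4⟩ := hspeed p hp hpt
    have h1 := inv_symmQuot_le_supportFun H hp hpt hq1 hq2 hq3 hl1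
    have h2 : 0 < symmQuot Finset.univ k κ :=
      symmQuot_pos (S := (Finset.univ : Finset (Fin n))) (by simpa using hk) hq3
    rw [inv_le_iff_one_le_mul₀ h2, ← hΛdef] at h1
    rw [hq4]
    have h3 := mul_nonneg (neg_nonneg.2 (hu p hp).le) (sub_nonneg.2 h1)
    linarith
  have hs := fun m => H.speed_conditions hf hΛs hω0 hω m
  have hdtN : ⟪o, dt N (0, t₀)⟫ = -∑ k, ⟪o, e k⟫ * (dx k f (0, t₀) / lam k) - φ * f (0, t₀) := by
    rw [hinner, H.inner_dt_normal_pos hflow]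
    have h1 : ⟪dt N (0, t₀), N (0, t₀)⟫ = 0 := H.inner_dirDeriv_normal_normal _ mem
    rw [h1]
    simp only [H.inner_dt_normal_frame hf hflow hlam, mul_neg, Finset.sum_neg_distrib]
    ring
  have hdtX : ⟪o, dt X (0, t₀)⟫ = -(u * f (0, t₀)) := by
    rw [hflow _ mem, inner_smul_right, hudef]; ring
  have hmain := maximum_principle_algebra m (lam := lam) (l := l) (o := fun k => ⟪o, e k⟫)
    (fd := fun k => dx k f (0, t₀)) (Ld := fun k => dx k Λ (0, t₀))
    (hm := fun k => dx m (dx m (fun p => ⟪dx k X p, dx k N p⟫)) (0, t₀))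
    (hk := fun k => dx k (dx k (fun p => ⟪dx m X p, dx m N p⟫)) (0, t₀))
    (a := fun k j => ⟪dx k (dx k X) (0, t₀), e j⟫) (C₀ := C₀) (ε := μ / 8) (c := c) (φ := φ)
    (u := u) (f := f (0, t₀)) (fmm := dx m (dx m f) (0, t₀)) (F := F) (Λ := Λ (0, t₀))
    (Λmm := dx m (dx m Λ) (0, t₀)) hl0 hlam hupos hFpos b1
    (fun k => by
      have := b2 k
      rwa [hXX, hNN] at this)
    (fun k => H.simons k m)
    (by
      have := b3
      rwa [hdtX, hdtN] at this)
    (fun k => (hs k).1)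
    (by
      have := (hs m).2
      rwa [hXX, hNN] at this)
    (hΛ2 m) (by rw [hspeed0, hudef]; ring) hΛ0 hFΛ
    (fun j => by
      rw [hΛ1]
      refine Finset.sum_congr rfl fun i _ => ?_
      rw [H.codazzi i i j, H.dx_dx_pos_comm])
  have hS₂ := le_sq_mul_sum_supergradient hk hκ hl1 hl2
  simp only [inv_inv] at hS₂
  have hlamF : c ≤ lam m * F := by
    have h1 := mul_le_symmQuot hk hκ (a := (lam m)⁻¹) (fun i => inv_anti₀ (hlam i) (hm i))
    have h2 := mul_le_mul_of_nonneg_left h1 (hlam m).le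
    refine le_trans (le_of_eq ?_) h2
    rw [mul_left_comm, mul_inv_cancel₀ (hlam m).ne', mul_one]
  refine maximum_principle_contradiction hμ hcpos hFpos hF₀ hu₀ huN hμX ?_ ?_ hB0 ?_
    (Finset.sum_nonneg fun i _ => hl0 i) hS₂ hlamF ?_ hC₀ hC hmain
  · exact (sq_le_one_iff_abs_le_one _).1 hφsq |> fun h => (abs_le.1 h).2
  · exact (sq_le_one_iff_abs_le_one _).1 husq |> fun h => (abs_le.1 h).2
  · nlinarith [sq_nonneg u, sq_nonneg φ]
  · rw [hQ, barrier, hudef, hφ]; ring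

end Touching

/-! ### Passing to the coordinates given by the Gauss map -/

/-- The inverse function theorem, with a smooth inverse on an open set. -/
lemma exists_smooth_local_inverse {E : Type*} [NormedAddCommGroup E] [NormedSpace ℝ E]
    [CompleteSpace E] {Y : E → E} {V : Set E} {z₀ : E} (hV : IsOpen V) (hY : ContDiffOn ℝ ∞ Y V)
    (hz₀ : z₀ ∈ V) {D : E ≃L[ℝ] E} (hD : (D : E →L[ℝ] E) = fderiv ℝ Y z₀) :
    ∃ (θ : E → E) (V' : Set E), IsOpen V' ∧ Y z₀ ∈ V' ∧ ContDiffOn ℝ ∞ θ V' ∧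
      (∀ y ∈ V', θ y ∈ V) ∧ (∀ y ∈ V', Y (θ y) = y) ∧ θ (Y z₀) = z₀ := by
  have hYat : ContDiffAt ℝ ∞ Y z₀ := hY.contDiffAt (hV.mem_nhds hz₀)
  have hder : HasFDerivAt Y (D : E →L[ℝ] E) z₀ := by
    rw [hD]; exact (hYat.differentiableAt (by simp)).hasFDerivAt
  set Φ := hYat.toOpenPartialHomeomorph Y hder (by simp) with hΦ
  have hcoe : (Φ : E → E) = Y := hYat.toOpenPartialHomeomorph_coe hder (by simp)
  have hsrc : z₀ ∈ Φ.source := hYat.mem_toOpenPartialHomeomorph_source hder (by simp)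
  have hcont : ContinuousAt (fderiv ℝ Y) z₀ :=
    ((hY.fderiv_of_isOpen (m := ∞) hV (by simp)).continuousOn).continuousAt (hV.mem_nhds hz₀)
  have hinv : ∀ᶠ z in 𝓝 z₀, fderiv ℝ Y z ∈
      Set.range (ContinuousLinearEquiv.toContinuousLinearMap : (E ≃L[ℝ] E) → E →L[ℝ] E) :=
    hcont.eventually_mem (by rw [← hD]; exact D.nhds)
  obtain ⟨S, hS, hSo, hSz⟩ := mem_nhds_iff.1 (hinv.and (hV.mem_nhds hz₀))
  refine ⟨Φ.symm, Φ.target ∩ Φ.symm ⁻¹' S, Φ.isOpen_inter_preimage_symm hSo, ?_, ?_, ?_, ?_, ?_⟩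
  · rw [← hcoe]
    exact ⟨Φ.map_source hsrc, by simpa [Φ.left_inv hsrc] using hSz⟩
  · rintro y ⟨hy1, hy2⟩
    obtain ⟨⟨D', hD'⟩, hyV⟩ := hS hy2
    have hYy : ContDiffAt ℝ ∞ Y (Φ.symm y) := hY.contDiffAt (hV.mem_nhds hyV)
    have hd : HasFDerivAt Y (D' : E →L[ℝ] E) (Φ.symm y) := by
      rw [hD']; exact (hYy.differentiableAt (by simp)).hasFDerivAt
    exact (Φ.contDiffAt_symm hy1 (by rwa [hcoe]) (by rwa [hcoe])).contDiffWithinAt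
  · rintro y ⟨-, hy2⟩
    exact (hS hy2).2
  · rintro y ⟨hy1, -⟩
    have := Φ.right_inv hy1
    rwa [hcoe] at this
  · have := Φ.left_inv hsrc
    rwa [hcoe] at this

section LocalFlow

variable {n : ℕ} {W : Set (SpaceTime n)} {X N : SpaceTime n → Amb n} {k : ℕ} {o : Amb n}
  {F₀ μ u₀ : ℝ} {p : SpaceTime n}

/-- A solution of the flow in local coordinates, for times in an open interval, with the a priori
bounds `σ_{k+1} / σ_k ≤ F₀`, `μ ≤ φ'` and `u₀ ≤ u`. The principal curvatures enter through an
orthonormal basis `q` of principal directions. -/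
structure LocalFlow (W : Set (SpaceTime n)) (k : ℕ) (o : Amb n) (F₀ μ u₀ : ℝ)
    (X N : SpaceTime n → Amb n) : Prop where
  isOpen : IsOpen W
  smooth : ContDiffOn ℝ ∞ X W
  smooth_normal : ContDiffOn ℝ ∞ N W
  normal : ∀ p ∈ W, ∀ v, ⟪spaceDeriv X p v, N p⟫ = 0
  injective : ∀ p ∈ W, Function.Injective (spaceDeriv X p)
  flow : ∀ p ∈ W, ∃ (q : Fin n → EuclideanSpace ℝ (Fin n)) (κ : Fin n → ℝ),
      IsTangentFrame (fun a => spaceDeriv X p (q a)) (X p) (N p) ∧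
      (∀ a, spaceDeriv N p (q a) = κ a • spaceDeriv X p (q a)) ∧ (∀ a, 0 < κ a) ∧
      symmQuot Finset.univ k κ ≤ F₀ ∧
      dt X p = (((n : ℝ) - k) / (k + 1) * ⟪o, X p⟫ +
        symmQuot Finset.univ k κ * ⟪o, N p⟫) • N p
  le_inner_pos : ∀ p ∈ W, μ ≤ ⟪o, X p⟫
  le_inner_normal : ∀ p ∈ W, u₀ ≤ -⟪o, N p⟫

lemma dirDeriv_comp_prodMap {F : Type*} [NormedAddCommGroup F] [NormedSpace ℝ F]
    {f : SpaceTime n → F} {θ : EuclideanSpace ℝ (Fin n) → EuclideanSpace ℝ (Fin n)}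
    (hθ : DifferentiableAt ℝ θ p.1) (hf : DifferentiableAt ℝ f (θ p.1, p.2)) (v : SpaceTime n) :
    dirDeriv v (fun p : SpaceTime n => f (θ p.1, p.2)) p =
      dirDeriv (fderiv ℝ θ p.1 v.1, v.2) f (θ p.1, p.2) := by
  unfold dirDeriv
  have h1 : HasFDerivAt (fun p : SpaceTime n => (θ p.1, p.2))
      (((fderiv ℝ θ p.1).comp (ContinuousLinearMap.fst ℝ _ _)).prod
        (ContinuousLinearMap.snd ℝ _ _)) p :=
    (hθ.hasFDerivAt.comp p hasFDerivAt_fst).prodMk hasFDerivAt_snd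
  have h2 := hf.hasFDerivAt.comp p h1
  rw [show (fun p : SpaceTime n => f (θ p.1, p.2)) = f ∘ fun p : SpaceTime n => (θ p.1, p.2)
    from rfl, h2.fderiv]
  rfl

/-- The second and third fundamental forms in an orthonormal basis of principal directions. -/
lemma frame_expansion {q : Fin n → EuclideanSpace ℝ (Fin n)} {κ : Fin n → ℝ}
    {A B : EuclideanSpace ℝ (Fin n) →L[ℝ] Amb n} {x ν : Amb n} (hA : Function.Injective A)
    (hAX : ∀ v, ⟪A v, x⟫ = 0) (hAN : ∀ v, ⟪A v, ν⟫ = 0)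
    (hq : IsTangentFrame (fun a => A (q a)) x ν) (hBq : ∀ a, B (q a) = κ a • A (q a))
    (v : EuclideanSpace ℝ (Fin n)) :
    ∃ a : Fin n → ℝ, v = ∑ i, a i • q i ∧ ⟪A v, B v⟫ = ∑ i, a i ^ 2 * κ i ∧
      ⟪B v, B v⟫ = ∑ i, a i ^ 2 * κ i ^ 2 := by
  set a : Fin n → ℝ := fun i => ⟪A v, A (q i)⟫ with ha
  have hAv : A v = ∑ i, a i • A (q i) := by
    refine hq.ext (fun j => ?_) ?_ ?_
    · simp [sum_inner, inner_smul_left, hq.inner_frame, ha]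
    · simp [sum_inner, inner_smul_left, hAX]
    · simp [sum_inner, inner_smul_left, hAN]
  have hvq : v = ∑ i, a i • q i := hA (by rw [hAv]; simp)
  have hBv : B v = ∑ i, (a i * κ i) • A (q i) := by
    conv_lhs => rw [hvq]
    simp [hBq, smul_smul]
  refine ⟨a, hvq, ?_, ?_⟩
  · rw [hBv, inner_sum]
    refine Finset.sum_congr rfl fun i _ => ?_
    rw [inner_smul_right]
    simp only [ha]; ring
  · conv_lhs => rw [hBv]
    simp only [sum_inner, inner_sum, inner_smul_left, inner_smul_right, hq.inner_frame]
    simp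
    exact Finset.sum_congr rfl fun i _ => by ring

/-- A number larger than all radii of curvature `1 / κ i` bounds them in the sense of quadratic
forms. -/
lemma inner_lt_of_inv_lt {q : Fin n → EuclideanSpace ℝ (Fin n)} {κ : Fin n → ℝ}
    {A B : EuclideanSpace ℝ (Fin n) →L[ℝ] Amb n} {x ν : Amb n} (hA : Function.Injective A)
    (hAX : ∀ v, ⟪A v, x⟫ = 0) (hAN : ∀ v, ⟪A v, ν⟫ = 0)
    (hq : IsTangentFrame (fun a => A (q a)) x ν) (hBq : ∀ a, B (q a) = κ a • A (q a))
    (hκ : ∀ a, 0 < κ a) {Q : ℝ} (h : ∀ i, (κ i)⁻¹ < Q) {v : EuclideanSpace ℝ (Fin n)}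
    (hv : v ≠ 0) : ⟪A v, B v⟫ < Q * ⟪B v, B v⟫ := by
  obtain ⟨a, ha, e1, e2⟩ := frame_expansion hA hAX hAN hq hBq v
  have h1 : ∀ i, 0 < κ i * Q - 1 := fun i => by
    have := (inv_lt_iff_one_lt_mul₀ (hκ i)).1 (h i)
    linarith
  have hterm : ∀ i, Q * (a i ^ 2 * κ i ^ 2) = a i ^ 2 * κ i + a i ^ 2 * κ i * (κ i * Q - 1) :=
    fun i => by ring
  obtain ⟨i, hi⟩ : ∃ i, a i ≠ 0 := by
    by_contra hne
    push Not at hne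
    exact hv (by rw [ha]; simp [hne])
  rw [e1, e2, Finset.mul_sum]
  refine Finset.sum_lt_sum (fun i _ => ?_) ⟨i, Finset.mem_univ _, ?_⟩
  · rw [hterm]
    have := mul_nonneg (mul_nonneg (sq_nonneg (a i)) (hκ i).le) (h1 i).le
    linarith
  · rw [hterm]
    have := mul_pos (mul_pos (pow_pos (abs_pos.2 hi) 2) (hκ i)) (h1 i)
    rw [sq_abs] at this
    linarith

/-- If `1 / κ i` is bounded by `Q` in the sense of quadratic forms, and the bound is attained, then
`Q` is the largest radius of curvature. -/
lemma exists_max_radius {q : Fin n → EuclideanSpace ℝ (Fin n)} {κ : Fin n → ℝ}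
    {A B : EuclideanSpace ℝ (Fin n) →L[ℝ] Amb n} {x ν : Amb n} (hA : Function.Injective A)
    (hAX : ∀ v, ⟪A v, x⟫ = 0) (hAN : ∀ v, ⟪A v, ν⟫ = 0)
    (hq : IsTangentFrame (fun a => A (q a)) x ν) (hBq : ∀ a, B (q a) = κ a • A (q a))
    (hκ : ∀ a, 0 < κ a) {Q : ℝ} (h : ∀ v, ⟪A v, B v⟫ ≤ Q * ⟪B v, B v⟫)
    (hv : ∃ v, v ≠ 0 ∧ Q * ⟪B v, B v⟫ ≤ ⟪A v, B v⟫) :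
    ∃ m, (κ m)⁻¹ = Q ∧ ∀ i, (κ i)⁻¹ ≤ (κ m)⁻¹ := by
  obtain ⟨v, hv0, hv⟩ := hv
  have hle : ∀ i, (κ i)⁻¹ ≤ Q := fun i => by
    have h1 := h (q i)
    have h2 := hq.inner_frame i i
    simp only [if_true] at h2
    rw [hBq, inner_smul_right, inner_smul_left, inner_smul_right, h2] at h1
    simp only [conj_trivial, mul_one] at h1
    rw [inv_le_iff_one_le_mul₀ (hκ i)]
    have h3 : 0 < κ i := hκ i
    by_contra hcon
    push Not at hcon
    nlinarith [mul_pos h3 (sub_pos.2 hcon)]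
  by_contra hcon
  push Not at hcon
  refine absurd hv (not_le.2 (inner_lt_of_inv_lt hA hAX hAN hq hBq hκ (fun i => ?_) hv0))
  refine lt_of_le_of_ne (hle i) fun heq => ?_
  obtain ⟨j, hj⟩ := hcon i heq
  exact absurd (hle j) (by rw [← heq]; exact not_le.2 hj)

/-- The radii of curvature of a solution cannot touch the barrier from below for the first time: the
statement `NormalForm.not_touching`, freed from the choice of coordinates. -/
lemma LocalFlow.not_touching (H : LocalFlow W k o F₀ μ u₀ X N) (hk : k < n) {C₀ t₀ : ℝ}
    {z₀ : EuclideanSpace ℝ (Fin n)} (ho : ⟪o, o⟫ = 1) (hμ : 0 < μ) (hu₀ : 0 < u₀) (hC₀ : 0 < C₀)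
    (hC : ((n : ℝ) - k) / (k + 1) + F₀ + F₀ / (2 * u₀) <
      C₀ * (μ / 8) * (((n : ℝ) - k) / (k + 1) * μ ^ 2)) (hp₀ : (z₀, t₀) ∈ W)
    (hZ : ∀ p ∈ W, p.2 ≤ t₀ → ∀ v, ⟪spaceDeriv X p v, spaceDeriv N p v⟫ ≤
      barrier C₀ μ o (X p) (N p) * ⟪spaceDeriv N p v, spaceDeriv N p v⟫)
    (hv : ∃ v, v ≠ 0 ∧ barrier C₀ μ o (X (z₀, t₀)) (N (z₀, t₀)) *
      ⟪spaceDeriv N (z₀, t₀) v, spaceDeriv N (z₀, t₀) v⟫ ≤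
        ⟪spaceDeriv X (z₀, t₀) v, spaceDeriv N (z₀, t₀) v⟫) : False := by
  obtain ⟨q, κ, hq, hBq, hκ, hκF, hfl⟩ := H.flow _ hp₀
  have hXXall : ∀ p ∈ W, ⟪X p, X p⟫ = 1 ∧ ⟪N p, N p⟫ = 1 ∧ ⟪X p, N p⟫ = 0 := fun p hp => by
    obtain ⟨_, _, h, -⟩ := H.flow p hp
    exact ⟨h.inner_pos, h.inner_normal, h.inner_pos_normal⟩
  have hXpos : ∀ v, ⟪spaceDeriv X (z₀, t₀) v, X (z₀, t₀)⟫ = 0 := fun v => by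
    have h := dirDeriv_congr H.isOpen (g := fun _ => (1 : ℝ)) (fun p hp => (hXXall p hp).1)
      (v, (0 : ℝ)) hp₀
    rw [dirDeriv_const, dirDeriv_inner H.isOpen H.smooth H.smooth _ hp₀,
      real_inner_comm (dirDeriv _ X _)] at h
    rw [spaceDeriv_apply]
    linarith
  obtain ⟨m, hmQ, hmax⟩ := exists_max_radius (H.injective _ hp₀) hXpos (H.normal _ hp₀) hq hBq hκ
    (hZ _ hp₀ le_rfl) hv
  set e : Fin n → Amb n := fun a => spaceDeriv X (z₀, t₀) (q a) with he
  -- The new coordinates of a point are the components of its normal in the frame `e`.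
  set Wt : Set (EuclideanSpace ℝ (Fin n)) := {z | (z, t₀) ∈ W} with hWt
  have hWto : IsOpen Wt := H.isOpen.preimage (by fun_prop : Continuous fun z => (z, t₀))
  set Y : EuclideanSpace ℝ (Fin n) → EuclideanSpace ℝ (Fin n) :=
    fun z => WithLp.toLp 2 fun i => ⟪N (z, t₀), e i⟫ with hY
  have hNt : ContDiffOn ℝ ∞ (fun z => N (z, t₀)) Wt :=
    H.smooth_normal.comp (by fun_prop : ContDiff ℝ ∞ fun z => (z, t₀)).contDiffOn fun z hz => hz
  have hYs : ContDiffOn ℝ ∞ Y Wt := by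
    rw [contDiffOn_piLp]
    exact fun i => hNt.inner ℝ contDiffOn_const
  have hNder : ∀ z ∈ Wt, HasFDerivAt (fun z => N (z, t₀)) (spaceDeriv N (z, t₀)) z := fun z hz =>
    (differentiableAt_of_smooth H.isOpen H.smooth_normal hz).hasFDerivAt.comp z
      ((hasFDerivAt_id z).prodMk (hasFDerivAt_const t₀ z))
  have hYder : ∀ z ∈ Wt, ∀ v i, fderiv ℝ Y z v i = ⟪spaceDeriv N (z, t₀) v, e i⟫ := by
    intro z hz v i
    have h1 := (differentiableAt_of_smooth hWto hYs hz).hasFDerivAt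
    have h2 : HasFDerivAt (fun z => ⟪N (z, t₀), e i⟫)
        ((EuclideanSpace.proj i : EuclideanSpace ℝ (Fin n) →L[ℝ] ℝ).comp (fderiv ℝ Y z)) z :=
      (EuclideanSpace.proj i : EuclideanSpace ℝ (Fin n) →L[ℝ] ℝ).hasFDerivAt.comp z h1
    have h3 := (hNder z hz).inner ℝ (hasFDerivAt_const (e i) z)
    have h4 := congrArg (fun L : EuclideanSpace ℝ (Fin n) →L[ℝ] ℝ => L v) (h2.unique h3)
    simpa [fderivInnerCLM_apply] using h4
  have hY0 : Y z₀ = 0 := by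
    ext i
    have := hq.inner_frame_normal i
    rw [real_inner_comm] at this
    simpa [hY, he] using this
  -- The derivative of the coordinates at `z₀` maps `κ⁻¹ • q` to the standard basis.
  have hDq : ∀ i, fderiv ℝ Y z₀ ((κ i)⁻¹ • q i) = EuclideanSpace.single i 1 := fun i => by
    ext j
    rw [hYder z₀ hp₀, map_smul, hBq, smul_smul, inv_mul_cancel₀ (hκ i).ne', one_smul,
      hq.inner_frame]
    simp [eq_comm]
  have hsurj : Function.Surjective (fderiv ℝ Y z₀) := fun w => by
    refine ⟨∑ i, w i • (κ i)⁻¹ • q i, ?_⟩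
    rw [map_sum]
    simp only [map_smul (fderiv ℝ Y z₀) (w _), hDq]
    ext j
    simp [Pi.single_apply]
  have hinj : Function.Injective (fderiv ℝ Y z₀) :=
    (LinearMap.injective_iff_surjective (f := (fderiv ℝ Y z₀).toLinearMap)).2 hsurj
  set D : EuclideanSpace ℝ (Fin n) ≃L[ℝ] EuclideanSpace ℝ (Fin n) :=
    ContinuousLinearEquiv.ofBijective (fderiv ℝ Y z₀) (LinearMap.ker_eq_bot.2 hinj)
      (LinearMap.range_eq_top.2 hsurj) with hD
  obtain ⟨θ, V', hV'o, hV'0, hθs, hθW, hθY, hθ0⟩ :=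
    exists_smooth_local_inverse hWto hYs hp₀ (D := D) (by ext; rfl)
  rw [hY0] at hV'0 hθ0
  have hθd : ∀ y ∈ V', DifferentiableAt ℝ θ y := fun y hy => differentiableAt_of_smooth hV'o hθs hy
  have hYθ : ∀ y ∈ V', ∀ v, fderiv ℝ Y (θ y) (fderiv ℝ θ y v) = v := fun y hy v => by
    have h1 := (differentiableAt_of_smooth hWto hYs (hθW y hy)).hasFDerivAt.comp y
      (hθd y hy).hasFDerivAt
    have h2 : HasFDerivAt (Y ∘ θ) (ContinuousLinearMap.id ℝ _) y :=
      (hasFDerivAt_id y).congr_of_eventuallyEq (by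
        filter_upwards [hV'o.mem_nhds hy] with y' hy' using hθY y' hy')
    exact congrArg (fun L : EuclideanSpace ℝ (Fin n) →L[ℝ] EuclideanSpace ℝ (Fin n) => L v)
      (h1.unique h2)
  have hθsurj : ∀ y ∈ V', Function.Surjective (fderiv ℝ θ y) := fun y hy => by
    refine (LinearMap.injective_iff_surjective (f := (fderiv ℝ θ y).toLinearMap)).1 ?_
    exact Function.LeftInverse.injective (g := fderiv ℝ Y (θ y)) (hYθ y hy)
  have hθq : ∀ i, fderiv ℝ θ 0 (EuclideanSpace.single i 1) = (κ i)⁻¹ • q i := fun i => by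
    apply hinj
    have := hYθ 0 hV'0 (EuclideanSpace.single i 1)
    rw [hθ0] at this
    rw [this, hDq]
  -- The solution in the new coordinates.
  set Θ : SpaceTime n → SpaceTime n := fun p => (θ p.1, p.2) with hΘ
  have hΘ0 : Θ (0, t₀) = (z₀, t₀) := by simp [hΘ, hθ0]
  have hΘs : ContDiffOn ℝ ∞ Θ (Prod.fst ⁻¹' V') :=
    (hθs.comp contDiffOn_fst fun p hp => hp).prodMk contDiffOn_snd
  have hΘc : ContinuousAt Θ (0, t₀) :=
    hΘs.continuousOn.continuousAt ((hV'o.preimage continuous_fst).mem_nhds hV'0)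
  set X' : SpaceTime n → Amb n := fun p => X (θ p.1, p.2) with hX'
  set N' : SpaceTime n → Amb n := fun p => N (θ p.1, p.2) with hN'
  have hWn : W ∈ 𝓝 (Θ (0, t₀)) := by rw [hΘ0]; exact H.isOpen.mem_nhds hp₀
  have hXc : ContinuousAt X' (0, t₀) :=
    ContinuousAt.comp (f := Θ) (H.smooth.continuousOn.continuousAt hWn) hΘc
  have hNc : ContinuousAt N' (0, t₀) :=
    ContinuousAt.comp (f := Θ) (H.smooth_normal.continuousOn.continuousAt hWn) hΘc
  have hX'0 : X' (0, t₀) = X (z₀, t₀) := by rw [← hΘ0]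
  have hN'0 : N' (0, t₀) = N (z₀, t₀) := by rw [← hΘ0]
  have hNN0 := (hXXall _ hp₀).2.1
  have hXX0 := (hXXall _ hp₀).1
  have hXN0 := (hXXall _ hp₀).2.2
  rw [← hN'0] at hNN0
  rw [← hX'0] at hXX0
  rw [← hN'0, ← hX'0] at hXN0
  have hc1 : ContinuousAt (fun p => 1 + ⟪N' (0, t₀), N' p⟫) (0, t₀) :=
    continuousAt_const.add (continuousAt_const.inner hNc)
  have hne1 : 1 + ⟪N' (0, t₀), N' (0, t₀)⟫ ≠ 0 := by rw [hNN0]; norm_num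
  have hc2 : ContinuousAt (fun p => 1 + ⟪tilt (N' (0, t₀)) (N' p) (X' (0, t₀)), X' p⟫) (0, t₀) := by
    unfold tilt
    refine continuousAt_const.add (ContinuousAt.inner (continuousAt_const.sub ?_) hXc)
    exact ((hc1.inv₀ hne1).mul (hNc.inner continuousAt_const)).smul (continuousAt_const.add hNc)
  have hne2 : 1 + ⟪tilt (N' (0, t₀)) (N' (0, t₀)) (X' (0, t₀)), X' (0, t₀)⟫ ≠ 0 := by
    unfold tilt
    rw [real_inner_comm (X' (0, t₀)) (N' (0, t₀)), hXN0]
    simp only [mul_zero, zero_smul, sub_zero]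
    rw [hXX0]; norm_num
  have hev : ∀ᶠ p in 𝓝 ((0 : EuclideanSpace ℝ (Fin n)), t₀), p.1 ∈ V' ∧ Θ p ∈ W ∧
      1 + ⟪N' (0, t₀), N' p⟫ ≠ 0 ∧
      1 + ⟪tilt (N' (0, t₀)) (N' p) (X' (0, t₀)), X' p⟫ ≠ 0 :=
    ((hV'o.preimage continuous_fst).mem_nhds hV'0 |> fun h =>
      Filter.Eventually.and h ((hΘc.eventually_mem hWn).and
        ((hc1.eventually_ne hne1).and (hc2.eventually_ne hne2))))
  obtain ⟨U, hUsub, hUo, hU0⟩ := mem_nhds_iff.1 hev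
  have hXs' : ContDiffOn ℝ ∞ X' U := H.smooth.comp (hΘs.mono fun p hp => (hUsub hp).1)
    fun p hp => (hUsub hp).2.1
  have hNs' : ContDiffOn ℝ ∞ N' U := H.smooth_normal.comp (hΘs.mono fun p hp => (hUsub hp).1)
    fun p hp => (hUsub hp).2.1
  have hXd : ∀ p ∈ U, ∀ v, dirDeriv v X' p = dirDeriv (fderiv ℝ θ p.1 v.1, v.2) X (Θ p) :=
    fun p hp v => dirDeriv_comp_prodMap (hθd _ (hUsub hp).1)
      (differentiableAt_of_smooth H.isOpen H.smooth (hUsub hp).2.1) v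
  have hNd : ∀ p ∈ U, ∀ v, dirDeriv v N' p = dirDeriv (fderiv ℝ θ p.1 v.1, v.2) N (Θ p) :=
    fun p hp v => dirDeriv_comp_prodMap (hθd _ (hUsub hp).1)
      (differentiableAt_of_smooth H.isOpen H.smooth_normal (hUsub hp).2.1) v
  have hXdx : ∀ p ∈ U, ∀ i, dx i X' p =
      spaceDeriv X (Θ p) (fderiv ℝ θ p.1 (EuclideanSpace.single i 1)) := fun p hp i => hXd p hp _
  have hNdx : ∀ p ∈ U, ∀ i, dx i N' p =
      spaceDeriv N (Θ p) (fderiv ℝ θ p.1 (EuclideanSpace.single i 1)) := fun p hp i => hNd p hp _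
  have HN : NormalForm U t₀ X' N' e fun i => (κ i)⁻¹ :=
    { isOpen := hUo
      mem := hU0
      smooth := hXs'
      smooth_normal := hNs'
      inner_pos := fun p hp => (hXXall _ (hUsub hp).2.1).1
      inner_normal := fun p hp => (hXXall _ (hUsub hp).2.1).2.1
      inner_pos_normal := fun p hp => (hXXall _ (hUsub hp).2.1).2.2
      normal := fun p hp v => by
        rw [hXd p hp]
        exact H.normal _ (hUsub hp).2.1 _
      frame := by rw [hX'0, hN'0]; exact hq
      deriv_normal := fun i => by
        rw [hNdx _ hU0, hΘ0, hθq, map_smul, hBq, smul_smul, inv_mul_cancel₀ (hκ i).ne', one_smul]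
      deriv_pos := fun i => by
        rw [hXdx _ hU0, hΘ0, hθq, map_smul]
      graph := fun p hp hpt i => by
        have h1 := congrArg (fun w : EuclideanSpace ℝ (Fin n) => w i) (hθY p.1 (hUsub hp).1)
        simp only [hN', hpt]
        exact h1
      one_add_inner_ne := fun p hp => (hUsub hp).2.2.1
      one_add_inner_tilt_ne := fun p hp => (hUsub hp).2.2.2 }
  set f : SpaceTime n → ℝ := fun p => ⟪dt X' p, N' p⟫ with hf
  have hdt : ∀ p ∈ U, dt X' p = dt X (Θ p) := fun p hp => by
    have := hXd p hp (0, 1)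
    rw [map_zero] at this
    exact this
  have hflow' : ∀ p ∈ U, ∃ (q : Fin n → EuclideanSpace ℝ (Fin n)) (κ : Fin n → ℝ),
      IsTangentFrame (fun a => spaceDeriv X' p (q a)) (X' p) (N' p) ∧
      (∀ a, spaceDeriv N' p (q a) = κ a • spaceDeriv X' p (q a)) ∧ (∀ a, 0 < κ a) ∧
      dt X' p = (((n : ℝ) - k) / (k + 1) * ⟪o, X' p⟫ +
        symmQuot Finset.univ k κ * ⟪o, N' p⟫) • N' p := fun p hp => by
    obtain ⟨q₁, κ₁, h1, h2, h3, -, h4⟩ := H.flow _ (hUsub hp).2.1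
    choose g hg using fun a => hθsurj p.1 (hUsub hp).1 (q₁ a)
    have e1 : ∀ a, spaceDeriv X' p (g a) = spaceDeriv X (Θ p) (q₁ a) := fun a => by
      rw [← hg a]; exact hXd p hp _
    have e2 : ∀ a, spaceDeriv N' p (g a) = spaceDeriv N (Θ p) (q₁ a) := fun a => by
      rw [← hg a]; exact hNd p hp _
    refine ⟨g, κ₁, ?_, fun a => ?_, h3, ?_⟩
    · simp only [e1]; exact h1
    · rw [e1, e2, h2]
    · rw [hdt p hp]; exact h4
  have hspeed_eq : ∀ p ∈ U, ∀ s : ℝ, dt X' p = s • N' p → f p = s := fun p hp s hs => by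
    simp only [hf]
    rw [hs, inner_smul_left, HN.inner_normal p hp]
    simp
  refine HN.not_touching hk (f := f) ((smooth_dirDeriv hUo hXs' _).inner ℝ hNs') (fun p hp => ?_)
    (fun i => inv_pos.2 (hκ i)) ho m hmax
    (fun p hp => by
      have := H.le_inner_normal _ (hUsub hp).2.1
      have h2 : ⟪o, N' p⟫ = ⟪o, N (Θ p)⟫ := rfl
      linarith)
    (fun p hp _ => ?_) ?_ (by simpa using hκF) hμ
    (by rw [hX'0]; exact H.le_inner_pos _ hp₀) hu₀ (by rw [hN'0]; exact H.le_inner_normal _ hp₀)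
    hC₀ hC (by rw [hX'0, hN'0]; exact hmQ) (fun p hp hpt => ?_)
  · obtain ⟨_, _, -, -, -, h⟩ := hflow' p hp
    rw [hspeed_eq p hp _ h, h]
  · obtain ⟨q₁, κ₁, h1, h2, h3, h4⟩ := hflow' p hp
    exact ⟨q₁, κ₁, h1, h2, h3, hspeed_eq p hp _ h4⟩
  · refine hspeed_eq _ hU0 _ ?_
    simp only [inv_inv]
    rw [hdt _ hU0, hΘ0, hX'0, hN'0]
    exact hfl
  · rw [hXdx p hp, hNdx p hp]
    exact hZ _ (hUsub hp).2.1 hpt _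

end LocalFlow

/-! ### Hypersurfaces in the charts of a manifold -/

section Chart

variable {n : ℕ} {M : Type*} [TopologicalSpace M] [ChartedSpace (EuclideanSpace ℝ (Fin n)) M]

/-- The derivative at `x` of the chart around `x₀`. -/
def chartDeriv (x₀ x : M) : EuclideanSpace ℝ (Fin n) →L[ℝ] EuclideanSpace ℝ (Fin n) :=
  mfderiv (𝓡 n) 𝓘(ℝ, EuclideanSpace ℝ (Fin n)) (extChartAt (𝓡 n) x₀) x

lemma diff_comp {E F : Type*} [NormedAddCommGroup E] [NormedSpace ℝ E] [NormedAddCommGroup F]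
    [NormedSpace ℝ F] {f : M → E} {g : E → F} {x : M} (hg : DifferentiableAt ℝ g (f x))
    (hf : MDifferentiableAt (𝓡 n) 𝓘(ℝ, E) f x) (v : EuclideanSpace ℝ (Fin n)) :
    diff (fun y => g (f y)) x v = fderiv ℝ g (f x) (diff f x v) := by
  unfold diff
  have h := mfderiv_comp x hg.mdifferentiableAt hf
  rw [mfderiv_eq_fderiv] at h
  exact congrArg (fun L : EuclideanSpace ℝ (Fin n) →L[ℝ] F => L v) h

variable [IsManifold (𝓡 n) ∞ M] {x₀ x : M}

lemma chartDeriv_bijective (hx : x ∈ (extChartAt (𝓡 n) x₀).source) :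
    Function.Bijective (chartDeriv (n := n) x₀ x) := by
  have : IsManifold (𝓡 n) 1 M := IsManifold.of_le (n := ∞) (by simp)
  obtain ⟨L, hL⟩ := isInvertible_mfderiv_extChartAt (I := 𝓡 n) hx
  have : (chartDeriv x₀ x : EuclideanSpace ℝ (Fin n) → EuclideanSpace ℝ (Fin n)) = L := by
    unfold chartDeriv
    rw [← hL]; rfl
  rw [this]
  exact L.bijective

lemma diff_eq_fderiv_chart {F : Type*} [NormedAddCommGroup F] [NormedSpace ℝ F] {f : M → F}
    (hx : x ∈ (extChartAt (𝓡 n) x₀).source) (hf : MDifferentiableAt (𝓡 n) 𝓘(ℝ, F) f x)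
    (v : EuclideanSpace ℝ (Fin n)) :
    diff f x v = fderiv ℝ (f ∘ (extChartAt (𝓡 n) x₀).symm) (extChartAt (𝓡 n) x₀ x)
      (chartDeriv x₀ x v) := by
  have : IsManifold (𝓡 n) 1 M := IsManifold.of_le (n := ∞) (by simp)
  have hx' := hx
  rw [extChartAt_source] at hx'
  set ψ := extChartAt (𝓡 n) x₀ with hψ
  have hxt : ψ x ∈ ψ.target := ψ.map_source hx
  have hinv : ψ.symm (ψ x) = x := ψ.left_inv hx
  have hs : MDifferentiableAt 𝓘(ℝ, EuclideanSpace ℝ (Fin n)) (𝓡 n) ψ.symm (ψ x) :=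
    ((contMDiffOn_extChartAt_symm (I := 𝓡 n) (n := 1) x₀).contMDiffAt
      ((isOpen_extChartAt_target x₀).mem_nhds hxt)).mdifferentiableAt one_ne_zero
  have hc : MDifferentiableAt (𝓡 n) 𝓘(ℝ, EuclideanSpace ℝ (Fin n)) ψ x :=
    mdifferentiableAt_extChartAt hx'
  have hfs : MDifferentiableAt 𝓘(ℝ, EuclideanSpace ℝ (Fin n)) 𝓘(ℝ, F) (f ∘ ψ.symm) (ψ x) :=
    MDifferentiableAt.comp (ψ x) (by rw [hinv]; exact hf) hs
  have heq : f =ᶠ[𝓝 x] (f ∘ ψ.symm) ∘ ψ := by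
    filter_upwards [extChartAt_source_mem_nhds' (I := 𝓡 n) hx] with y hy
    simp [ψ.left_inv hy]
  have h1 : mfderiv (𝓡 n) 𝓘(ℝ, F) f x = mfderiv (𝓡 n) 𝓘(ℝ, F) ((f ∘ ψ.symm) ∘ ψ) x :=
    heq.mfderiv_eq
  rw [mfderiv_comp x hfs hc, mfderiv_eq_fderiv] at h1
  exact congrArg (fun L : EuclideanSpace ℝ (Fin n) →L[ℝ] F => L v) h1

lemma smooth_comp_chart {F : Type*} [NormedAddCommGroup F] [NormedSpace ℝ F] {f : M → F}
    (hf : ContMDiff (𝓡 n) 𝓘(ℝ, F) ∞ f) (x₀ : M) :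
    ContDiffOn ℝ ∞ (f ∘ (extChartAt (𝓡 n) x₀).symm) (extChartAt (𝓡 n) x₀).target :=
  contMDiffOn_iff_contDiffOn.1 (hf.comp_contMDiffOn (contMDiffOn_extChartAt_symm x₀))

end Chart

namespace IsEnclosingHypersurface

variable {n : ℕ} {M : Type*} [TopologicalSpace M] [ChartedSpace (EuclideanSpace ℝ (Fin n)) M]
  {o : Amb n} {X ν : M → Amb n}

lemma inner_pos (h : IsEnclosingHypersurface o X ν) (x : M) : ⟪X x, X x⟫ = 1 := by
  rw [real_inner_self_eq_norm_sq, (h.mem_hemisphere x).1, one_pow]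

lemma inner_normal (h : IsEnclosingHypersurface o X ν) (x : M) : ⟪ν x, ν x⟫ = 1 := by
  rw [real_inner_self_eq_norm_sq, h.unit_normal x, one_pow]

lemma mdifferentiableAt (h : IsEnclosingHypersurface o X ν) (x : M) :
    MDifferentiableAt (𝓡 n) 𝓘(ℝ, Amb n) X x := (h.smooth x).mdifferentiableAt (by simp)

lemma mdifferentiableAt_normal (h : IsEnclosingHypersurface o X ν) (x : M) :
    MDifferentiableAt (𝓡 n) 𝓘(ℝ, Amb n) ν x := (h.smooth_normal x).mdifferentiableAt (by simp)

lemma curvQuot_eq {κ : Fin n → ℝ} {x : M}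
    (hκ : principalCurvatures X ν x = Finset.univ.val.map κ) (k : ℕ) :
    curvQuot k X ν x = symmQuot Finset.univ k κ := by
  unfold curvQuot sigma symmQuot elemSymm
  rw [hκ, Finset.esymm_map_val, Finset.esymm_map_val]

variable [IsManifold (𝓡 n) ∞ M]

lemma diff_eq (h : IsEnclosingHypersurface o X ν) {x₀ x : M}
    (hx : x ∈ (extChartAt (𝓡 n) x₀).source) (v : EuclideanSpace ℝ (Fin n)) :
    diff X x v = dirDeriv (chartDeriv x₀ x v) (X ∘ (extChartAt (𝓡 n) x₀).symm)
      (extChartAt (𝓡 n) x₀ x) := diff_eq_fderiv_chart hx (h.mdifferentiableAt x) v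

lemma diff_normal_eq (h : IsEnclosingHypersurface o X ν) {x₀ x : M}
    (hx : x ∈ (extChartAt (𝓡 n) x₀).source) (v : EuclideanSpace ℝ (Fin n)) :
    diff ν x v = dirDeriv (chartDeriv x₀ x v) (ν ∘ (extChartAt (𝓡 n) x₀).symm)
      (extChartAt (𝓡 n) x₀ x) := diff_eq_fderiv_chart hx (h.mdifferentiableAt_normal x) v

/-- In a chart, the first and second derivatives of a hypersurface satisfy the equations of Gauss
and Weingarten. -/
lemma chart_equations (h : IsEnclosingHypersurface o X ν) (x₀ : M)
    {z : EuclideanSpace ℝ (Fin n)} (hz : z ∈ (extChartAt (𝓡 n) x₀).target)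
    (v w : EuclideanSpace ℝ (Fin n)) :
    let X' := X ∘ (extChartAt (𝓡 n) x₀).symm
    let ν' := ν ∘ (extChartAt (𝓡 n) x₀).symm
    ⟪dirDeriv v X' z, X' z⟫ = 0 ∧ ⟪dirDeriv v X' z, ν' z⟫ = 0 ∧ ⟪dirDeriv v ν' z, ν' z⟫ = 0 ∧
    ⟪dirDeriv v ν' z, X' z⟫ = 0 ∧
    ⟪dirDeriv v (dirDeriv w X') z, X' z⟫ = -⟪dirDeriv w X' z, dirDeriv v X' z⟫ ∧
    ⟪dirDeriv v (dirDeriv w X') z, ν' z⟫ = -⟪dirDeriv w X' z, dirDeriv v ν' z⟫ := by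
  intro X' ν'
  have hT : IsOpen (extChartAt (𝓡 n) x₀).target := isOpen_extChartAt_target x₀
  have hX : ContDiffOn ℝ ∞ X' (extChartAt (𝓡 n) x₀).target := smooth_comp_chart h.smooth x₀
  have hν : ContDiffOn ℝ ∞ ν' (extChartAt (𝓡 n) x₀).target := smooth_comp_chart h.smooth_normal x₀
  have e1 : ∀ v, ∀ z ∈ (extChartAt (𝓡 n) x₀).target, ⟪dirDeriv v X' z, X' z⟫ = 0 := by
    intro v z hz
    have h1 := dirDeriv_congr hT (f := fun z => ⟪X' z, X' z⟫) (g := fun _ => (1 : ℝ))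
      (fun z _ => h.inner_pos _) v hz
    rw [dirDeriv_const, dirDeriv_inner hT hX hX v hz, real_inner_comm (dirDeriv v X' z)] at h1
    linarith
  have e2 : ∀ v, ∀ z ∈ (extChartAt (𝓡 n) x₀).target, ⟪dirDeriv v X' z, ν' z⟫ = 0 := by
    intro v z hz
    have hx := (extChartAt (𝓡 n) x₀).map_target hz
    obtain ⟨w, rfl⟩ := (chartDeriv_bijective hx).2 v
    have h1 := h.normal ((extChartAt (𝓡 n) x₀).symm z) w
    rwa [h.diff_eq hx, (extChartAt (𝓡 n) x₀).right_inv hz] at h1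
  have e3 : ⟪dirDeriv v ν' z, ν' z⟫ = 0 := by
    have h1 := dirDeriv_congr hT (f := fun z => ⟪ν' z, ν' z⟫) (g := fun _ => (1 : ℝ))
      (fun z _ => h.inner_normal _) v hz
    rw [dirDeriv_const, dirDeriv_inner hT hν hν v hz, real_inner_comm (dirDeriv v ν' z)] at h1
    linarith
  refine ⟨e1 v z hz, e2 v z hz, e3, ?_, ?_, ?_⟩
  · have h1 := dirDeriv_congr hT (f := fun z => ⟪X' z, ν' z⟫) (g := fun _ => (0 : ℝ))
      (fun z _ => h.tangent_sphere _) v hz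
    rw [dirDeriv_const, dirDeriv_inner hT hX hν v hz, e2 v z hz, zero_add] at h1
    rw [real_inner_comm]; exact h1
  · have h1 := dirDeriv_congr hT (g := fun _ => (0 : ℝ)) (e1 w) v hz
    rw [dirDeriv_const, dirDeriv_inner hT (smooth_dirDeriv hT hX w) hX v hz] at h1
    linarith
  · have h1 := dirDeriv_congr hT (g := fun _ => (0 : ℝ)) (e2 w) v hz
    rw [dirDeriv_const, dirDeriv_inner hT (smooth_dirDeriv hT hX w) hν v hz] at h1
    linarith

/-- An orthonormal basis of principal directions. -/
lemma exists_frame (h : IsEnclosingHypersurface o X ν) (x : M) :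
    ∃ (q : Fin n → EuclideanSpace ℝ (Fin n)) (κ : Fin n → ℝ),
      IsTangentFrame (fun a => diff X x (q a)) (X x) (ν x) ∧
      (∀ a, diff ν x (q a) = κ a • diff X x (q a)) ∧
      principalCurvatures X ν x = Finset.univ.val.map κ := by
  have hx : x ∈ (extChartAt (𝓡 n) x).source := mem_extChartAt_source x
  have hz := (extChartAt (𝓡 n) x).map_source hx
  have hinv : (extChartAt (𝓡 n) x).symm (extChartAt (𝓡 n) x x) = x :=
    (extChartAt (𝓡 n) x).left_inv hx
  refine exists_principal_frame (h.immersion x) (h.inner_pos x) (h.inner_normal x)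
    (h.tangent_sphere x) (fun v => ?_) (h.normal x) (fun v => ?_) (fun v => ?_) (fun v w => ?_)
  · have := (h.chart_equations x hz (chartDeriv x x v) 0).1
    rw [h.diff_eq hx]
    simpa [hinv] using this
  · have := (h.chart_equations x hz (chartDeriv x x v) 0).2.2.2.1
    rw [h.diff_normal_eq hx]
    simpa [hinv] using this
  · have := (h.chart_equations x hz (chartDeriv x x v) 0).2.2.1
    rw [h.diff_normal_eq hx]
    simpa [hinv] using this
  · have h1 := (h.chart_equations x hz (chartDeriv x x v) (chartDeriv x x w)).2.2.2.2.2
    have h2 := (h.chart_equations x hz (chartDeriv x x w) (chartDeriv x x v)).2.2.2.2.2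
    rw [dirDeriv_comm (isOpen_extChartAt_target x) (smooth_comp_chart h.smooth x) _ _ hz] at h1
    rw [h.diff_eq hx, h.diff_normal_eq hx, h.diff_eq hx, h.diff_normal_eq hx]
    refine (real_inner_comm _ _).trans (Eq.trans ?_ (real_inner_comm _ _))
    linarith

/-- At the point of the hypersurface farthest from `o` the support function is positive. -/
lemma inner_normal_neg_of_isMin (h : IsEnclosingHypersurface o X ν) (hc : IsStrictlyConvex X ν)
    (hn : 0 < n) {x : M} (hmin : ∀ y, ⟪o, X x⟫ ≤ ⟪o, X y⟫) : ⟪o, ν x⟫ < 0 := by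
  obtain ⟨q, κ, hq, hB, hκ⟩ := h.exists_frame x
  have hx : x ∈ (extChartAt (𝓡 n) x).source := mem_extChartAt_source x
  have hz := (extChartAt (𝓡 n) x).map_source hx
  have hinv : (extChartAt (𝓡 n) x).symm (extChartAt (𝓡 n) x x) = x :=
    (extChartAt (𝓡 n) x).left_inv hx
  have hT : IsOpen (extChartAt (𝓡 n) x).target := isOpen_extChartAt_target x
  set X' := X ∘ (extChartAt (𝓡 n) x).symm with hX'
  set z := extChartAt (𝓡 n) x x with hzdef
  have hX : ContDiffOn ℝ ∞ X' (extChartAt (𝓡 n) x).target := smooth_comp_chart h.smooth x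
  have hXz : X' z = X x := congrArg X hinv
  have hg : ContDiffOn ℝ ∞ (fun y => ⟪o, X' y⟫) (extChartAt (𝓡 n) x).target :=
    contDiffOn_const.inner ℝ hX
  have hline : ∀ v, ⟪o, dirDeriv v X' z⟫ = 0 ∧ 0 ≤ ⟪o, dirDeriv v (dirDeriv v X') z⟫ := by
    intro v
    have h1 := dirDeriv_of_line_min hT (f := fun y => ⟪o, X' y⟫ - ⟪o, X x⟫)
      (hg.sub contDiffOn_const) v hz (by simp [hXz])
      (Filter.Eventually.of_forall fun s => sub_nonneg.2 (hmin _))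
    have h2 : ∀ y ∈ (extChartAt (𝓡 n) x).target,
        dirDeriv v (fun y => ⟪o, X' y⟫ - ⟪o, X x⟫) y = ⟪o, dirDeriv v X' y⟫ := fun y hy => by
      rw [dirDeriv_sub hT hg contDiffOn_const v hy, dirDeriv_const,
        dirDeriv_const_inner hT o hX v hy, sub_zero]
    rw [dirDeriv_congr hT h2 v hz, h2 z hz,
      dirDeriv_const_inner hT o (smooth_dirDeriv hT hX v) v hz] at h1
    exact h1
  set a : Fin n := ⟨0, hn⟩
  have hκa : 0 < κ a := hc x (κ a) (by rw [hκ]; simp)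
  have hzero : ∀ i, ⟪o, diff X x (q i)⟫ = 0 := fun i => by
    rw [h.diff_eq hx]; exact (hline _).1
  set v := chartDeriv x x (q a) with hv
  have h1 := (hline v).2
  obtain ⟨-, -, -, -, h2, h3⟩ := h.chart_equations x hz v v
  simp only [Function.comp_apply, hinv] at h2 h3
  change ⟪dirDeriv v (dirDeriv v X') z, X x⟫ = -⟪dirDeriv v X' z, dirDeriv v X' z⟫ at h2
  have e1 : dirDeriv v X' z = diff X x (q a) := (h.diff_eq hx _).symm
  have e2 : dirDeriv v (ν ∘ (extChartAt (𝓡 n) x).symm) z = diff ν x (q a) :=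
    (h.diff_normal_eq hx _).symm
  have h4 := hq.inner_frame a a
  simp only [if_true] at h4
  rw [e1, h4] at h2
  change ⟪dirDeriv v (dirDeriv v X') z, ν x⟫ = -⟪dirDeriv v X' z, dirDeriv v _ z⟫ at h3
  rw [e1, e2, hB, inner_smul_right, h4, mul_one] at h3
  rw [hq.inner_eq, h2, h3] at h1
  simp only [hzero, zero_mul, Finset.sum_const_zero] at h1
  have hpos := (h.mem_hemisphere x).2
  by_contra hcon
  push Not at hcon
  nlinarith [mul_nonneg hcon hκa.le]

end IsEnclosingHypersurface

/-! ### Polar coordinates and the lower bound for the support function -/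

section Polar

variable {n : ℕ} {o p w : Amb n}

lemma cos_rho (ho : ‖o‖ = 1) (hp : ‖p‖ = 1) : Real.cos (rho o p) = ⟪o, p⟫ := by
  have h := abs_le.1 (abs_real_inner_le_norm o p)
  rw [ho, hp, one_mul] at h
  exact Real.cos_arccos h.1 h.2

lemma sin_rho_sq (ho : ‖o‖ = 1) (hp : ‖p‖ = 1) : Real.sin (rho o p) ^ 2 = 1 - ⟪o, p⟫ ^ 2 := by
  rw [← cos_rho ho hp, ← Real.sin_sq_add_cos_sq (rho o p)]; ring

lemma support_eq {ν : Amb n} (ho : ‖o‖ = 1) (hp : ‖p‖ = 1) (hs : Real.sin (rho o p) ≠ 0)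
    (hν : ⟪p, ν⟫ = 0) : support o p ν = -⟪o, ν⟫ := by
  have h1 := sin_rho_sq ho hp
  rw [← cos_rho ho hp] at h1
  unfold support conformalField radialField ang
  simp only [inner_smul_left, inner_sub_left, hν, conj_trivial]
  field_simp
  linear_combination -⟪o, ν⟫ * h1

/-- The differentials of the polar coordinates. -/
lemma polar_deriv (ho : ‖o‖ = 1) (hp : ‖p‖ = 1) (hs : 0 < Real.sin (rho o p)) :
    DifferentiableAt ℝ (rho o) p ∧ DifferentiableAt ℝ (ang o) p ∧
    ∀ w, Real.sin (rho o p) * fderiv ℝ (rho o) p w = -⟪o, w⟫ ∧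
      Real.sin (rho o p) • fderiv ℝ (ang o) p w =
        w + (Real.sin (rho o p) * fderiv ℝ (rho o) p w) • o -
          (Real.cos (rho o p) * fderiv ℝ (rho o) p w) • ang o p := by
  have h1 := sin_rho_sq ho hp
  have hne1 : ⟪o, p⟫ ≠ 1 := fun h => by rw [h] at h1; nlinarith
  have hne2 : ⟪o, p⟫ ≠ -1 := fun h => by rw [h] at h1; nlinarith
  have hin : HasFDerivAt (fun q : Amb n => ⟪o, q⟫) (innerSL ℝ o) p := (innerSL ℝ o).hasFDerivAt
  have hr : HasFDerivAt (rho o) (-(1 / √(1 - ⟪o, p⟫ ^ 2)) • innerSL ℝ o) p :=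
    (Real.hasDerivAt_arccos hne2 hne1).comp_hasFDerivAt p hin
  have hsin : √(1 - ⟪o, p⟫ ^ 2) = Real.sin (rho o p) := (Real.sin_arccos _).symm
  rw [hsin] at hr
  set r' := -(1 / Real.sin (rho o p)) • innerSL ℝ o with hr'
  have hS : HasFDerivAt (fun q => Real.sin (rho o q)) (Real.cos (rho o p) • r') p := hr.sin
  have hC : HasFDerivAt (fun q => Real.cos (rho o q)) (-Real.sin (rho o p) • r') p := hr.cos
  have hA : DifferentiableAt ℝ (ang o) p := by
    unfold ang
    exact (hS.differentiableAt.inv hs.ne').smul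
      (differentiableAt_id.sub (hC.differentiableAt.smul_const o))
  refine ⟨hr.differentiableAt, hA, fun w => ⟨?_, ?_⟩⟩
  · rw [hr.fderiv, hr']
    simp
    field_simp
  · have h2 : HasFDerivAt (fun q => Real.sin (rho o q) • ang o q) _ p := hS.smul hA.hasFDerivAt
    have h3 : HasFDerivAt (fun q => q - Real.cos (rho o q) • o) _ p :=
      (hasFDerivAt_id p).sub (hC.smul_const o)
    have heq : (fun q => Real.sin (rho o q) • ang o q) =ᶠ[𝓝 p]
        fun q => q - Real.cos (rho o q) • o := by
      filter_upwards [hS.continuousAt.eventually_ne hs.ne'] with q hq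
      unfold ang
      rw [smul_smul, mul_inv_cancel₀ hq, one_smul]
    have h4 := congrArg (fun L : Amb n →L[ℝ] Amb n => L w)
      (h2.unique (h3.congr_of_eventuallyEq heq))
    rw [hr.fderiv]
    simp at h4
    rw [eq_sub_iff_add_eq]
    refine (h4.trans ?_)
    simp

/-- The round metric in polar coordinates. -/
lemma polar_metric (ho : ‖o‖ = 1) (hp : ‖p‖ = 1) (hs : 0 < Real.sin (rho o p)) (hw : ⟪w, p⟫ = 0) :
    Real.sin (rho o p) ^ 2 * ‖fderiv ℝ (ang o) p w‖ ^ 2 =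
      ‖w‖ ^ 2 - fderiv ℝ (rho o) p w ^ 2 := by
  obtain ⟨-, -, h⟩ := polar_deriv ho hp hs
  obtain ⟨h1, h2⟩ := h w
  set s := Real.sin (rho o p) with hsdef
  set r' := fderiv ℝ (rho o) p w
  have hc := cos_rho ho hp
  have hsq := sin_rho_sq ho hp
  rw [← hc] at hsq
  have hang : ang o p = s⁻¹ • (p - Real.cos (rho o p) • o) := rfl
  set φ := Real.cos (rho o p) with hφ
  have hoo : ⟪o, o⟫ = 1 := by rw [real_inner_self_eq_norm_sq, ho, one_pow]
  have hpp : ⟪p, p⟫ = 1 := by rw [real_inner_self_eq_norm_sq, hp, one_pow]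
  have hop : ⟪p, o⟫ = φ := by rw [real_inner_comm, hc]
  have how : ⟪w, o⟫ = -(s * r') := by rw [real_inner_comm, h1]; ring
  have hne : s ≠ 0 := hs.ne'
  have hzo : ⟪ang o p, o⟫ = 0 := by
    rw [hang, inner_smul_left, inner_sub_left, inner_smul_left, hop, hoo]; simp
  have hzz : ⟪ang o p, ang o p⟫ = 1 := by
    rw [hang]
    simp only [inner_smul_left, inner_smul_right, inner_sub_left, inner_sub_right, hpp, hop, hoo,
      real_inner_comm p o, conj_trivial]
    field_simp
    linear_combination -hsq
  have hwz : ⟪w, ang o p⟫ = φ * r' := by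
    rw [hang, inner_smul_right, inner_sub_right, inner_smul_right, hw, how]
    field_simp
    ring
  have e1 : s ^ 2 * ‖fderiv ℝ (ang o) p w‖ ^ 2 = ⟪s • fderiv ℝ (ang o) p w,
      s • fderiv ℝ (ang o) p w⟫ := by
    rw [inner_smul_left, inner_smul_right, real_inner_self_eq_norm_sq]; simp; ring
  rw [e1, h2]
  simp only [inner_sub_left, inner_sub_right, inner_add_left, inner_add_right, inner_smul_left,
    inner_smul_right, conj_trivial, real_inner_comm w o, real_inner_comm w (ang o p),
    real_inner_comm (ang o p) o, hzo, hzz, hwz, how, hoo, real_inner_self_eq_norm_sq w]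
  linear_combination -r' ^ 2 * hsq

/-- A gradient bound for the radial function bounds the support function from below. -/
lemma le_sq_inner_normal {M : Type*} [TopologicalSpace M] [ChartedSpace (EuclideanSpace ℝ (Fin n)) M]
    [IsManifold (𝓡 n) ∞ M] {X ν : M → Amb n} (h : IsEnclosingHypersurface o X ν) (ho : ‖o‖ = 1)
    {G r₁ : ℝ} (hG : RadialGradientBound o X G) (hr₁ : 0 < r₁) (x : M)
    (hr : r₁ ≤ rho o (X x)) (hr' : rho o (X x) ≤ Real.pi / 2) :
    Real.sin r₁ ^ 4 / (1 + G ^ 2) ≤ ⟪o, ν x⟫ ^ 2 := by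
  have hX1 := (h.mem_hemisphere x).1
  have hs1 : 0 < Real.sin r₁ := Real.sin_pos_of_pos_of_lt_pi hr₁ (by linarith [Real.pi_pos])
  have hs : Real.sin r₁ ≤ Real.sin (rho o (X x)) :=
    Real.sin_le_sin_of_le_of_le_pi_div_two (by linarith [Real.pi_pos]) hr' hr
  set s := Real.sin (rho o (X x)) with hsdef
  have hspos : 0 < s := hs1.trans_le hs
  have hsle : s ^ 2 ≤ 1 := by nlinarith [Real.sin_le_one (rho o (X x)), Real.neg_one_le_sin r₁]
  obtain ⟨q, κ, hq, -, -⟩ := h.exists_frame x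
  have hsq := sin_rho_sq ho hX1
  -- The tangential part of `o` is the direction of the gradient of the radial function.
  set v : EuclideanSpace ℝ (Fin n) := ∑ i, ⟪o, diff X x (q i)⟫ • q i with hv
  have hdv : diff X x v = ∑ i, ⟪o, diff X x (q i)⟫ • diff X x (q i) := by
    rw [hv, map_sum]; simp
  set b := ∑ i, ⟪o, diff X x (q i)⟫ ^ 2 with hb
  have hob : ⟪o, diff X x v⟫ = b := by
    rw [hdv, inner_sum]
    simp only [inner_smul_right, hb, pow_two]
  have hvv : ‖diff X x v‖ ^ 2 = b := by
    rw [← real_inner_self_eq_norm_sq, hdv]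
    simp only [sum_inner, inner_sum, inner_smul_left, inner_smul_right, hq.inner_frame]
    simp [hb, pow_two]
  have hoo : b + ⟪o, X x⟫ ^ 2 + ⟪o, ν x⟫ ^ 2 = 1 := by
    have h1 := hq.inner_eq o o
    rw [real_inner_self_eq_norm_sq, ho] at h1
    simp only [hb, pow_two] at h1 ⊢
    linarith
  obtain ⟨hd1, hd2, hd⟩ := polar_deriv ho hX1 hspos
  have hvX : ⟪diff X x v, X x⟫ = 0 := by
    rw [hdv]
    simp only [sum_inner, inner_smul_left, hq.inner_frame_pos]
    simp
  have hm := polar_metric ho hX1 hspos hvX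
  have h1 := (hd (diff X x v)).1
  have h2 := hG x v
  rw [diff_comp hd1 (h.mdifferentiableAt x), diff_comp hd2 (h.mdifferentiableAt x)] at h2
  rw [hob] at h1
  rw [hvv] at hm
  set r' := fderiv ℝ (rho o) (X x) (diff X x v)
  set Z := ‖fderiv ℝ (ang o) (X x) (diff X x v)‖
  have h3 : r' ^ 2 ≤ (G * Z) ^ 2 := sq_le_sq' (by linarith [neg_abs_le r']) ((le_abs_self r').trans h2)
  have h4 : s ^ 2 * r' ^ 2 = b ^ 2 := by linear_combination (s * r' - b) * h1
  have hb0 : 0 ≤ b := Finset.sum_nonneg fun i _ => sq_nonneg _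
  have h5 : b * (b * (s ^ 2 + G ^ 2)) ≤ b * (G ^ 2 * s ^ 2) := by
    have h6 := mul_le_mul_of_nonneg_left h3 (show 0 ≤ s ^ 2 * s ^ 2 by positivity)
    have h7 : s ^ 2 * s ^ 2 * (G * Z) ^ 2 = s ^ 2 * G ^ 2 * (b - r' ^ 2) := by
      rw [← hm]; ring
    rw [h7] at h6
    nlinarith
  rw [div_le_iff₀ (by positivity)]
  have h8 : s ^ 2 = b + ⟪o, ν x⟫ ^ 2 := by linarith
  have h9 : s ^ 4 ≤ ⟪o, ν x⟫ ^ 2 * (s ^ 2 + G ^ 2) := by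
    rcases hb0.eq_or_lt with hb0 | hb0
    · have : ⟪o, ν x⟫ ^ 2 = s ^ 2 := by linarith
      rw [this]
      nlinarith [mul_nonneg (sq_nonneg s) (sq_nonneg G)]
    · have h6 := le_of_mul_le_mul_left h5 hb0
      have h7 : ⟪o, ν x⟫ ^ 2 = s ^ 2 - b := by linarith
      rw [h7]
      nlinarith
  have h10 : Real.sin r₁ ^ 4 ≤ s ^ 4 := pow_le_pow_left₀ hs1.le hs 4
  nlinarith [mul_le_mul_of_nonneg_left hsle (sq_nonneg ⟪o, ν x⟫)]

end Polar

/-! ### Families of hypersurfaces in charts -/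

lemma convex_timeInterval (T : EReal) : Convex ℝ (timeInterval T) := by
  refine Set.OrdConnected.convex ⟨fun a ha b hb t ht => ⟨ha.1.trans ht.1, ?_⟩⟩
  exact lt_of_le_of_lt (by exact_mod_cast ht.2) hb.2

lemma timeInterval_mem_nhds {T : EReal} {t : ℝ} (ht : t ∈ timeInterval T) (ht0 : 0 < t) :
    timeInterval T ∈ 𝓝 t := by
  obtain ⟨t', h1, h2⟩ := EReal.lt_iff_exists_real_btwn.1 ht.2
  refine Filter.mem_of_superset (Ioo_mem_nhds ht0 (by exact_mod_cast h1)) fun s hs => ⟨hs.1.le, ?_⟩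
  exact lt_trans (by exact_mod_cast hs.2) h2

lemma uniqueDiffOn_timeInterval {T : EReal} {t : ℝ} (ht : t ∈ timeInterval T) :
    UniqueDiffOn ℝ (timeInterval T) := by
  obtain ⟨t', h1, h2⟩ := EReal.lt_iff_exists_real_btwn.1 ht.2
  have h3 : t < t' := by exact_mod_cast h1
  refine uniqueDiffOn_convex (convex_timeInterval T) ⟨(t + t') / 2, ?_⟩
  refine mem_interior_iff_mem_nhds.2 (timeInterval_mem_nhds ⟨by linarith [ht.1], ?_⟩
    (by linarith [ht.1]))
  exact lt_trans (by exact_mod_cast (by linarith : (t + t') / 2 < t')) h2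

section ChartFun

variable {n : ℕ} {M : Type*} [TopologicalSpace M] [ChartedSpace (EuclideanSpace ℝ (Fin n)) M]

/-- A family of maps in the chart around `x₀`, as a map on space-time. -/
def chartFun (x₀ : M) (f : ℝ → M → Amb n) : SpaceTime n → Amb n :=
  fun p => f p.2 ((extChartAt (𝓡 n) x₀).symm p.1)

variable {T : EReal} {f : ℝ → M → Amb n}

lemma hasFDerivAt_of_chartFun {x₀ : M} {p : SpaceTime n}
    (hp : p ∈ (extChartAt (𝓡 n) x₀).target ×ˢ timeInterval T) {D : SpaceTime n →L[ℝ] Amb n}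
    (hD : HasFDerivWithinAt (chartFun x₀ f) D ((extChartAt (𝓡 n) x₀).target ×ˢ timeInterval T) p) :
    HasFDerivAt (f p.2 ∘ (extChartAt (𝓡 n) x₀).symm) (D.comp (ContinuousLinearMap.inl ℝ _ _))
      p.1 := by
  have h1 : HasFDerivWithinAt (fun z : EuclideanSpace ℝ (Fin n) => (z, p.2))
      (ContinuousLinearMap.inl ℝ _ _) (extChartAt (𝓡 n) x₀).target p.1 :=
    ((hasFDerivAt_id p.1).prodMk (hasFDerivAt_const p.2 p.1)).hasFDerivWithinAt
  have h2 := HasFDerivWithinAt.comp (g := chartFun x₀ f)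
    (f := fun z : EuclideanSpace ℝ (Fin n) => (z, p.2)) p.1 hD h1
    (fun z hz => ⟨hz, hp.2⟩)
  exact h2.hasFDerivAt ((isOpen_extChartAt_target x₀).mem_nhds hp.1)

lemma spaceDeriv_chartFun {x₀ : M} {p : SpaceTime n}
    (hp : p ∈ (extChartAt (𝓡 n) x₀).target ×ˢ timeInterval T)
    (hd : DifferentiableAt ℝ (chartFun x₀ f) p) :
    spaceDeriv (chartFun x₀ f) p = fderiv ℝ (f p.2 ∘ (extChartAt (𝓡 n) x₀).symm) p.1 :=
  (hasFDerivAt_of_chartFun hp hd.hasFDerivAt.hasFDerivWithinAt).fderiv.symm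

variable [IsManifold (𝓡 n) ∞ M]

lemma contDiffOn_chartFun (hf : ContMDiffOn ((𝓡 n).prod 𝓘(ℝ, ℝ)) 𝓘(ℝ, Amb n) ∞
    (fun p : M × ℝ => f p.2 p.1) (Set.univ ×ˢ timeInterval T)) (x₀ : M) :
    ContDiffOn ℝ ∞ (chartFun x₀ f) ((extChartAt (𝓡 n) x₀).target ×ˢ timeInterval T) := by
  rw [← contMDiffOn_iff_contDiffOn, modelWithCornersSelf_prod, ← chartedSpaceSelf_prod]
  have h1 : ContMDiffOn (𝓘(ℝ, EuclideanSpace ℝ (Fin n)).prod 𝓘(ℝ, ℝ)) (𝓡 n) ∞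
      (fun p : EuclideanSpace ℝ (Fin n) × ℝ => (extChartAt (𝓡 n) x₀).symm p.1)
      ((extChartAt (𝓡 n) x₀).target ×ˢ timeInterval T) :=
    (contMDiffOn_extChartAt_symm x₀).comp contMDiffOn_fst fun p hp => hp.1
  exact hf.comp (h1.prodMk contMDiffOn_snd) fun p hp => ⟨Set.mem_univ _, hp.2⟩

/-- The space derivative of a smooth family is continuous, up to the initial time. -/
lemma continuousOn_fderiv_chart (hf : ContMDiffOn ((𝓡 n).prod 𝓘(ℝ, ℝ)) 𝓘(ℝ, Amb n) ∞
    (fun p : M × ℝ => f p.2 p.1) (Set.univ ×ˢ timeInterval T)) (x₀ : M) :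
    ContinuousOn (fun p : SpaceTime n => fderiv ℝ (f p.2 ∘ (extChartAt (𝓡 n) x₀).symm) p.1)
      ((extChartAt (𝓡 n) x₀).target ×ˢ timeInterval T) := by
  have hs := contDiffOn_chartFun hf x₀
  rcases (timeInterval T).eq_empty_or_nonempty with hT | ⟨t, ht⟩
  · simp [hT]
  have hu : UniqueDiffOn ℝ ((extChartAt (𝓡 n) x₀).target ×ˢ timeInterval T) :=
    (isOpen_extChartAt_target x₀).uniqueDiffOn.prod (uniqueDiffOn_timeInterval ht)
  have hc := hs.continuousOn_fderivWithin hu (by simp)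
  refine ContinuousOn.congr (f := fun p => (fderivWithin ℝ (chartFun x₀ f)
    ((extChartAt (𝓡 n) x₀).target ×ˢ timeInterval T) p).comp (ContinuousLinearMap.inl ℝ _ _))
    (hc.clm_comp continuousOn_const) fun p hp => ?_
  exact (hasFDerivAt_of_chartFun hp
    ((hs.differentiableOn (by simp)) p hp).hasFDerivWithinAt).fderiv

end ChartFun

/-! ### The principal radii of curvature stay below the barrier -/

section Radii

variable {n : ℕ} {M : Type*} [TopologicalSpace M] [ChartedSpace (EuclideanSpace ℝ (Fin n)) M]

/-- All principal radii of curvature at `x` are less than `Q`. -/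
def RadiiLT (X ν : M → Amb n) (Q : ℝ) (x : M) : Prop :=
  ∀ v : EuclideanSpace ℝ (Fin n), v ≠ 0 → ⟪diff X x v, diff ν x v⟫ < Q * ⟪diff ν x v, diff ν x v⟫

lemma IsStrictlyConvex.pos_of_frame {X ν : M → Amb n} (hc : IsStrictlyConvex X ν) {x : M} {κ : Fin n → ℝ}
    (hκ : principalCurvatures X ν x = Finset.univ.val.map κ) (a : Fin n) : 0 < κ a :=
  hc x _ (by rw [hκ]; exact Multiset.mem_map_of_mem κ (Finset.mem_univ_val a))

variable [IsManifold (𝓡 n) ∞ M] {k : ℕ} {o : Amb n} {T : EReal} {X ν : ℝ → M → Amb n}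

namespace IsEnclosingHypersurface

variable {X ν : M → Amb n}

lemma inner_diff_pos (h : IsEnclosingHypersurface o X ν) (x : M)
    (v : EuclideanSpace ℝ (Fin n)) : ⟪diff X x v, X x⟫ = 0 := by
  have hx : x ∈ (extChartAt (𝓡 n) x).source := mem_extChartAt_source x
  have := (h.chart_equations x ((extChartAt (𝓡 n) x).map_source hx) (chartDeriv x x v) 0).1
  rw [h.diff_eq hx]
  simpa [(extChartAt (𝓡 n) x).left_inv hx] using this

lemma inner_diff_diff_normal_pos (h : IsEnclosingHypersurface o X ν) (hc : IsStrictlyConvex X ν)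
    {x : M} {v : EuclideanSpace ℝ (Fin n)} (hv : v ≠ 0) : 0 < ⟪diff X x v, diff ν x v⟫ := by
  obtain ⟨q, κ, hq, hB, hκ⟩ := h.exists_frame x
  obtain ⟨a, ha, e1, -⟩ := frame_expansion (h.immersion x) (h.inner_diff_pos x) (h.normal x) hq hB v
  obtain ⟨i, hi⟩ : ∃ i, a i ≠ 0 := by
    by_contra hne
    push Not at hne
    exact hv (by rw [ha]; simp [hne])
  rw [e1]
  exact Finset.sum_pos' (fun i _ => mul_nonneg (sq_nonneg _) (hc.pos_of_frame hκ i).le)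
    ⟨i, Finset.mem_univ _, mul_pos (by positivity) (hc.pos_of_frame hκ i)⟩

lemma exists_radiiLT (h : IsEnclosingHypersurface o X ν) (hc : IsStrictlyConvex X ν) (x : M) :
    ∃ Q, RadiiLT X ν Q x := by
  obtain ⟨q, κ, hq, hB, hκ⟩ := h.exists_frame x
  have hpos := hc.pos_of_frame hκ
  refine ⟨1 + ∑ i, (κ i)⁻¹, fun v hv => inner_lt_of_inv_lt (h.immersion x) (h.inner_diff_pos x)
    (h.normal x) hq hB hpos (fun i => ?_) hv⟩
  have := Finset.single_le_sum (f := fun i => (κ i)⁻¹) (fun i _ => (inv_pos.2 (hpos i)).le)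
    (Finset.mem_univ i)
  linarith

/-- The outward normal of a strictly convex hypersurface is determined by the hypersurface. -/
lemma normal_unique {ν' : M → Amb n} (hn : 0 < n) (h : IsEnclosingHypersurface o X ν)
    (hc : IsStrictlyConvex X ν) (h' : IsEnclosingHypersurface o X ν')
    (hc' : IsStrictlyConvex X ν') : ν = ν' := by
  have hcol : ∀ y, ν' y = ⟪ν' y, ν y⟫ • ν y := fun y => by
    obtain ⟨q, κ, hq, -, -⟩ := h.exists_frame y
    have e1 : ∀ i, ⟪ν y, diff X y (q i)⟫ = 0 := fun i => by
      rw [real_inner_comm]; exact h.normal y _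
    have e2 : ⟪ν y, X y⟫ = 0 := by rw [real_inner_comm]; exact h.tangent_sphere y
    refine hq.ext (fun i => ?_) ?_ ?_
    · rw [inner_smul_left, e1, mul_zero, real_inner_comm]
      exact h'.normal y _
    · rw [inner_smul_left, e2, mul_zero, real_inner_comm]
      exact h'.tangent_sphere y
    · rw [inner_smul_left, h.inner_normal]; simp
  have hsq : ∀ y, ⟪ν' y, ν y⟫ = 1 ∨ ⟪ν' y, ν y⟫ = -1 := fun y => by
    have h1 := h'.inner_normal y
    rw [hcol y, inner_smul_left, inner_smul_right, h.inner_normal] at h1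
    rw [← sq_eq_one_iff]
    simpa [pow_two] using h1
  funext y
  rcases hsq y with h1 | h1
  · rw [hcol y, h1, one_smul]
  -- Opposite normals at `y` would be opposite near `y`, and only one of them is convex.
  exfalso
  have hcont : Continuous fun y => ⟪ν' y, ν y⟫ :=
    h'.smooth_normal.continuous.inner h.smooth_normal.continuous
  have hev : ν' =ᶠ[𝓝 y] -ν := by
    filter_upwards [hcont.continuousAt.eventually_lt continuousAt_const
      (show ⟪ν' y, ν y⟫ < 0 by rw [h1]; norm_num)] with w hw
    have h2 : ⟪ν' w, ν w⟫ = -1 := (hsq w).resolve_left fun h2 => by rw [h2] at hw; linarith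
    rw [hcol w, h2]; simp
  have hd : ∀ v : EuclideanSpace ℝ (Fin n), diff ν' y v = -diff ν y v := fun v => by
    unfold diff
    rw [hev.mfderiv_eq, mfderiv_neg]
    rfl
  have hv : EuclideanSpace.single (⟨0, hn⟩ : Fin n) (1 : ℝ) ≠ 0 := by simp
  have p1 := h.inner_diff_diff_normal_pos hc (x := y) hv
  have p2 := h'.inner_diff_diff_normal_pos hc' (x := y) hv
  rw [hd, inner_neg_right] at p2
  linarith

end IsEnclosingHypersurface

namespace IsConvexSolution

/-- The condition that the radii of curvature are less than `Q` is open. -/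
lemma eventually_radiiLT (S : IsConvexSolution k o T X ν) {Q : M → ℝ → ℝ}
    (hQ : ContinuousOn (fun p : M × ℝ => Q p.1 p.2) (Set.univ ×ˢ timeInterval T)) {t : ℝ}
    (ht : t ∈ timeInterval T) {x : M} (hx : RadiiLT (X t) (ν t) (Q x t) x) :
    ∀ᶠ p : M × ℝ in 𝓝 (x, t), p.2 ∈ timeInterval T →
      RadiiLT (X p.2) (ν p.2) (Q p.1 p.2) p.1 := by
  set ψ := extChartAt (𝓡 n) x with hψ
  set D : Set (SpaceTime n) := ψ.target ×ˢ timeInterval T with hD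
  have hxs : x ∈ ψ.source := mem_extChartAt_source x
  set A : SpaceTime n → EuclideanSpace ℝ (Fin n) →L[ℝ] Amb n :=
    fun p => fderiv ℝ (X p.2 ∘ ψ.symm) p.1 with hA
  set B : SpaceTime n → EuclideanSpace ℝ (Fin n) →L[ℝ] Amb n :=
    fun p => fderiv ℝ (ν p.2 ∘ ψ.symm) p.1 with hB
  have hAc : ContinuousOn A D := continuousOn_fderiv_chart S.smooth x
  have hBc : ContinuousOn B D := continuousOn_fderiv_chart S.smooth_normal x
  have hQc : ContinuousOn (fun p : SpaceTime n => Q (ψ.symm p.1) p.2) D := by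
    refine hQ.comp (f := fun p : SpaceTime n => (ψ.symm p.1, p.2)) ?_
      fun p hp => ⟨Set.mem_univ _, hp.2⟩
    exact ((continuousOn_extChartAt_symm x).comp continuousOn_fst fun p hp => hp.1).prodMk
      continuousOn_snd
  have hdX : ∀ p : M × ℝ, p.1 ∈ ψ.source → p.2 ∈ timeInterval T → ∀ v,
      diff (X p.2) p.1 v = A (ψ p.1, p.2) (chartDeriv x p.1 v) := fun p hp ht v =>
    (S.hypersurface _ ht).diff_eq hp v
  have hdν : ∀ p : M × ℝ, p.1 ∈ ψ.source → p.2 ∈ timeInterval T → ∀ v,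
      diff (ν p.2) p.1 v = B (ψ p.1, p.2) (chartDeriv x p.1 v) := fun p hp ht v =>
    (S.hypersurface _ ht).diff_normal_eq hp v
  set g : SpaceTime n × EuclideanSpace ℝ (Fin n) → ℝ := fun r =>
    Q (ψ.symm r.1.1) r.1.2 * ⟪B r.1 r.2, B r.1 r.2⟫ - ⟪A r.1 r.2, B r.1 r.2⟫ with hg
  have hgc : ContinuousOn g (D ×ˢ Set.univ) := by
    have h1 : ContinuousOn (fun r : SpaceTime n × EuclideanSpace ℝ (Fin n) => A r.1 r.2)
        (D ×ˢ Set.univ) :=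
      (hAc.comp continuousOn_fst fun r hr => hr.1).clm_apply continuousOn_snd
    have h2 : ContinuousOn (fun r : SpaceTime n × EuclideanSpace ℝ (Fin n) => B r.1 r.2)
        (D ×ˢ Set.univ) :=
      (hBc.comp continuousOn_fst fun r hr => hr.1).clm_apply continuousOn_snd
    exact ((hQc.comp continuousOn_fst fun r hr => hr.1).mul (h2.inner h2)).sub (h1.inner h2)
  have hp0 : (ψ x, t) ∈ D := ⟨ψ.map_source hxs, ht⟩
  have hpos : ∀ w ∈ Metric.sphere (0 : EuclideanSpace ℝ (Fin n)) 1, 0 < g ((ψ x, t), w) := by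
    intro w hw
    obtain ⟨v, rfl⟩ := (chartDeriv_bijective hxs).2 w
    have hv : v ≠ 0 := by
      rintro rfl
      simp at hw
    have h1 := hx v hv
    rw [hdX (x, t) hxs ht, hdν (x, t) hxs ht] at h1
    simp only [hg, ψ.left_inv hxs]
    exact sub_pos.2 h1
  have hnear : ∀ᶠ p in 𝓝 (ψ x, t), ∀ w ∈ Metric.sphere (0 : EuclideanSpace ℝ (Fin n)) 1,
      p ∈ D → 0 < g (p, w) := by
    refine (isCompact_sphere _ _).eventually_forall_of_forall_eventually fun w hw => ?_
    have h1 := (hgc ((ψ x, t), w) ⟨hp0, Set.mem_univ _⟩).eventually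
      (lt_mem_nhds (hpos w hw))
    filter_upwards [eventually_nhdsWithin_iff.1 h1] with r hr hrD
    exact hr ⟨hrD, Set.mem_univ _⟩
  have hcont : ContinuousAt (fun p : M × ℝ => (ψ p.1, p.2)) (x, t) :=
    (ContinuousAt.comp (f := Prod.fst) (x := (x, t)) (continuousAt_extChartAt x)
      continuousAt_fst).prodMk continuousAt_snd
  have hsrc : ∀ᶠ p : M × ℝ in 𝓝 (x, t), p.1 ∈ ψ.source :=
    continuousAt_fst.eventually_mem (extChartAt_source_mem_nhds x)
  filter_upwards [hcont.eventually hnear, hsrc] with p hp hps hpt v hv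
  rw [hdX p hps hpt, hdν p hps hpt]
  set w := chartDeriv x p.1 v with hw
  have hw0 : w ≠ 0 := fun h0 => hv ((chartDeriv_bijective hps).1 (by rw [← hw, h0, map_zero]))
  have hwn : 0 < ‖w‖ := norm_pos_iff.2 hw0
  have h1 := hp (‖w‖⁻¹ • w) (by simp [norm_smul, hwn.ne']) ⟨ψ.map_source hps, hpt⟩
  simp only [hg, map_smul, inner_smul_left, inner_smul_right, ψ.left_inv hps, conj_trivial] at h1
  have h2 : 0 < ‖w‖⁻¹ * ‖w‖⁻¹ * (Q p.1 p.2 * ⟪B (ψ p.1, p.2) w, B (ψ p.1, p.2) w⟫ -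
      ⟪A (ψ p.1, p.2) w, B (ψ p.1, p.2) w⟫) := by linarith
  exact sub_pos.1 (pos_of_mul_pos_right h2 (by positivity))

/-- A bound for the radii of curvature at all earlier times persists. -/
lemma inner_le_of_forall_lt (S : IsConvexSolution k o T X ν) {Q : M → ℝ → ℝ}
    (hQ : ContinuousOn (fun p : M × ℝ => Q p.1 p.2) (Set.univ ×ˢ timeInterval T)) {t₀ : ℝ}
    (ht₀ : t₀ ∈ timeInterval T) (hpos : 0 < t₀) {x : M}
    (h : ∀ t ∈ timeInterval T, t < t₀ → RadiiLT (X t) (ν t) (Q x t) x)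
    (v : EuclideanSpace ℝ (Fin n)) :
    ⟪diff (X t₀) x v, diff (ν t₀) x v⟫ ≤ Q x t₀ * ⟪diff (ν t₀) x v, diff (ν t₀) x v⟫ := by
  have hI := timeInterval_mem_nhds ht₀ hpos
  have hxs : x ∈ (extChartAt (𝓡 n) x).source := mem_extChartAt_source x
  have key : ∀ f : ℝ → M → Amb n, ContMDiffOn ((𝓡 n).prod 𝓘(ℝ, ℝ)) 𝓘(ℝ, Amb n) ∞
      (fun p : M × ℝ => f p.2 p.1) (Set.univ ×ˢ timeInterval T) →
      (∀ t ∈ timeInterval T, MDifferentiableAt (𝓡 n) 𝓘(ℝ, Amb n) (f t) x) →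
      ContinuousAt (fun t => diff (f t) x v) t₀ := by
    intro f hf hfd
    have h1 : ContinuousOn (fun t => fderiv ℝ (f t ∘ (extChartAt (𝓡 n) x).symm)
        (extChartAt (𝓡 n) x x) (chartDeriv x x v)) (timeInterval T) :=
      ((continuousOn_fderiv_chart hf x).comp
        (f := fun t => (extChartAt (𝓡 n) x x, t)) (by fun_prop)
        fun t ht => ⟨(extChartAt (𝓡 n) x).map_source hxs, ht⟩).clm_apply continuousOn_const
    exact (h1.congr fun t ht => diff_eq_fderiv_chart hxs (hfd t ht) v).continuousAt hI
  have hX := key X S.smooth fun t ht => (S.hypersurface t ht).mdifferentiableAt x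
  have hν := key ν S.smooth_normal fun t ht => (S.hypersurface t ht).mdifferentiableAt_normal x
  have hQx : ContinuousAt (fun t => Q x t) t₀ :=
    (hQ.comp (f := fun t => (x, t)) (by fun_prop)
      fun t ht => ⟨Set.mem_univ _, ht⟩).continuousAt hI
  have hXν : ContinuousAt (fun t => ⟪diff (X t) x v, diff (ν t) x v⟫) t₀ := hX.inner hν
  have hνν : ContinuousAt (fun t => ⟪diff (ν t) x v, diff (ν t) x v⟫) t₀ := hν.inner hν
  have hc1 := hXν.tendsto.mono_left (nhdsWithin_le_nhds (s := Set.Iio t₀))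
  have hc2 := (hQx.mul hνν).tendsto.mono_left (nhdsWithin_le_nhds (s := Set.Iio t₀))
  refine le_of_tendsto_of_tendsto hc1 hc2 ?_
  filter_upwards [nhdsWithin_le_nhds hI, self_mem_nhdsWithin] with t ht1 ht2
  rcases eq_or_ne v 0 with rfl | hv
  · simp
  · exact (h t ht1 ht2 v hv).le

end IsConvexSolution

end Radii

/-! ### Absence of a first touching time, and the curvature bound -/

section Main

variable {n : ℕ} {M : Type*} [TopologicalSpace M] [ChartedSpace (EuclideanSpace ℝ (Fin n)) M]
  [IsManifold (𝓡 n) ∞ M] {k : ℕ} {o : Amb n} {T : EReal} {X ν : ℝ → M → Amb n}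

/-- The support function is positive, quantitatively. -/
lemma IsEnclosingHypersurface.le_neg_inner_normal [CompactSpace M] [ConnectedSpace M]
    {X ν : M → Amb n} (h : IsEnclosingHypersurface o X ν) (hc : IsStrictlyConvex X ν) (hn : 0 < n)
    (ho : ‖o‖ = 1) {G r₁ : ℝ} (hG : RadialGradientBound o X G) (hr₁ : 0 < r₁)
    (hr : ∀ x, r₁ ≤ rho o (X x) ∧ rho o (X x) ≤ Real.pi / 2) (x : M) :
    Real.sin r₁ ^ 4 / (1 + G ^ 2) ≤ -⟪o, ν x⟫ := by
  have hsq : ∀ y, Real.sin r₁ ^ 4 / (1 + G ^ 2) ≤ ⟪o, ν y⟫ ^ 2 := fun y =>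
    le_sq_inner_normal h ho hG hr₁ y (hr y).1 (hr y).2
  have hs1 : 0 < Real.sin r₁ := Real.sin_pos_of_pos_of_lt_pi hr₁ (by
    linarith [Real.pi_pos, (hr x).1, (hr x).2])
  have hu₀ : 0 < Real.sin r₁ ^ 4 / (1 + G ^ 2) := by positivity
  have hX : Continuous fun y => ⟪o, X y⟫ := continuous_const.inner h.smooth.continuous
  have hν : Continuous fun y => ⟪o, ν y⟫ := continuous_const.inner h.smooth_normal.continuous
  obtain ⟨y, -, hy⟩ := isCompact_univ.exists_isMinOn (Set.univ_nonempty (α := M)) hX.continuousOn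
  have hneg : ⟪o, ν y⟫ < 0 := h.inner_normal_neg_of_isMin hc hn fun w => hy (Set.mem_univ w)
  have hx : ⟪o, ν x⟫ < 0 := by
    by_contra hcon
    push Not at hcon
    obtain ⟨w, -, hw⟩ := isPreconnected_univ.intermediate_value (Set.mem_univ y) (Set.mem_univ x)
      hν.continuousOn ⟨hneg.le, hcon⟩
    have := hsq w
    simp only at hw
    rw [hw] at this
    norm_num at this
    linarith
  have habs := abs_real_inner_le_norm o (ν x)
  rw [ho, h.unit_normal, one_mul] at habs
  have h1 := (abs_le.1 habs).1
  nlinarith [hsq x]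

lemma IsConvexSolution.smooth_chart (S : IsConvexSolution k o T X ν) (x₀ : M) :
    ContDiffOn ℝ ∞ (chartFun x₀ X)
      ((extChartAt (𝓡 n) x₀).target ×ˢ interior (timeInterval T)) ∧
    ContDiffOn ℝ ∞ (chartFun x₀ ν)
      ((extChartAt (𝓡 n) x₀).target ×ˢ interior (timeInterval T)) :=
  ⟨(contDiffOn_chartFun S.smooth x₀).mono (Set.prod_mono le_rfl interior_subset),
    (contDiffOn_chartFun S.smooth_normal x₀).mono (Set.prod_mono le_rfl interior_subset)⟩

lemma IsConvexSolution.spaceDeriv_chart (S : IsConvexSolution k o T X ν) (x₀ : M)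
    {p : SpaceTime n} (hp : p ∈ (extChartAt (𝓡 n) x₀).target ×ˢ interior (timeInterval T))
    (v : EuclideanSpace ℝ (Fin n)) :
    spaceDeriv (chartFun x₀ X) p (chartDeriv x₀ ((extChartAt (𝓡 n) x₀).symm p.1) v) =
      diff (X p.2) ((extChartAt (𝓡 n) x₀).symm p.1) v ∧
    spaceDeriv (chartFun x₀ ν) p (chartDeriv x₀ ((extChartAt (𝓡 n) x₀).symm p.1) v) =
      diff (ν p.2) ((extChartAt (𝓡 n) x₀).symm p.1) v := by
  have hWo : IsOpen ((extChartAt (𝓡 n) x₀).target ×ˢ interior (timeInterval T)) :=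
    (isOpen_extChartAt_target x₀).prod isOpen_interior
  have ht : p.2 ∈ timeInterval T := interior_subset hp.2
  have hx := (extChartAt (𝓡 n) x₀).map_target hp.1
  constructor
  · rw [spaceDeriv_chartFun ⟨hp.1, ht⟩
      (differentiableAt_of_smooth hWo (S.smooth_chart x₀).1 hp),
      (S.hypersurface _ ht).diff_eq hx, (extChartAt (𝓡 n) x₀).right_inv hp.1]
    rfl
  · rw [spaceDeriv_chartFun ⟨hp.1, ht⟩
      (differentiableAt_of_smooth hWo (S.smooth_chart x₀).2 hp),
      (S.hypersurface _ ht).diff_normal_eq hx, (extChartAt (𝓡 n) x₀).right_inv hp.1]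
    rfl

/-- In a chart, and at interior times, a solution with the a priori bounds is a `LocalFlow`. -/
lemma IsConvexSolution.localFlow (S : IsConvexSolution k o T X ν) (ho : ‖o‖ = 1)
    {F₀ μ u₀ : ℝ} (hs : ∀ t ∈ timeInterval T, ∀ x, Real.sin (rho o (X t x)) ≠ 0)
    (hF : ∀ t ∈ timeInterval T, ∀ x, curvQuot k (X t) (ν t) x ≤ F₀)
    (hμ : ∀ t ∈ timeInterval T, ∀ x, μ ≤ ⟪o, X t x⟫)
    (hu : ∀ t ∈ timeInterval T, ∀ x, u₀ ≤ -⟪o, ν t x⟫) (x₀ : M) :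
    LocalFlow ((extChartAt (𝓡 n) x₀).target ×ˢ interior (timeInterval T)) k o F₀ μ u₀
      (chartFun x₀ X) (chartFun x₀ ν) := by
  set ψ := extChartAt (𝓡 n) x₀ with hψ
  have hWo : IsOpen (ψ.target ×ˢ interior (timeInterval T)) :=
    (isOpen_extChartAt_target x₀).prod isOpen_interior
  have hsub : ψ.target ×ˢ interior (timeInterval T) ⊆ ψ.target ×ˢ timeInterval T :=
    Set.prod_mono le_rfl interior_subset
  obtain ⟨hX, hν⟩ := S.smooth_chart x₀
  have hdX : ∀ p ∈ ψ.target ×ˢ interior (timeInterval T), ∀ v,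
      spaceDeriv (chartFun x₀ X) p (chartDeriv x₀ (ψ.symm p.1) v) =
        diff (X p.2) (ψ.symm p.1) v := fun p hp v => (S.spaceDeriv_chart x₀ hp v).1
  have hdν : ∀ p ∈ ψ.target ×ˢ interior (timeInterval T), ∀ v,
      spaceDeriv (chartFun x₀ ν) p (chartDeriv x₀ (ψ.symm p.1) v) =
        diff (ν p.2) (ψ.symm p.1) v := fun p hp v => (S.spaceDeriv_chart x₀ hp v).2
  refine ⟨hWo, hX, hν, fun p hp v => ?_, fun p hp v w hvw => ?_, fun p hp => ?_,
    fun p hp => hμ _ (hsub hp).2 _, fun p hp => hu _ (hsub hp).2 _⟩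
  · obtain ⟨v, rfl⟩ := (chartDeriv_bijective (ψ.map_target hp.1)).2 v
    rw [hdX p hp]
    exact (S.hypersurface _ (hsub hp).2).normal _ v
  · obtain ⟨v, rfl⟩ := (chartDeriv_bijective (ψ.map_target hp.1)).2 v
    obtain ⟨w, rfl⟩ := (chartDeriv_bijective (ψ.map_target hp.1)).2 w
    rw [hdX p hp, hdX p hp] at hvw
    rw [(S.hypersurface _ (hsub hp).2).immersion _ hvw]
  · have ht := (hsub hp).2
    have h := S.hypersurface _ ht
    obtain ⟨q, κ, hq, hB, hκ⟩ := h.exists_frame (ψ.symm p.1)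
    refine ⟨fun a => chartDeriv x₀ (ψ.symm p.1) (q a), κ, ?_, fun a => ?_,
      (S.strictlyConvex _ ht).pos_of_frame hκ, ?_, ?_⟩
    · simp only [hdX p hp]
      exact hq
    · rw [hdX p hp, hdν p hp, hB]
    · rw [← IsEnclosingHypersurface.curvQuot_eq hκ]
      exact hF _ ht _
    · have hnhds : timeInterval T ∈ 𝓝 p.2 := mem_interior_iff_mem_nhds.1 hp.2
      have h1 := (S.flow _ ht (ψ.symm p.1)).hasDerivAt hnhds
      have hline : HasDerivAt (fun s : ℝ => (p.1, s)) ((0 : EuclideanSpace ℝ (Fin n)), (1 : ℝ)) p.2 :=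
        (hasDerivAt_const p.2 p.1).prodMk (hasDerivAt_id p.2)
      have h2 : HasDerivAt (fun s => chartFun x₀ X (p.1, s)) (dt (chartFun x₀ X) p) p.2 :=
        HasFDerivAt.comp_hasDerivAt (f := fun s : ℝ => (p.1, s)) p.2
          (differentiableAt_of_smooth hWo hX hp).hasFDerivAt hline
      rw [h2.unique h1, cos_rho ho (h.mem_hemisphere _).1,
        IsEnclosingHypersurface.curvQuot_eq hκ,
        support_eq ho (h.mem_hemisphere _).1 (hs _ ht _) (h.tangent_sphere _)]
      congr 1
      change _ = ((n : ℝ) - k) / (k + 1) * ⟪o, X p.2 (ψ.symm p.1)⟫ +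
        symmQuot Finset.univ k κ * ⟪o, ν p.2 (ψ.symm p.1)⟫
      ring

/-- The radii of curvature stay below the barrier: there is no first time at which they touch it. -/
lemma IsConvexSolution.radiiLT_barrier [CompactSpace M] (S : IsConvexSolution k o T X ν)
    (hk : k < n) (ho : ‖o‖ = 1) {F₀ μ u₀ C₀ : ℝ}
    (hs : ∀ t ∈ timeInterval T, ∀ x, Real.sin (rho o (X t x)) ≠ 0)
    (hF : ∀ t ∈ timeInterval T, ∀ x, curvQuot k (X t) (ν t) x ≤ F₀)
    (hμ : ∀ t ∈ timeInterval T, ∀ x, μ ≤ ⟪o, X t x⟫)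
    (hu : ∀ t ∈ timeInterval T, ∀ x, u₀ ≤ -⟪o, ν t x⟫) (hμ0 : 0 < μ) (hu₀ : 0 < u₀)
    (hC₀ : 0 < C₀) (hC : ((n : ℝ) - k) / (k + 1) + F₀ + F₀ / (2 * u₀) <
      C₀ * (μ / 8) * (((n : ℝ) - k) / (k + 1) * μ ^ 2))
    (hinit : ∀ x, RadiiLT (X 0) (ν 0) (barrier C₀ μ o (X 0 x) (ν 0 x)) x) {t : ℝ}
    (ht : t ∈ timeInterval T) (x : M) :
    RadiiLT (X t) (ν t) (barrier C₀ μ o (X t x) (ν t x)) x := by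
  set Q : M → ℝ → ℝ := fun x t => barrier C₀ μ o (X t x) (ν t x) with hQdef
  have hQ : ContinuousOn (fun p : M × ℝ => Q p.1 p.2) (Set.univ ×ˢ timeInterval T) := by
    have h1 := S.smooth.continuousOn
    have h2 := S.smooth_normal.continuousOn
    exact continuousOn_const.mul (((continuousOn_const.inner h1).sub continuousOn_const).sub
      (continuousOn_const.mul (continuousOn_const.inner h2)))
  by_contra hbad
  have hsubI : ∀ s ∈ Set.Icc 0 t, s ∈ timeInterval T := fun s hs =>
    ⟨hs.1, lt_of_le_of_lt (by exact_mod_cast hs.2) ht.2⟩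
  -- The set of bad points up to the time `t` is compact; consider its first time.
  set B : Set (M × ℝ) := {p | p.2 ∈ Set.Icc 0 t ∧ ¬RadiiLT (X p.2) (ν p.2) (Q p.1 p.2) p.1} with hB
  have hBclosed : IsClosed B := by
    rw [← isOpen_compl_iff, isOpen_iff_mem_nhds]
    intro p hp
    by_cases hpI : p.2 ∈ Set.Icc 0 t
    · have hgood : RadiiLT (X p.2) (ν p.2) (Q p.1 p.2) p.1 := by
        by_contra h
        exact hp ⟨hpI, h⟩
      filter_upwards [S.eventually_radiiLT hQ (hsubI _ hpI) hgood] with p' hp' hcon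
      exact hcon.2 (hp' (hsubI _ hcon.1))
    · filter_upwards [continuousAt_snd.eventually_mem (isClosed_Icc.isOpen_compl.mem_nhds hpI)]
        with p' hp' hcon
      exact hp' hcon.1
  have hBc : IsCompact B :=
    (isCompact_univ.prod (isCompact_Icc (a := 0) (b := t))).of_isClosed_subset hBclosed
      fun p hp => ⟨Set.mem_univ _, hp.1⟩
  obtain ⟨t₀, ⟨⟨x₀, t₁⟩, ⟨hI, hx₀⟩, rfl⟩, hmin⟩ := (hBc.image continuous_snd).exists_isLeast
    ⟨t, (x, t), ⟨⟨ht.1, le_rfl⟩, hbad⟩, rfl⟩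
  simp only at hI hx₀ hmin
  have hI' := hsubI _ hI
  have hpos : 0 < t₁ := by
    rcases hI.1.eq_or_lt with h | h
    · rw [← h] at hx₀
      exact absurd (hinit x₀) hx₀
    · exact h
  have hbefore : ∀ s ∈ timeInterval T, s < t₁ → ∀ y, RadiiLT (X s) (ν s) (Q y s) y := by
    intro s hs hst y
    by_contra h
    have := hmin ⟨(y, s), ⟨⟨hs.1, hst.le.trans hI.2⟩, h⟩, rfl⟩
    exact absurd hst (not_lt.2 this)
  have hle : ∀ s ∈ timeInterval T, s ≤ t₁ → ∀ y, ∀ v : EuclideanSpace ℝ (Fin n),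
      ⟪diff (X s) y v, diff (ν s) y v⟫ ≤ Q y s * ⟪diff (ν s) y v, diff (ν s) y v⟫ := by
    intro s hs hst y v
    rcases hst.eq_or_lt with rfl | hst
    · exact S.inner_le_of_forall_lt hQ hs hpos (fun s hs hst => hbefore s hs hst y) v
    · rcases eq_or_ne v 0 with rfl | hv
      · simp
      · exact (hbefore s hs hst y v hv).le
  have hL := S.localFlow ho hs hF hμ hu x₀
  set ψ := extChartAt (𝓡 n) x₀ with hψ
  have hxs : x₀ ∈ ψ.source := mem_extChartAt_source x₀
  have hint : t₁ ∈ interior (timeInterval T) :=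
    mem_interior_iff_mem_nhds.2 (timeInterval_mem_nhds hI' hpos)
  have hsub : ∀ p ∈ ψ.target ×ˢ interior (timeInterval T), p.2 ∈ timeInterval T :=
    fun p hp => interior_subset hp.2
  have hdX : ∀ p ∈ ψ.target ×ˢ interior (timeInterval T), ∀ v,
      spaceDeriv (chartFun x₀ X) p (chartDeriv x₀ (ψ.symm p.1) v) =
        diff (X p.2) (ψ.symm p.1) v := fun p hp v => (S.spaceDeriv_chart x₀ hp v).1
  have hdν : ∀ p ∈ ψ.target ×ˢ interior (timeInterval T), ∀ v,
      spaceDeriv (chartFun x₀ ν) p (chartDeriv x₀ (ψ.symm p.1) v) =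
        diff (ν p.2) (ψ.symm p.1) v := fun p hp v => (S.spaceDeriv_chart x₀ hp v).2
  have hp₀ : (ψ x₀, t₁) ∈ ψ.target ×ˢ interior (timeInterval T) := ⟨ψ.map_source hxs, hint⟩
  have hoo : ⟪o, o⟫ = 1 := by rw [real_inner_self_eq_norm_sq, ho, one_pow]
  refine hL.not_touching hk hoo hμ0 hu₀ hC₀ hC hp₀ (fun p hp hpt v => ?_) ?_
  · obtain ⟨v, rfl⟩ := (chartDeriv_bijective (ψ.map_target hp.1)).2 v
    rw [hdX p hp, hdν p hp]
    exact hle _ (hsub p hp) hpt _ v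
  · have hx₀' := hx₀
    unfold RadiiLT at hx₀'
    push Not at hx₀'
    obtain ⟨v, hv, hv'⟩ := hx₀'
    have hinv : ψ.symm (ψ x₀) = x₀ := ψ.left_inv hxs
    refine ⟨chartDeriv x₀ x₀ v, fun h0 => hv ((chartDeriv_bijective hxs).1 (by rw [h0, map_zero])),
      ?_⟩
    have e1 := hdX _ hp₀ v
    have e2 := hdν _ hp₀ v
    simp only [hinv] at e1 e2
    rw [e1, e2]
    have e3 : chartFun x₀ X (ψ x₀, t₁) = X t₁ x₀ := congrArg (X t₁) hinv
    have e4 : chartFun x₀ ν (ψ x₀, t₁) = ν t₁ x₀ := congrArg (ν t₁) hinv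
    rw [e3, e4]
    exact hv'

/-- On a closed manifold the radii of curvature at the initial time are bounded. -/
lemma IsConvexSolution.exists_initial_bound [CompactSpace M] (S : IsConvexSolution k o T X ν)
    (h0 : (0 : ℝ) ∈ timeInterval T) : ∃ L, ∀ x, RadiiLT (X 0) (ν 0) L x := by
  have hmono : ∀ {L L' : ℝ} {x : M}, L ≤ L' → RadiiLT (X 0) (ν 0) L x →
      RadiiLT (X 0) (ν 0) L' x := fun hL h v hv =>
    (h v hv).trans_le (mul_le_mul_of_nonneg_right hL real_inner_self_nonneg)
  have := isCompact_univ (X := M).induction_on (p := fun s => ∃ L, ∀ x ∈ s, RadiiLT (X 0) (ν 0) L x)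
    ⟨0, fun x hx => hx.elim⟩ (fun s t hst ⟨L, hL⟩ => ⟨L, fun x hx => hL x (hst hx)⟩)
    (fun s t ⟨L, hL⟩ ⟨L', hL'⟩ => ⟨max L L', fun x hx => hx.elim
      (fun hx => hmono (le_max_left _ _) (hL x hx))
      fun hx => hmono (le_max_right _ _) (hL' x hx)⟩)
    (fun x _ => by
      obtain ⟨L, hL⟩ := (S.hypersurface 0 h0).exists_radiiLT (S.strictlyConvex 0 h0) x
      have h1 := S.eventually_radiiLT (Q := fun _ _ => L) continuousOn_const h0 hL
      have h2 : ContinuousAt (fun y : M => (y, (0 : ℝ))) x := by fun_prop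
      refine ⟨_, mem_nhdsWithin_of_mem_nhds (h2.eventually h1), L, fun y hy => hy h0⟩)
  obtain ⟨L, hL⟩ := this
  exact ⟨L, fun x => hL x (Set.mem_univ x)⟩

end Main

end SphereFlow

end

theorem lemma3p2 {n k : ℕ} (hk : k < n) {M : Type*} [TopologicalSpace M] [T2Space M]
    [CompactSpace M] [ConnectedSpace M] [ChartedSpace (EuclideanSpace ℝ (Fin n)) M]
    [IsManifold (𝓡 n) ∞ M] (o : SphereFlow.Amb n) (ho : ‖o‖ = 1) (X₀ : M → SphereFlow.Amb n)
    (r₁ r₂ G F₀ : ℝ) (hr₁ : 0 < r₁) (hr₂ : r₂ < Real.pi / 2) :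
    ∃ C : ℝ, 0 < C ∧ ∀ (T : EReal) (X ν : ℝ → M → SphereFlow.Amb n),
      SphereFlow.IsConvexSolution k o T X ν → X 0 = X₀ →
      (∀ t ∈ SphereFlow.timeInterval T, ∀ x,
        r₁ ≤ SphereFlow.rho o (X t x) ∧ SphereFlow.rho o (X t x) ≤ r₂) →
      (∀ t ∈ SphereFlow.timeInterval T, SphereFlow.RadialGradientBound o (X t) G) →
      (∀ t ∈ SphereFlow.timeInterval T, ∀ x, SphereFlow.curvQuot k (X t) (ν t) x ≤ F₀) →
      ∀ t ∈ SphereFlow.timeInterval T, ∀ x,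
        ∀ κ ∈ SphereFlow.principalCurvatures (X t) (ν t) x, 1 / C ≤ κ := by
  open SphereFlow in
  have hn : 0 < n := by omega
  -- The constant may depend on `X₀` only, so it is taken from one solution starting at `X₀`; the
  -- others have the same initial curvatures because the unit normal is determined by `X₀`.
  by_cases hex : ∃ (T : EReal) (X ν : ℝ → M → Amb n), IsConvexSolution k o T X ν ∧ X 0 = X₀ ∧
      (0 : ℝ) ∈ timeInterval T ∧ ∀ x, r₁ ≤ rho o (X 0 x) ∧ rho o (X 0 x) ≤ r₂
  swap
  · refine ⟨1, one_pos, fun T X ν S hX hr _ _ t ht => ?_⟩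
    have h0 : (0 : ℝ) ∈ timeInterval T := ⟨le_rfl, lt_of_le_of_lt (by exact_mod_cast ht.1) ht.2⟩
    exact absurd ⟨T, X, ν, S, hX, h0, hr 0 h0⟩ hex
  obtain ⟨T', X', ν', S', hX', h0', hr'⟩ := hex
  obtain ⟨L, hL⟩ := S'.exists_initial_bound h0'
  obtain ⟨x₀⟩ := (inferInstance : Nonempty M)
  have hr12 : r₁ ≤ r₂ := (hr' x₀).1.trans (hr' x₀).2
  set μ : ℝ := Real.cos r₂ with hμ
  have hμ0 : 0 < μ := Real.cos_pos_of_mem_Ioo ⟨by linarith [Real.pi_pos], hr₂⟩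
  set u₀ : ℝ := Real.sin r₁ ^ 4 / (1 + G ^ 2) with hu₀
  have hs1 : 0 < Real.sin r₁ := Real.sin_pos_of_pos_of_lt_pi hr₁ (by linarith [Real.pi_pos])
  have hu₀0 : 0 < u₀ := by positivity
  set c : ℝ := ((n : ℝ) - k) / (k + 1) with hc
  have hc0 : 0 < c := by
    have : (k : ℝ) < n := by exact_mod_cast hk
    exact div_pos (by linarith) (by positivity)
  -- The constant of the barrier.
  obtain ⟨C₀, hC₀, hC₁, hC₂⟩ : ∃ C₀ : ℝ, 0 < C₀ ∧
      c + F₀ + F₀ / (2 * u₀) < C₀ * (μ / 8) * (c * μ ^ 2) ∧ L ≤ C₀ * (μ / 2) := by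
    have h1 := Filter.tendsto_id.atTop_mul_const (show 0 < μ / 8 * (c * μ ^ 2) by positivity)
      (l := Filter.atTop (α := ℝ))
    have h2 := Filter.tendsto_id.atTop_mul_const (show 0 < μ / 2 by positivity)
      (l := Filter.atTop (α := ℝ))
    obtain ⟨C₀, h3, h4, h5⟩ := ((Filter.eventually_gt_atTop 0).and
      ((h1.eventually_gt_atTop (c + F₀ + F₀ / (2 * u₀))).and (h2.eventually_ge_atTop L))).exists
    exact ⟨C₀, h3, by simpa [mul_assoc] using h4, h5⟩
  refine ⟨C₀, hC₀, fun T X ν S hX hr hG hF t ht x => ?_⟩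
  have h0 : (0 : ℝ) ∈ timeInterval T := ⟨le_rfl, lt_of_le_of_lt (by exact_mod_cast ht.1) ht.2⟩
  have hνeq : ν 0 = ν' 0 := by
    have h1 := S'.hypersurface 0 h0'
    have h2 := S'.strictlyConvex 0 h0'
    rw [hX', ← hX] at h1 h2
    exact (S.hypersurface 0 h0).normal_unique hn (S.strictlyConvex 0 h0) h1 h2
  have hXμ : ∀ t ∈ timeInterval T, ∀ x, μ ≤ ⟪o, X t x⟫ := fun t ht x => by
    rw [← cos_rho ho ((S.hypersurface t ht).mem_hemisphere x).1]
    exact Real.cos_le_cos_of_nonneg_of_le_pi (by linarith [(hr t ht x).1])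
      (by linarith [Real.pi_pos]) (hr t ht x).2
  have hνu : ∀ t ∈ timeInterval T, ∀ x, u₀ ≤ -⟪o, ν t x⟫ := fun t ht x =>
    (S.hypersurface t ht).le_neg_inner_normal (S.strictlyConvex t ht) hn ho (hG t ht) hr₁
      (fun y => ⟨(hr t ht y).1, (hr t ht y).2.trans hr₂.le⟩) x
  have hsin : ∀ t ∈ timeInterval T, ∀ x, Real.sin (rho o (X t x)) ≠ 0 := fun t ht x =>
    (Real.sin_pos_of_pos_of_lt_pi (hr₁.trans_le (hr t ht x).1)
      (by linarith [Real.pi_pos, (hr t ht x).2])).ne'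
  have hinit : ∀ x, RadiiLT (X 0) (ν 0) (barrier C₀ μ o (X 0 x) (ν 0 x)) x := fun x v hv => by
    have h1 := hL x v hv
    rw [hX', ← hX, ← hνeq] at h1
    refine h1.trans_le (mul_le_mul_of_nonneg_right (hC₂.trans ?_) real_inner_self_nonneg)
    refine mul_le_mul_of_nonneg_left ?_ hC₀.le
    have h2 := mul_pos hμ0 (hu₀0.trans_le (hνu 0 h0 x))
    linarith [hXμ 0 h0 x]
  have hgood := S.radiiLT_barrier hk ho hsin hF hXμ hνu hμ0 hu₀0 hC₀ hC₁ hinit ht x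
  have h := S.hypersurface t ht
  obtain ⟨q, κ, hq, hB, hκ⟩ := h.exists_frame x
  rw [hκ]
  intro κ' hκ'
  obtain ⟨a, -, rfl⟩ := Multiset.mem_map.1 hκ'
  have hpos := (S.strictlyConvex t ht).pos_of_frame hκ a
  have haa := hq.inner_frame a a
  simp only [if_true] at haa
  have hq0 : q a ≠ 0 := fun h0 => by simp [h0] at haa
  have h1 := hgood (q a) hq0
  rw [hB, inner_smul_right, inner_smul_left, inner_smul_right, haa] at h1
  simp only [conj_trivial, mul_one] at h1
  have h2 : 1 < barrier C₀ μ o (X t x) (ν t x) * κ a := by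
    by_contra hcon
    push Not at hcon
    nlinarith [mul_nonneg hpos.le (sub_nonneg.2 hcon)]
  have h3 : barrier C₀ μ o (X t x) (ν t x) ≤ C₀ := by
    refine mul_le_of_le_one_right hC₀.le ?_
    have b1 := abs_real_inner_le_norm o (X t x)
    have b2 := abs_real_inner_le_norm o (ν t x)
    rw [ho, (h.mem_hemisphere x).1, one_mul] at b1
    rw [ho, h.unit_normal, one_mul] at b2
    have b3 := mul_le_mul_of_nonneg_left (abs_le.1 b2).1 (show 0 ≤ μ / 8 by positivity)
    linarith [(abs_le.1 b1).2]
  rw [div_le_iff₀ hC₀]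
  have h4 := mul_le_mul_of_nonneg_right h3 hpos.le
  linarith
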